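/- Let $\Bbbk$ be an algebraically closed field of characteristic $0$, let $\xi\in\Bbbk$ be a primitive $4$-th root of unity, and let $G=\langle x,y\mid x^4=y^2=1,\ xy=yx\rangle$. Let $t$ generate $\mathbb Z_2$ and act on $G$ by the automorphism $x\triangleleft t=xy$, $y\triangleleft t=y$. Put $$\sigma(x^iy^j;t,t)=(-1)^{i(i-1)/2},\qquad \tau(x^iy^j,x^ky^l;t)=(-1)^{jk},$$ and let $\sigma(g;s,s')=1$ when $s=1$ or $s'=1$, and $\tau(g,h;1)=1$. Let $H=H_{c:\sigma_0}$ be Kashina's $16$-dimensional semisimple Hopf algebra: it has basis $\{e_g\#s : g\in G,\ s\in\mathbb Z_2\}$ and structure $$(e_g\#s)(e_h\#s')=\delta_{g\triangleleft s,h}\,\sigma(g;s,s')\,e_g\#ss',\qquad \Delta(e_g\#s)=\sum_{ab=g}\tau(a,b;s)\,(e_a\#s)\otimes(e_b\#s),\qquad \varepsilon(e_g\#s)=\delta_{g,1},$$ $$S(e_g\#s)=\sigma(g^{-1};s,s^{-1})^{-1}\,\tau(g^{-1},g;s)^{-1}\,e_{(g\triangleleft s)^{-1}}\#s^{-1}.$$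 Write $e_g=e_g\#1$, $t=\sum_g e_g\#t$, so $e_gt=e_g\#t$, and let $\{\zeta_g,\chi_g\}_{g\in G}$ be the basis of $H^*$ dual to $\{e_g,e_gt\}_{g\in G}$. The Drinfel'd double $D(H)$ is $H^*\otimes H$ with unit $\varepsilon\otimes1$ and product $$(\phi\otimes h)(\phi'\otimes h')=\phi\,\langle\phi'_3,h_1\rangle\,\phi'_2\otimes h_2\,\langle\phi'_1,S^{-1}(h_3)\rangle\,h'.$$ **Theorem.** There are exactly $88$ isomorphism classes of simple left $D(H)$-modules; $32$ of them are one-dimensional and $56$ are two-dimensional. Representatives are the following modules, which are simple and pairwise non-isomorphic. Matrices are in a basis $v$ or $(v,w)$, with columns the images of the basis vectors. Write $\delta_\mu$ for the function $g\mapsto\delta_{g,\mu}$. In (S0)–(S2), $\chi_g\mapsto0$ and $\zeta_{x^ky^l}\mapsto\zeta_x^k\zeta_y^l$ for all $g=x^ky^l\in G$; in (S3)–(S4), $\zeta_g\mapsto0$ and $\chi_{x^ky^l}\mapsto\chi_x^k\chi_y^l$ (with zeroth powers equal to the identity matrix). Put $$P=\begin{pmatrix}0&1\\1&0\end{pmatrix},\qquad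 J=\begin{pmatrix}0&-1\\1&0\end{pmatrix},\qquad D=\begin{pmatrix}1&0\\0&-1\end{pmatrix},\qquad I=\begin{pmatrix}1&0\\0&1\end{pmatrix}.$$ * (S0) $V^{\pm}_{\mu,i}$, $\mu=x^{2a}y^b$, $a,b\in\{0,1\}$, $0\le i\le3$ ($32$ modules of dimension $1$): $e_g\mapsto\delta_{g,\mu}$, $t\mapsto\pm\xi^a$, $\zeta_x\mapsto\xi^i$, $\zeta_y\mapsto(-1)^b$. * (S1) $W_{\mu,i,\pm}$, $\mu=x^{1+2c}$, $c\in\{0,1\}$, $0\le i\le3$ ($16$ modules of dimension $2$): $e_g\mapsto\mathrm{diag}(\delta_{g,\mu},\delta_{g,\mu y})$; $t\mapsto P$ if $c=0$ and $t\mapsto J$ if $c=1$; $\zeta_x\mapsto\mathrm{diag}(\pm\xi^i,\xi^i)$, $\zeta_y\mapsto\mp D$. * (S2) $X_{\mu,i}$, $\mu=x^{2a}y^b$, $a,b\in\{0,1\}$, $i\in\{0,1\}$ ($8$ modules of dimension $2$): $e_g\mapsto\delta_{g,\mu}I$; $t\mapsto P$ if $a=0$ and $t\mapsto J$ if $a=1$;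 $\zeta_x\mapsto\xi^iD$, $\zeta_y\mapsto-(-1)^bI$. * (S3) $Y_{\mu,j}$, $\mu\in\{x,x^3\}$, $1\le j\le8$ ($16$ modules of dimension $2$): $e_g\mapsto\mathrm{diag}(\delta_{g,\mu},\delta_{g,\mu y})$, and $(t,\chi_x,\chi_y)$ is, for $j=1,\dots,8$ in this order, * $\mu=x$: $(\xi J,P,D)$, $(-\xi J,P,D)$, $(\xi J,J,-D)$, $(-\xi J,J,-D)$, $(P,J,D)$, $(-P,J,D)$, $(P,P,-D)$, $(-P,P,-D)$; * $\mu=x^3$: $(\xi P,J,D)$, $(-\xi P,J,D)$, $(\xi P,P,-D)$, $(-\xi P,P,-D)$, $(J,P,D)$, $(-J,P,D)$, $(J,J,-D)$, $(-J,J,-D)$. * (S4) $Z_{\mu,j}$, $\mu=x^{2c}$, $c\in\{0,1\}$, $1\le j\le8$ ($16$ modules of dimension $2$): $e_g\mapsto\mathrm{diag}(\delta_{g,\mu},\delta_{g,\mu y})$, and $(t,\chi_x,\chi_y)$ is, for $j=1,\dots,8$ in this order, $(\xi^cI,P,-D)$, $(-\xi^cI,P,-D)$, $(\xi^cI,J,-D)$,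 $(-\xi^cI,J,-D)$, $(\xi^cD,P,D)$, $(-\xi^cD,P,D)$, $(\xi^cD,J,D)$, $(-\xi^cD,J,D)$. Equivalently, the same list classifies the simple Yetter–Drinfel'd modules over $H$ up to isomorphism, both * the left-right ones (left $H$-module, right $H$-comodule, $\rho(h\cdot v)=h_2\cdot v_0\otimes h_3v_1S^{-1}(h_1)$), where on each listed space $H$ acts by the given matrices and $\rho(v)=\sum_{g\in G}(\zeta_gv\otimes e_g+\chi_gv\otimes e_gt)$, and * the left-left ones (left $H$-module, left $H$-comodule, $\rho_l(h\cdot v)=h_1v_{-1}S(h_3)\otimes h_2\cdot v_0$), where on each listed space $H$ acts by the given matrices and $\rho_l(v)=\sum_{g\in G}(S(e_g)\otimes\zeta_gv+S(e_gt)\otimes\chi_gv)$. In each of the three settings the listed $88$ modules are simple and pairwise non-isomorphic, and every simple module is isomorphic to one of them. -/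

import Mathlib

open scoped TensorProduct

universe u v w

/-! ### Yetter–Drinfel'd modules over a Hopf algebra -/

section General

open Coalgebra

/-- A Hopf algebra whose antipode is bijective. -/
class BijectiveAntipode (k : Type u) (H : Type v) [Field k] [Ring H] [HopfAlgebra k H] : Prop where
  bijective : Function.Bijective (HopfAlgebra.antipode k : H →ₗ[k] H)

variable (k : Type u) (H : Type v) [Field k] [Ring H] [HopfAlgebra k H]

/-- The inverse `S⁻¹` of the antipode. -/
noncomputable def antipodeInv [BijectiveAntipode k H] : H →ₗ[k] H :=
  (LinearEquiv.ofBijective (HopfAlgebra.antipode k : H →ₗ[k] H)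
    BijectiveAntipode.bijective).symm.toLinearMap

/-- The iterated coproduct `h ↦ h₁ ⊗ (h₂ ⊗ h₃)`. -/
noncomputable def comul₃ : H →ₗ[k] H ⊗[k] (H ⊗[k] H) :=
  (comul : H →ₗ[k] H ⊗[k] H).lTensor H ∘ₗ comul

/-- The linear map `a ⊗ (b ⊗ c) ↦ f a b c` attached to a trilinear map `f`. -/
noncomputable def lift₃ {k : Type u} {H : Type v} [Field k] [Ring H] [HopfAlgebra k H]
    {W : Type*} [AddCommMonoid W] [Module k W] (f : H →ₗ[k] H →ₗ[k] H →ₗ[k] W) :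
    H ⊗[k] (H ⊗[k] H) →ₗ[k] W :=
  TensorProduct.lift ((TensorProduct.uncurry (RingHom.id k) H H W).comp f)

/-- The trilinear map `(a, b, c) ↦ (v ⊗ x ↦ (b · v) ⊗ c x S⁻¹(a))`. -/
noncomputable def twistLR {k : Type u} {H : Type v} [Field k] [Ring H] [HopfAlgebra k H]
    [BijectiveAntipode k H] {V : Type w} [AddCommGroup V] [Module k V]
    (act : H →ₐ[k] Module.End k V) :
    H →ₗ[k] H →ₗ[k] H →ₗ[k] (V ⊗[k] H →ₗ[k] V ⊗[k] H) :=
  LinearMap.mk₂ k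
    (fun a b =>
      { toFun := fun c => TensorProduct.map (act b)
          (LinearMap.mulLeft k c ∘ₗ LinearMap.mulRight k (antipodeInv k H a))
        map_add' := fun c c' => by ext; simp [add_mul, TensorProduct.tmul_add]
        map_smul' := fun r c => by ext; simp })
    (fun a a' b => by ext; simp [mul_add, TensorProduct.tmul_add])
    (fun r a b => by ext; simp)
    (fun a b b' => by ext; simp [TensorProduct.add_tmul])
    (fun r a b => by ext; simp [TensorProduct.smul_tmul'])

/-- The trilinear map `(a, b, c) ↦ (x ⊗ v ↦ a x S(c) ⊗ (b · v))`. -/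
noncomputable def twistLL {k : Type u} {H : Type v} [Field k] [Ring H] [HopfAlgebra k H]
    {V : Type w} [AddCommGroup V] [Module k V]
    (act : H →ₐ[k] Module.End k V) :
    H →ₗ[k] H →ₗ[k] H →ₗ[k] (H ⊗[k] V →ₗ[k] H ⊗[k] V) :=
  LinearMap.mk₂ k
    (fun a b =>
      { toFun := fun c => TensorProduct.map
          (LinearMap.mulLeft k a ∘ₗ LinearMap.mulRight k (HopfAlgebra.antipode k c)) (act b)
        map_add' := fun c c' => by ext; simp [mul_add, TensorProduct.add_tmul]
        map_smul' := fun r c => by ext; simp [TensorProduct.smul_tmul'] })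
    (fun a a' b => by ext; simp [add_mul, TensorProduct.add_tmul])
    (fun r a b => by ext; simp [TensorProduct.smul_tmul'])
    (fun a b b' => by ext; simp [TensorProduct.tmul_add])
    (fun r a b => by ext; simp)

/-- A left-right Yetter–Drinfel'd module structure on the vector space `V`: a left `H`-action and a
right `H`-coaction `ρ(v) = v₀ ⊗ v₁` with `ρ(h · v) = h₂ · v₀ ⊗ h₃ v₁ S⁻¹(h₁)`. -/
structure LeftRightYD [BijectiveAntipode k H] (V : Type w) [AddCommGroup V] [Module k V] where
  act : H →ₐ[k] Module.End k V
  coact : V →ₗ[k] V ⊗[k] H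
  coassoc : (TensorProduct.assoc k V H H).toLinearMap ∘ₗ coact.rTensor H ∘ₗ coact =
    (comul : H →ₗ[k] H ⊗[k] H).lTensor V ∘ₗ coact
  counit_coact : (TensorProduct.rid k V).toLinearMap ∘ₗ
    (counit : H →ₗ[k] k).lTensor V ∘ₗ coact = LinearMap.id
  compat : ∀ (h : H) (v : V), coact (act h v) = lift₃ (twistLR act) (comul₃ k H h) (coact v)

/-- A left-left Yetter–Drinfel'd module structure on the vector space `V`: a left `H`-action and a
left `H`-coaction `ρ(v) = v₋₁ ⊗ v₀` with `ρ(h · v) = h₁ v₋₁ S(h₃) ⊗ h₂ · v₀`. -/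
structure LeftLeftYD (V : Type w) [AddCommGroup V] [Module k V] where
  act : H →ₐ[k] Module.End k V
  coact : V →ₗ[k] H ⊗[k] V
  coassoc : (TensorProduct.assoc k H H V).toLinearMap ∘ₗ
    (comul : H →ₗ[k] H ⊗[k] H).rTensor V ∘ₗ coact = coact.lTensor H ∘ₗ coact
  counit_coact : (TensorProduct.lid k V).toLinearMap ∘ₗ
    (counit : H →ₗ[k] k).rTensor V ∘ₗ coact = LinearMap.id
  compat : ∀ (h : H) (v : V), coact (act h v) = lift₃ (twistLL act) (comul₃ k H h) (coact v)

variable {k H} {V : Type*} {W : Type*} [AddCommGroup V] [Module k V] [AddCommGroup W] [Module k W]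

/-- A nonzero Yetter–Drinfel'd module without proper nonzero subobjects. -/
def LeftRightYD.IsSimple [BijectiveAntipode k H] (M : LeftRightYD k H V) : Prop :=
  Nontrivial V ∧ ∀ U : Submodule k V, (∀ h, ∀ v ∈ U, M.act h v ∈ U) →
    (∀ v ∈ U, M.coact v ∈ LinearMap.range (U.subtype.rTensor H)) → U = ⊥ ∨ U = ⊤

/-- Isomorphism of Yetter–Drinfel'd modules: an `H`-linear and `H`-colinear bijection. -/
def LeftRightYD.Isomorphic [BijectiveAntipode k H] (M : LeftRightYD k H V)
    (N : LeftRightYD k H W) : Prop :=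
  ∃ f : V ≃ₗ[k] W, (∀ h v, f (M.act h v) = N.act h (f v)) ∧
    ∀ v, N.coact (f v) = f.toLinearMap.rTensor H (M.coact v)

/-- A nonzero Yetter–Drinfel'd module without proper nonzero subobjects. -/
def LeftLeftYD.IsSimple (M : LeftLeftYD k H V) : Prop :=
  Nontrivial V ∧ ∀ U : Submodule k V, (∀ h, ∀ v ∈ U, M.act h v ∈ U) →
    (∀ v ∈ U, M.coact v ∈ LinearMap.range (U.subtype.lTensor H)) → U = ⊥ ∨ U = ⊤

/-- Isomorphism of Yetter–Drinfel'd modules: an `H`-linear and `H`-colinear bijection. -/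
def LeftLeftYD.Isomorphic (M : LeftLeftYD k H V) (N : LeftLeftYD k H W) : Prop :=
  ∃ f : V ≃ₗ[k] W, (∀ h v, f (M.act h v) = N.act h (f v)) ∧
    ∀ v, N.coact (f v) = f.toLinearMap.lTensor H (M.coact v)

/-! ### The Drinfel'd double -/

variable (k H)

/-- The vector space `H* ⊗ H` underlying the Drinfel'd double `D(H) = H*ᶜᵒᵖ ⊗ H`. -/
abbrev DrinfeldDouble : Type _ := Module.Dual k H ⊗[k] H

/-- The product of `H*`: `⟨φψ, x⟩ = φ(x₁) ψ(x₂)`. -/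
noncomputable def dualMul : Module.Dual k H →ₗ[k] Module.Dual k H →ₗ[k] Module.Dual k H :=
  LinearMap.mk₂ k (fun φ ψ => LinearMap.mul' k k ∘ₗ TensorProduct.map φ ψ ∘ₗ comul)
    (fun φ φ' ψ => by simp [TensorProduct.map_add_left, LinearMap.add_comp, LinearMap.comp_add])
    (fun r φ ψ => by
      simp [TensorProduct.map_smul_left, LinearMap.smul_comp, LinearMap.comp_smul])
    (fun φ ψ ψ' => by simp [TensorProduct.map_add_right, LinearMap.add_comp, LinearMap.comp_add])
    (fun r φ ψ => by
      simp [TensorProduct.map_smul_right, LinearMap.smul_comp, LinearMap.comp_smul])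

/-- The trilinear map `(a, b, c) ↦ (φ ↦ ⟨φ, S⁻¹(c) · a⟩ ⊗ b)`. -/
noncomputable def twistDouble [BijectiveAntipode k H] :
    H →ₗ[k] H →ₗ[k] H →ₗ[k] (Module.Dual k H →ₗ[k] DrinfeldDouble k H) :=
  LinearMap.mk₂ k
    (fun a b =>
      { toFun := fun c =>
          { toFun := fun φ => (φ ∘ₗ LinearMap.mulLeft k (antipodeInv k H c) ∘ₗ
              LinearMap.mulRight k a) ⊗ₜ[k] b
            map_add' := fun φ φ' => by rw [LinearMap.add_comp, TensorProduct.add_tmul]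
            map_smul' := fun r φ => by
              rw [LinearMap.smul_comp, TensorProduct.smul_tmul', RingHom.id_apply] }
        map_add' := fun c c' => by
          ext φ
          simp only [LinearMap.coe_mk, AddHom.coe_mk, LinearMap.add_apply, map_add,
            ← TensorProduct.add_tmul]
          congr 1
          ext x
          simp [add_mul]
        map_smul' := fun r c => by
          ext φ
          simp only [LinearMap.coe_mk, AddHom.coe_mk, LinearMap.smul_apply, map_smul,
            TensorProduct.smul_tmul', RingHom.id_apply]
          congr 1
          ext x
          simp })
    (fun a a' b => by
      ext c φ
      simp only [LinearMap.coe_mk, AddHom.coe_mk, LinearMap.add_apply, ← TensorProduct.add_tmul]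
      congr 1
      ext x
      simp [mul_add])
    (fun r a b => by
      ext c φ
      simp only [LinearMap.coe_mk, AddHom.coe_mk, LinearMap.smul_apply, TensorProduct.smul_tmul']
      congr 1
      ext x
      simp)
    (fun a b b' => by ext c φ; simp [TensorProduct.tmul_add])
    (fun r a b => by ext c φ; simp)

variable {k H}

/-- `h ↦ (φ ↦ ⟨φ₃, h₁⟩ φ₂ ⊗ h₂ ⟨φ₁, S⁻¹(h₃)⟩)`, where
`⟨φ₁, S⁻¹(h₃)⟩ φ₂ ⟨φ₃, h₁⟩ = ⟨φ, S⁻¹(h₃) · h₁⟩`. -/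
noncomputable def doubleCross [BijectiveAntipode k H] (h : H) (φ : Module.Dual k H) :
    DrinfeldDouble k H :=
  lift₃ (twistDouble k H) (comul₃ k H h) φ

variable (k H)

/-- The product of the Drinfel'd double: the bilinear map with
`(φ ⊗ h) (φ' ⊗ h') = φ ⟨φ'₃, h₁⟩ φ'₂ ⊗ h₂ ⟨φ'₁, S⁻¹(h₃)⟩ h'`. -/
noncomputable def doubleMul [BijectiveAntipode k H] :
    DrinfeldDouble k H →ₗ[k] DrinfeldDouble k H →ₗ[k] DrinfeldDouble k H :=
  TensorProduct.lift <| LinearMap.mk₂ k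
    (fun φ h => TensorProduct.lift <| LinearMap.mk₂ k
      (fun φ' h' => TensorProduct.map (dualMul k H φ) (LinearMap.mulRight k h') (doubleCross h φ'))
      (fun φ' ψ' h' => by simp [doubleCross])
      (fun r φ' h' => by simp [doubleCross])
      (fun φ' h' l' => by
        rw [← LinearMap.add_apply, ← TensorProduct.map_add_right]
        congr 2; ext; simp [mul_add])
      (fun r φ' h' => by
        rw [← LinearMap.smul_apply, ← TensorProduct.map_smul_right]
        congr 2; ext; simp))
    (fun φ ψ h => by
      ext φ' h'
      simp [TensorProduct.map_add_left]
      rfl)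
    (fun r φ h => by
      ext φ' h'
      simp [TensorProduct.map_smul_left]
      rfl)
    (fun φ h l => by
      ext φ' h'
      simp [doubleCross])
    (fun r φ h => by
      ext φ' h'
      simp [doubleCross])

theorem doubleMul_tmul [BijectiveAntipode k H] (φ φ' : Module.Dual k H) (h h' : H) :
    doubleMul k H (φ ⊗ₜ h) (φ' ⊗ₜ h') =
      TensorProduct.map (dualMul k H φ) (LinearMap.mulRight k h') (doubleCross h φ') := rfl

/-- The unit `ε ⊗ 1` of the Drinfel'd double. -/
noncomputable def doubleOne : DrinfeldDouble k H := (counit : H →ₗ[k] k) ⊗ₜ[k] (1 : H)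

/-- A left module structure over the Drinfel'd double on the vector space `V`. -/
structure DoubleModule [BijectiveAntipode k H] (V : Type w) [AddCommGroup V] [Module k V] where
  act : DrinfeldDouble k H →ₗ[k] Module.End k V
  act_one : act (doubleOne k H) = 1
  act_mul : ∀ a b, act (doubleMul k H a b) = act a * act b

variable {k H}

/-- A nonzero `D(H)`-module without proper nonzero submodules. -/
def DoubleModule.IsSimple [BijectiveAntipode k H] (M : DoubleModule k H V) : Prop :=
  Nontrivial V ∧ ∀ U : Submodule k V, (∀ a, ∀ v ∈ U, M.act a v ∈ U) → U = ⊥ ∨ U = ⊤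

/-- Isomorphism of `D(H)`-modules. -/
def DoubleModule.Isomorphic [BijectiveAntipode k H] (M : DoubleModule k H V)
    (N : DoubleModule k H W) : Prop :=
  ∃ f : V ≃ₗ[k] W, ∀ a v, f (M.act a v) = N.act a (f v)

end General

/-! ### The Hopf algebra -/

/-- The group `ℤ/4 × ℤ/2 = ⟨x, y ∣ x⁴ = y² = 1, xy = yx⟩`, written additively:
`(i, j)` stands for `xⁱ yʲ`. -/
abbrev KG : Type := ZMod 4 × ZMod 2

namespace KG

/-- The action `g ◁ tᵃ` of `ℤ/2 = ⟨t⟩` by automorphisms: `x ◁ t = xy`, `y ◁ t = y`. -/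
def tact (g : KG) (a : ZMod 2) : KG := (g.1, g.2 + a * (g.1.val : ZMod 2))

/-- The cocycle `σ(g; tᵃ, tᵇ)`: normalized, with `σ(xⁱyʲ; t, t) = (-1)^(i(i-1)/2)`. -/
def sigma (g : KG) (a b : ZMod 2) : ℤ :=
  if a = 1 ∧ b = 1 then (-1) ^ (g.1.val * (g.1.val - 1) / 2) else 1

/-- The cocycle `τ(g, h; tᵃ)`: normalized, with `τ(xⁱyʲ, xᵏyˡ; t) = (-1)^(jk)`. -/
def tau (g h : KG) (a : ZMod 2) : ℤ :=
  if a = 1 then (-1) ^ (g.2.val * h.1.val) else 1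

theorem tact_add (g h : KG) (a : ZMod 2) : tact (g + h) a = tact g a + tact h a := by
  revert g h a; decide

theorem tact_tact (g : KG) (a b : ZMod 2) : tact (tact g a) b = tact g (a + b) := by
  revert g a b; decide

theorem tact_zero (g : KG) : tact g 0 = g := by
  revert g; decide

theorem zero_tact (a : ZMod 2) : tact 0 a = 0 := by
  revert a; decide

theorem sigma_cocycle (g : KG) (a b c : ZMod 2) :
    sigma (tact g a) b c * sigma g a (b + c) = sigma g a b * sigma g (a + b) c := by
  revert g a b c; decide

theorem sigma_left (g : KG) (b : ZMod 2) : sigma g 0 b = 1 := by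
  revert g b; decide

theorem sigma_right (g : KG) (a : ZMod 2) : sigma g a 0 = 1 := by
  revert g a; decide

theorem sigma_zero (a b : ZMod 2) : sigma 0 a b = 1 := by
  revert a b; decide

theorem tau_left (g : KG) (a : ZMod 2) : tau 0 g a = 1 := by
  revert g a; decide

theorem tau_right (g : KG) (a : ZMod 2) : tau g 0 a = 1 := by
  revert g a; decide

theorem tau_zero (g h : KG) : tau g h 0 = 1 := by
  revert g h; decide

theorem tau_cocycle (g h l : KG) (a : ZMod 2) :
    tau (g + h) l a * tau g h a = tau h l a * tau g (h + l) a := by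
  rcases g with ⟨i, j⟩; rcases h with ⟨i', j'⟩; rcases l with ⟨i'', j''⟩
  revert i j i' j' i'' j'' a; decide
theorem sigma_tau (g h : KG) (a b : ZMod 2) :
    sigma (g + h) a b * tau g h (a + b) =
      sigma g a b * sigma h a b * tau g h a * tau (tact g a) (tact h a) b := by
  revert g h a b; decide

theorem neg_tact (g : KG) (a : ZMod 2) : tact (-g) a = -tact g a := by
  revert g a; decide

theorem neg_tact_involutive (a : ZMod 2) : Function.Involutive fun g : KG => -tact g a := by
  unfold Function.Involutive; revert a; decide

theorem sigma_mul_self (g : KG) (a b : ZMod 2) : sigma g a b * sigma g a b = 1 := by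
  revert g a b; decide

theorem tau_mul_self (g h : KG) (a : ZMod 2) : tau g h a * tau g h a = 1 := by
  revert g h a; decide

theorem antipode_sign (g : KG) (a : ZMod 2) :
    tau g (-g) a * sigma (-tact g a) (-a) a = sigma (-g) a (-a) * tau (-g) g a := by
  revert g a; decide

theorem antipode_sign' (g : KG) (a : ZMod 2) :
    sigma (-g) a (-a) * tau (-g) g a *
      (sigma (tact g a) (-a) a * tau (tact g a) (-tact g a) (-a)) = 1 := by
  revert g a; decide

end KG

/-- The underlying vector space of `H`: a function `f` stands for `∑ f(g, tᵃ) • (e_g # tᵃ)`. -/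
def KashinaH (k : Type*) : Type _ := KG × ZMod 2 → k

namespace KashinaH

open KG

variable (k : Type*) [Field k]

noncomputable instance : AddCommGroup (KashinaH k) := inferInstanceAs (AddCommGroup (KG × ZMod 2 → k))
noncomputable instance : Module k (KashinaH k) := inferInstanceAs (Module k (KG × ZMod 2 → k))

/-- The standard basis `e_g # tᵃ` of `H`. -/
noncomputable def basis : Module.Basis (KG × ZMod 2) k (KashinaH k) := Pi.basisFun k (KG × ZMod 2)

/-- The product of `H`: the bilinear map with
`(e_g # tᵃ) (e_h # tᵇ) = δ_{g ◁ tᵃ, h} σ(g; tᵃ, tᵇ) e_g # tᵃ⁺ᵇ`. -/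
noncomputable def mulMap : KashinaH k →ₗ[k] KashinaH k →ₗ[k] KashinaH k :=
  (basis k).constr k fun p => (basis k).constr k fun q =>
    if tact p.1 p.2 = q.1 then (sigma p.1 p.2 q.2 : k) • basis k (p.1, p.2 + q.2) else 0

theorem mulMap_basis (g h : KG) (a b : ZMod 2) :
    mulMap k (basis k (g, a)) (basis k (h, b)) =
      if tact g a = h then (sigma g a b : k) • basis k (g, a + b) else 0 := by
  rw [mulMap, Module.Basis.constr_basis, Module.Basis.constr_basis]

theorem mulMap_assoc : ∀ u v w : KashinaH k,
    mulMap k (mulMap k u v) w = mulMap k u (mulMap k v w) := by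
  have : (mulMap k).compr₂ (mulMap k) =
      (LinearMap.llcomp k (KashinaH k) (KashinaH k) (KashinaH k)).compl₁₂ (mulMap k) (mulMap k) := by
    refine (basis k).ext fun ⟨g, a⟩ => (basis k).ext fun ⟨h, b⟩ => (basis k).ext fun ⟨l, c⟩ => ?_
    simp only [LinearMap.compr₂_apply, LinearMap.compl₁₂_apply, LinearMap.llcomp_apply, mulMap_basis]
    by_cases h1 : tact g a = h
    · subst h1
      rw [if_pos rfl]
      by_cases h2 : tact (tact g a) b = l
      · have h3 : tact g (a + b) = l := by rw [← tact_tact, h2]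
        have hc : ((sigma (tact g a) b c : ℤ) : k) * (sigma g a (b + c) : ℤ) = (sigma g a b : ℤ) * (sigma g (a + b) c : ℤ) := by
          exact_mod_cast congrArg (Int.cast : ℤ → k) (sigma_cocycle g a b c)
        simp [mulMap_basis, h2, h3, smul_smul, add_assoc, hc]
      · have h3 : ¬ tact g (a + b) = l := by rwa [← tact_tact]
        simp [mulMap_basis, h2, h3]
    · rw [if_neg h1]
      by_cases h2 : tact h b = l
      · simp [mulMap_basis, h2, h1]
      · simp [h2]
  intro u v w
  exact congrArg (fun F => F u v w) this

noncomputable instance : Mul (KashinaH k) := ⟨fun u v => mulMap k u v⟩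
noncomputable instance : One (KashinaH k) := ⟨∑ g : KG, basis k (g, 0)⟩

variable {k} in
theorem mul_def (u v : KashinaH k) : u * v = mulMap k u v := rfl

theorem one_def : (1 : KashinaH k) = ∑ g : KG, basis k (g, 0) := rfl

theorem one_mulMap : ∀ u : KashinaH k, mulMap k 1 u = u := by
  have : mulMap k 1 = LinearMap.id := by
    refine (basis k).ext fun ⟨h, b⟩ => ?_
    simp [one_def, mulMap_basis, tact_zero, sigma_left]
  exact fun u => congrArg (fun F => F u) this

theorem mulMap_one : ∀ u : KashinaH k, mulMap k u 1 = u := by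
  have : (mulMap k).flip 1 = LinearMap.id := by
    refine (basis k).ext fun ⟨h, b⟩ => ?_
    simp [one_def, mulMap_basis, sigma_right]
  exact fun u => congrArg (fun F => F u) this

noncomputable instance : Ring (KashinaH k) :=
  { (inferInstance : AddCommGroup (KashinaH k)), (inferInstance : Mul (KashinaH k)),
    (inferInstance : One (KashinaH k)) with
    left_distrib := fun u v w => map_add (mulMap k u) v w
    right_distrib := fun u v w => by simp [mul_def]
    zero_mul := fun u => by simp [mul_def]
    mul_zero := fun u => by simp [mul_def]
    mul_assoc := mulMap_assoc k
    one_mul := one_mulMap k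
    mul_one := mulMap_one k }

noncomputable instance : Algebra k (KashinaH k) :=
  Algebra.ofModule (fun r u v => by simp [mul_def]) (fun r u v => by simp [mul_def])

theorem basis_mul (g h : KG) (a b : ZMod 2) :
    basis k (g, a) * basis k (h, b) =
      if tact g a = h then (sigma g a b : k) • basis k (g, a + b) else 0 :=
  mulMap_basis k g h a b

/-- `Δ(e_g # tᵃ) = ∑_{hl = g} τ(h, l; tᵃ) (e_h # tᵃ) ⊗ (e_l # tᵃ)`. -/
noncomputable def comulMap : KashinaH k →ₗ[k] KashinaH k ⊗[k] KashinaH k :=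
  (basis k).constr k fun p =>
    ∑ h : KG, (tau h (p.1 - h) p.2 : k) • (basis k (h, p.2) ⊗ₜ[k] basis k (p.1 - h, p.2))

/-- `ε(e_g # tᵃ) = δ_{g,1}`. -/
noncomputable def counitMap : KashinaH k →ₗ[k] k :=
  (basis k).constr k fun p => if p.1 = 0 then 1 else 0

/-- `S(e_g # tᵃ) = σ(g⁻¹; tᵃ, t⁻ᵃ)⁻¹ τ(g⁻¹, g; tᵃ)⁻¹ e_{(g ◁ tᵃ)⁻¹} # t⁻ᵃ`. -/
noncomputable def antipodeMap : KashinaH k →ₗ[k] KashinaH k :=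
  (basis k).constr k fun p =>
    ((sigma (-p.1) p.2 (-p.2) : k)⁻¹ * (tau (-p.1) p.1 p.2 : k)⁻¹) • basis k (-tact p.1 p.2, -p.2)

theorem comulMap_basis (g : KG) (a : ZMod 2) : comulMap k (basis k (g, a)) =
    ∑ h : KG, (tau h (g - h) a : k) • (basis k (h, a) ⊗ₜ[k] basis k (g - h, a)) := by
  simp [comulMap]

theorem counitMap_basis (g : KG) (a : ZMod 2) :
    counitMap k (basis k (g, a)) = if g = 0 then 1 else 0 := by
  rw [counitMap, Module.Basis.constr_basis]

theorem antipodeMap_basis (g : KG) (a : ZMod 2) : antipodeMap k (basis k (g, a)) =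
    ((sigma (-g) a (-a) : k)⁻¹ * (tau (-g) g a : k)⁻¹) • basis k (-tact g a, -a) := by
  simp [antipodeMap]

noncomputable instance : Coalgebra k (KashinaH k) where
  comul := comulMap k
  counit := counitMap k
  coassoc := by
    refine (basis k).ext fun ⟨g, a⟩ => ?_
    simp only [LinearMap.comp_apply, comulMap_basis, map_sum, map_smul, LinearMap.rTensor_tmul,
      LinearMap.lTensor_tmul, LinearEquiv.coe_coe, TensorProduct.sum_tmul, TensorProduct.tmul_sum,
      ← TensorProduct.smul_tmul', TensorProduct.tmul_smul, TensorProduct.assoc_tmul,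
      Finset.smul_sum, smul_smul]
    rw [Finset.sum_comm]
    refine Finset.sum_congr rfl fun h _ => ?_
    rw [← Equiv.sum_comp (Equiv.addLeft h)]
    refine Finset.sum_congr rfl fun l _ => ?_
    have := congrArg (Int.cast : ℤ → k) (tau_cocycle h l (g - h - l) a)
    push_cast at this
    rw [add_sub_cancel] at this
    simp only [Equiv.coe_addLeft, add_sub_cancel_left, sub_add_eq_sub_sub]
    rw [this, mul_comm (tau h (g - h) a : k)]
  rTensor_counit_comp_comul := by
    refine (basis k).ext fun ⟨g, a⟩ => ?_
    simp [comulMap_basis, counitMap_basis, tau_left, TensorProduct.ite_tmul]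
  lTensor_counit_comp_comul := by
    refine (basis k).ext fun ⟨g, a⟩ => ?_
    simp [comulMap_basis, counitMap_basis, tau_right, TensorProduct.tmul_ite, sub_eq_zero]

theorem counit_basis (g : KG) (a : ZMod 2) :
    Coalgebra.counit (R := k) (basis k (g, a)) = if g = 0 then 1 else 0 :=
  counitMap_basis k g a

theorem comul_basis (g : KG) (a : ZMod 2) : Coalgebra.comul (R := k) (basis k (g, a)) =
    ∑ h : KG, (tau h (g - h) a : k) • (basis k (h, a) ⊗ₜ[k] basis k (g - h, a)) :=
  comulMap_basis k g a

theorem one_tmul_one : (1 : KashinaH k ⊗[k] KashinaH k) =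
    ∑ g : KG, ∑ h : KG, basis k (g, 0) ⊗ₜ[k] basis k (h, 0) := by
  rw [Algebra.TensorProduct.one_def, one_def, TensorProduct.sum_tmul]
  simp only [TensorProduct.tmul_sum]

theorem comul_basis_mul (g h : KG) (a b : ZMod 2) :
    Coalgebra.comul (R := k) (basis k (g, a)) * Coalgebra.comul (R := k) (basis k (h, b)) =
      if tact g a = h then
        (sigma g a b : k) • Coalgebra.comul (R := k) (basis k (g, a + b)) else 0 := by
  have key : ∀ u : KG, ((tau u (g - u) a : k) • (basis k (u, a) ⊗ₜ[k] basis k (g - u, a))) *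
      Coalgebra.comul (R := k) (basis k (h, b)) =
      if tact g a = h then (sigma g a b : k) • (tau u (g - u) (a + b) : k) •
        (basis k (u, a + b) ⊗ₜ[k] basis k (g - u, a + b)) else 0 := by
    intro u
    have hg : tact (g - u) a = tact g a - tact u a := by
      rw [eq_sub_iff_add_eq, ← tact_add, sub_add_cancel]
    rw [comul_basis, Finset.mul_sum, Finset.sum_eq_single (tact u a)]
    · simp only [smul_mul_assoc, mul_smul_comm, Algebra.TensorProduct.tmul_mul_tmul, basis_mul,
        if_true, hg, sub_left_inj]
      split_ifs with hh
      · have := congrArg (Int.cast : ℤ → k) (sigma_tau u (g - u) a b)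
        rw [add_sub_cancel, hg, hh] at this
        push_cast at this
        simp only [← TensorProduct.smul_tmul', TensorProduct.tmul_smul, smul_smul, this]
        congr 1
        ring
      · simp
    · intro v _ hv
      rw [smul_mul_assoc, mul_smul_comm, Algebra.TensorProduct.tmul_mul_tmul, basis_mul,
        if_neg (Ne.symm hv), TensorProduct.zero_tmul, smul_zero, smul_zero]
    · exact fun h => absurd (Finset.mem_univ _) h
  conv_lhs => rw [comul_basis k g a, Finset.sum_mul]
  rw [Finset.sum_congr rfl fun u _ => key u]
  split_ifs
  · rw [comul_basis, Finset.smul_sum]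
  · simp

noncomputable instance : Bialgebra k (KashinaH k) where
  counit_one := by simp [one_def, counit_basis]
  mul_compr₂_counit := by
    refine (basis k).ext fun ⟨g, a⟩ => (basis k).ext fun ⟨h, b⟩ => ?_
    simp only [LinearMap.compr₂_apply, LinearMap.compl₁₂_apply, LinearMap.mul_apply', basis_mul,
      counit_basis]
    by_cases hg : g = 0
    · subst hg
      by_cases hh : h = 0
      · simp [hh, zero_tact, sigma_zero, counit_basis]
      · simp [hh, Ne.symm hh, zero_tact]
    · by_cases hh : tact g a = h <;> simp [hh, hg, counit_basis]
  comul_one := by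
    rw [one_tmul_one, one_def, map_sum]
    simp only [comul_basis, tau_zero, Int.cast_one, one_smul]
    rw [Finset.sum_comm]
    refine Finset.sum_congr rfl fun h _ => ?_
    rw [← Equiv.sum_comp (Equiv.addLeft h)]
    simp
  mul_compr₂_comul := by
    refine (basis k).ext fun ⟨g, a⟩ => (basis k).ext fun ⟨h, b⟩ => ?_
    simp only [LinearMap.compr₂_apply, LinearMap.compl₁₂_apply, LinearMap.mul_apply',
      comul_basis_mul, basis_mul]
    split_ifs <;> simp

theorem intCast_ne_zero (n : ℤ) (hn : n * n = 1) : (n : k) ≠ 0 := by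
  intro h0
  have := congrArg (Int.cast : ℤ → k) hn
  simp [h0] at this

noncomputable instance : HopfAlgebra k (KashinaH k) where
  antipode := antipodeMap k
  mul_antipode_rTensor_comul := by
    refine (basis k).ext fun ⟨g, a⟩ => ?_
    simp only [LinearMap.comp_apply, comul_basis, counit_basis, map_sum, map_smul,
      LinearMap.rTensor_tmul, antipodeMap_basis, LinearMap.mul'_apply, smul_mul_assoc, basis_mul,
      Algebra.linearMap_apply]
    by_cases hg : g = 0
    · subst hg
      rw [if_pos rfl, map_one, one_def]
      refine Eq.trans ?_ (Equiv.sum_comp (Function.Involutive.toPerm _ (neg_tact_involutive a))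
        fun g => basis k (g, 0))
      refine Finset.sum_congr rfl fun h _ => ?_
      have hs := intCast_ne_zero k _ (sigma_mul_self (-h) a (-a))
      have ht := intCast_ne_zero k _ (tau_mul_self (-h) h a)
      have := congrArg (Int.cast : ℤ → k) (antipode_sign h a)
      push_cast at this
      rw [if_pos (by rw [neg_tact, tact_tact, add_neg_cancel, tact_zero, zero_sub]),
        smul_smul, smul_smul, zero_sub, neg_add_cancel]
      simp only [Function.Involutive.coe_toPerm]
      convert one_smul k _
      field_simp
      exact this
    · rw [if_neg hg, map_zero]
      refine Finset.sum_eq_zero fun h _ => ?_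
      rw [if_neg, smul_zero, smul_zero]
      rw [neg_tact, tact_tact, add_neg_cancel, tact_zero]
      intro h0
      exact hg (by rw [← sub_add_cancel g h, ← h0, neg_add_cancel])
  mul_antipode_lTensor_comul := by
    refine (basis k).ext fun ⟨g, a⟩ => ?_
    simp only [LinearMap.comp_apply, comul_basis, counit_basis, map_sum, map_smul,
      LinearMap.lTensor_tmul, antipodeMap_basis, LinearMap.mul'_apply, mul_smul_comm, basis_mul,
      Algebra.linearMap_apply]
    by_cases hg : g = 0
    · subst hg
      rw [if_pos rfl, map_one, one_def]
      refine Finset.sum_congr rfl fun h _ => ?_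
      have hs := intCast_ne_zero k _ (sigma_mul_self h a (-a))
      have ht := intCast_ne_zero k _ (tau_mul_self h (-h) a)
      rw [zero_sub, neg_tact, neg_neg, neg_neg, if_pos rfl, smul_smul, smul_smul, add_neg_cancel]
      convert one_smul k _
      field_simp
    · rw [if_neg hg, map_zero]
      refine Finset.sum_eq_zero fun h _ => ?_
      rw [if_neg, smul_zero, smul_zero]
      rw [eq_neg_iff_add_eq_zero, ← tact_add, add_sub_cancel]
      intro h0
      exact hg (by rw [← tact_zero g, ← add_neg_cancel a, ← tact_tact, h0, zero_tact])

/-- The antipode of `H` is an involution. -/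
theorem antipode_antipode (u : KashinaH k) :
    HopfAlgebra.antipode k (HopfAlgebra.antipode k u) = u := by
  have : antipodeMap k ∘ₗ antipodeMap k = LinearMap.id := by
    refine (basis k).ext fun ⟨g, a⟩ => ?_
    simp only [LinearMap.comp_apply, antipodeMap_basis, map_smul, LinearMap.id_apply]
    rw [smul_smul, neg_tact, tact_tact, neg_neg, neg_neg, add_neg_cancel, tact_zero]
    have h1 := intCast_ne_zero k _ (sigma_mul_self (-g) a (-a))
    have h2 := intCast_ne_zero k _ (tau_mul_self (-g) g a)
    have h3 := intCast_ne_zero k _ (sigma_mul_self (tact g a) (-a) a)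
    have h4 := intCast_ne_zero k _ (tau_mul_self (tact g a) (-tact g a) (-a))
    have := congrArg (Int.cast : ℤ → k) (antipode_sign' g a)
    push_cast at this
    convert one_smul k _
    · field_simp
      rw [mul_assoc, this]
    · rw [neg_neg]
  exact congrArg (fun F => F u) this

instance : BijectiveAntipode k (KashinaH k) :=
  ⟨Function.Involutive.bijective (antipode_antipode k)⟩

/-- The element `e_g = e_g # 1` of `H`. -/
noncomputable def e (g : KG) : KashinaH k := basis k (g, 0)

/-- The element `t = ∑_g e_g # t` of `H`. -/
noncomputable def t : KashinaH k := ∑ g : KG, basis k (g, 1)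

/-- The functional `ζ_g ∈ H*`: `e_h ↦ δ_{g,h}`, `e_h t ↦ 0`. -/
noncomputable def zeta (g : KG) : Module.Dual k (KashinaH k) := (basis k).coord (g, 0)

/-- The functional `χ_g ∈ H*`: `e_h ↦ 0`, `e_h t ↦ δ_{g,h}`. -/
noncomputable def chi (g : KG) : Module.Dual k (KashinaH k) := (basis k).coord (g, 1)

end KashinaH

/-! ### The list of modules -/

/-- The matrices by which `e_g`, `t`, `ζ_g`, `χ_g` act on an `n`-dimensional space with a fixed
basis; the columns of a matrix are the images of the basis vectors. -/
structure ActionTable (k : Type*) (n : ℕ) where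
  e : KG → Matrix (Fin n) (Fin n) k
  t : Matrix (Fin n) (Fin n) k
  zeta : KG → Matrix (Fin n) (Fin n) k
  chi : KG → Matrix (Fin n) (Fin n) k

/-- The names of the modules: `V_{μ,i}^±` with `μ = x²ᵃyᵇ`; `W_{μ,i,±}` with `μ = x¹⁺²ᶜ`;
`X_{μ,i}` with `μ = x²ᵃyᵇ`; `Y_{μ,j+1}` with `μ = x¹⁺²ᶜ`; `Z_{μ,j+1}` with `μ = x²ᶜ`.
The sign `±` is `+` for `true` and `-` for `false`. -/
inductive Label : Type
  | V (a b : Fin 2) (sign : Bool) (i : Fin 4)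
  | W (c : Fin 2) (sign : Bool) (i : Fin 4)
  | X (a b : Fin 2) (i : Fin 2)
  | Y (c : Fin 2) (j : Fin 8)
  | Z (c : Fin 2) (j : Fin 8)
  deriving DecidableEq, Fintype

namespace Label

/-- The dimension of the module with the given name. -/
def dim : Label → ℕ
  | V _ _ _ _ => 1
  | W _ _ _ => 2
  | X _ _ _ => 2
  | Y _ _ => 2
  | Z _ _ => 2

section Tables

variable {k : Type*} [Field k] (ξ : k)

/-- The group element `xⁱ yʲ`. -/
def xy (i j : ℕ) : KG := (i, j)

/-- The sign `+1` for `true` and `-1` for `false`. -/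
def sgn (s : Bool) : k := if s then 1 else -1

/-- `e_g ↦ diag(δ_{g,μ}, δ_{g,ν})`. -/
def eMat (μ ν g : KG) : Matrix (Fin 2) (Fin 2) k :=
  !![if g = μ then 1 else 0, 0; 0, if g = ν then 1 else 0]

/-- `ζ_{xᵏyˡ} ↦ (ζ_x)ᵏ (ζ_y)ˡ` and `χ_{xᵏyˡ} ↦ 0`, from the matrices `T`, `Zx`, `Zy` of
`t`, `ζ_x`, `ζ_y`. -/
def zetaTable (μ ν : KG) (T Zx Zy : Matrix (Fin 2) (Fin 2) k) : ActionTable k 2 where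
  e := eMat μ ν
  t := T
  zeta g := Zx ^ g.1.val * Zy ^ g.2.val
  chi _ := 0

/-- `ζ_{xᵏyˡ} ↦ 0` and `χ_{xᵏyˡ} ↦ (χ_x)ᵏ (χ_y)ˡ`, from the matrices `T`, `Cx`, `Cy` of
`t`, `χ_x`, `χ_y`. -/
def chiTable (μ ν : KG) (T Cx Cy : Matrix (Fin 2) (Fin 2) k) : ActionTable k 2 where
  e := eMat μ ν
  t := T
  zeta _ := 0
  chi g := Cx ^ g.1.val * Cy ^ g.2.val

/-- `V_{μ,i}^±`, `μ = x²ᵃyᵇ`: `t ↦ ± ξᵃ`, `ζ_{xᵏyˡ} ↦ ξⁱᵏ (-1)ᵇˡ`, `χ ↦ 0`. -/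
def tableV (a b : Fin 2) (s : Bool) (i : Fin 4) : ActionTable k 1 where
  e g := !![if g = xy (2 * a.val) b.val then 1 else 0]
  t := !![sgn s * ξ ^ a.val]
  zeta g := !![ξ ^ (i.val * g.1.val) * (-1) ^ (b.val * g.2.val)]
  chi _ := 0

/-- `W_{μ,i,±}`, `μ = x¹⁺²ᶜ`. -/
def tableW (c : Fin 2) (s : Bool) (i : Fin 4) : ActionTable k 2 :=
  zetaTable (xy (1 + 2 * c.val) 0) (xy (1 + 2 * c.val) 1)
    !![0, (-1) ^ c.val; 1, 0]
    !![sgn s * ξ ^ i.val, 0; 0, ξ ^ i.val]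
    !![-sgn s, 0; 0, sgn s]

/-- `X_{μ,i}`, `μ = x²ᵃyᵇ`. -/
def tableX (a b : Fin 2) (i : Fin 2) : ActionTable k 2 :=
  zetaTable (xy (2 * a.val) b.val) (xy (2 * a.val) b.val)
    !![0, (-1) ^ a.val; 1, 0]
    !![ξ ^ i.val, 0; 0, -ξ ^ i.val]
    !![-(-1) ^ b.val, 0; 0, -(-1) ^ b.val]

/-- `Y_{x,1}, …, Y_{x,8}`. -/
def tableYx : Fin 8 → ActionTable k 2 := ![
  chiTable (xy 1 0) (xy 1 1) !![0, -ξ; ξ, 0] !![0, 1; 1, 0] !![1, 0; 0, -1],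
  chiTable (xy 1 0) (xy 1 1) !![0, ξ; -ξ, 0] !![0, 1; 1, 0] !![1, 0; 0, -1],
  chiTable (xy 1 0) (xy 1 1) !![0, -ξ; ξ, 0] !![0, -1; 1, 0] !![-1, 0; 0, 1],
  chiTable (xy 1 0) (xy 1 1) !![0, ξ; -ξ, 0] !![0, -1; 1, 0] !![-1, 0; 0, 1],
  chiTable (xy 1 0) (xy 1 1) !![0, 1; 1, 0] !![0, -1; 1, 0] !![1, 0; 0, -1],
  chiTable (xy 1 0) (xy 1 1) !![0, -1; -1, 0] !![0, -1; 1, 0] !![1, 0; 0, -1],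
  chiTable (xy 1 0) (xy 1 1) !![0, 1; 1, 0] !![0, 1; 1, 0] !![-1, 0; 0, 1],
  chiTable (xy 1 0) (xy 1 1) !![0, -1; -1, 0] !![0, 1; 1, 0] !![-1, 0; 0, 1]]

/-- `Y_{x³,1}, …, Y_{x³,8}`. -/
def tableYx3 : Fin 8 → ActionTable k 2 := ![
  chiTable (xy 3 0) (xy 3 1) !![0, ξ; ξ, 0] !![0, -1; 1, 0] !![1, 0; 0, -1],
  chiTable (xy 3 0) (xy 3 1) !![0, -ξ; -ξ, 0] !![0, -1; 1, 0] !![1, 0; 0, -1],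
  chiTable (xy 3 0) (xy 3 1) !![0, ξ; ξ, 0] !![0, 1; 1, 0] !![-1, 0; 0, 1],
  chiTable (xy 3 0) (xy 3 1) !![0, -ξ; -ξ, 0] !![0, 1; 1, 0] !![-1, 0; 0, 1],
  chiTable (xy 3 0) (xy 3 1) !![0, -1; 1, 0] !![0, 1; 1, 0] !![1, 0; 0, -1],
  chiTable (xy 3 0) (xy 3 1) !![0, 1; -1, 0] !![0, 1; 1, 0] !![1, 0; 0, -1],
  chiTable (xy 3 0) (xy 3 1) !![0, -1; 1, 0] !![0, -1; 1, 0] !![-1, 0; 0, 1],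
  chiTable (xy 3 0) (xy 3 1) !![0, 1; -1, 0] !![0, -1; 1, 0] !![-1, 0; 0, 1]]

/-- `Z_{μ,1}, …, Z_{μ,8}`, `μ = x²ᶜ`. -/
def tableZ (c : Fin 2) : Fin 8 → ActionTable k 2 := ![
  chiTable (xy (2 * c.val) 0) (xy (2 * c.val) 1)
    !![ξ ^ c.val, 0; 0, ξ ^ c.val] !![0, 1; 1, 0] !![-1, 0; 0, 1],
  chiTable (xy (2 * c.val) 0) (xy (2 * c.val) 1)
    !![-ξ ^ c.val, 0; 0, -ξ ^ c.val] !![0, 1; 1, 0] !![-1, 0; 0, 1],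
  chiTable (xy (2 * c.val) 0) (xy (2 * c.val) 1)
    !![ξ ^ c.val, 0; 0, ξ ^ c.val] !![0, -1; 1, 0] !![-1, 0; 0, 1],
  chiTable (xy (2 * c.val) 0) (xy (2 * c.val) 1)
    !![-ξ ^ c.val, 0; 0, -ξ ^ c.val] !![0, -1; 1, 0] !![-1, 0; 0, 1],
  chiTable (xy (2 * c.val) 0) (xy (2 * c.val) 1)
    !![ξ ^ c.val, 0; 0, -ξ ^ c.val] !![0, 1; 1, 0] !![1, 0; 0, -1],
  chiTable (xy (2 * c.val) 0) (xy (2 * c.val) 1)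
    !![-ξ ^ c.val, 0; 0, ξ ^ c.val] !![0, 1; 1, 0] !![1, 0; 0, -1],
  chiTable (xy (2 * c.val) 0) (xy (2 * c.val) 1)
    !![ξ ^ c.val, 0; 0, -ξ ^ c.val] !![0, -1; 1, 0] !![1, 0; 0, -1],
  chiTable (xy (2 * c.val) 0) (xy (2 * c.val) 1)
    !![-ξ ^ c.val, 0; 0, ξ ^ c.val] !![0, -1; 1, 0] !![1, 0; 0, -1]]

/-- The matrices of the module with the given name. -/
def table : (l : Label) → ActionTable k l.dim
  | V a b s i => tableV ξ a b s i
  | W c s i => tableW ξ c s i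
  | X a b i => tableX ξ a b i
  | Y c j => (![tableYx ξ, tableYx3 ξ] : Fin 2 → Fin 8 → ActionTable k 2) c j
  | Z c j => tableZ ξ c j

end Tables

end Label

section Realization

open KashinaH

variable {k : Type*} [Field k] {n : ℕ}

/-- The space `kⁿ` carries the `H`-action of the table and the right coaction
`ρ(v) = ∑_g (ζ_g · v ⊗ e_g + χ_g · v ⊗ e_g t)`, so that `φ · v = ⟨φ, v₁⟩ v₀` for `φ = ζ_g, χ_g`. -/
def LeftRightYD.HasTable (M : LeftRightYD k (KashinaH k) (Fin n → k)) (A : ActionTable k n) :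
    Prop :=
  (∀ g, M.act (e k g) = (A.e g).toLin') ∧ M.act (t k) = A.t.toLin' ∧
    ∀ v, M.coact v = ∑ g : KG, ((A.zeta g).mulVec v ⊗ₜ[k] e k g +
      (A.chi g).mulVec v ⊗ₜ[k] (e k g * t k))

/-- The space `kⁿ` carries the `H`-action of the table and the left coaction
`ρ(v) = S(v₁) ⊗ v₀ = ∑_g (S(e_g) ⊗ ζ_g · v + S(e_g t) ⊗ χ_g · v)`. -/
def LeftLeftYD.HasTable (M : LeftLeftYD k (KashinaH k) (Fin n → k)) (A : ActionTable k n) :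
    Prop :=
  (∀ g, M.act (e k g) = (A.e g).toLin') ∧ M.act (t k) = A.t.toLin' ∧
    ∀ v, M.coact v = ∑ g : KG, (HopfAlgebra.antipode k (e k g) ⊗ₜ[k] (A.zeta g).mulVec v +
      HopfAlgebra.antipode k (e k g * t k) ⊗ₜ[k] (A.chi g).mulVec v)

/-- On `kⁿ` the elements `e_g = ε ⊗ e_g`, `t = ε ⊗ t`, `ζ_g = ζ_g ⊗ 1`, `χ_g = χ_g ⊗ 1` of `D(H)`
act by the matrices of the table. -/
def DoubleModule.HasTable (M : DoubleModule k (KashinaH k) (Fin n → k)) (A : ActionTable k n) :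
    Prop :=
  (∀ g, M.act (Coalgebra.counit ⊗ₜ e k g) = (A.e g).toLin') ∧
    M.act (Coalgebra.counit ⊗ₜ t k) = A.t.toLin' ∧
    (∀ g, M.act (zeta k g ⊗ₜ 1) = (A.zeta g).toLin') ∧
    ∀ g, M.act (chi k g ⊗ₜ 1) = (A.chi g).toLin'

end Realization

/-! In all three settings a module amounts to the same data, `BasisRep`: operators A for the basis
e_g # tᵃ of H and B for its dual basis, the latter multiplying by convolution. On basis elements the
compatibility condition, or the product of D(H), has a single nonzero term and becomes the
commutation rule `BasisRep.cross`, where all the cocycle values collapse to one sign `theta`. For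
left-left modules the coaction is expanded in the basis S(e_g # tᵃ), because v ↦ S(v₁) ⊗ v₀ turns a
right comodule into a left one; the same rule results. Subobjects and isomorphisms also correspond
(`isSimple_iff`, `isomorphic_iff`), so the classification is carried out once, for `BasisRep`.

Let N be simple. The functional ζ_1 acts as a central idempotent with complement χ_1, so either all
χ_g or all ζ_g act by zero (`IsSimple.exists_isPure`). In either case the dual basis acts through
two operators X and Y, belonging to x and y, with X⁴ = Y² = 1 and YX = XY for ζ, YX = -XY for χ. The
e_g grade N by G, t sends grade g to g ◁ t, t² is a sign on each grade, and tX = ±XYt, tY = ±Yt.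

For ζ, X and Y preserve grades, so there is a homogeneous joint eigenvector v. If the exponent of x
in its grade is odd, v and tv span a module W. If it is even, t preserves the grade, and the
eigenvalue of Y at v decides whether t commutes with X at v, giving a one-dimensional V, or
anticommutes, giving X spanned by v and tv.

For χ, X multiplies grades by y, and X² and Y are diagonalised on one grade. In even grades t
preserves the grade, and for a t-eigenvector u the vectors u, Xu span a module Z. In odd grades t
and X move the grade in the same way, X⁻¹t plays the part of t, and u, Xu span a module Y.

All these eigenvectors come from operators with scalar square (`exists_eigenvector`), so N may have
any dimension. The family found defines a nonzero map from a listed module to N, an isomorphism by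
Schur's lemma (`Realizes.isomorphic`). Conversely, the listed matrices satisfy the relations, which
need checking only for x and y (`BasisRep.ofGrading`); a diagonal matrix with distinct entries and
an invertible antidiagonal one leave no invariant line (`HasTable.isSimple`); and traces separate
the list (`eq_of_sameTraces`). -/

/-! ### Sign identities for the cocycles. -/

namespace KG

/-- The sign in the commutation rule of the Drinfel'd double of `H`: for `g = xⁱyʲ`, `m = xᵏyˡ` it is
`(-1)^(il + jk + (1-b)ik)` when `a = 1`, and `1` when `a = 0`. -/
def theta (g : KG) (a : ZMod 2) (m : KG) (b : ZMod 2) : ℤ :=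
  if a = 1 then
    (-1) ^ (g.1.val * m.2.val + (g.2.val + if b = 0 then g.1.val else 0) * m.1.val)
  else 1

/-- The sign in `S(e_g # tᵃ) = ± e_{(g ◁ tᵃ)⁻¹} # tᵃ`. -/
def ssign (g : KG) (a : ZMod 2) : ℤ := sigma (-g) a a * tau (-g) g a

theorem theta_mul_self (g : KG) (a : ZMod 2) (m : KG) (b : ZMod 2) :
    theta g a m b * theta g a m b = 1 := by
  simp only [theta]
  split_ifs <;> simp [← mul_pow]

theorem ssign_mul_self (g : KG) (a : ZMod 2) : ssign g a * ssign g a = 1 := by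
  rw [ssign, mul_mul_mul_comm, sigma_mul_self, tau_mul_self, one_mul]

theorem add_self_zmod2 (a b : ZMod 2) : a + (b + a) = b := by
  revert a b; decide

theorem tact_eq_iff (g h : KG) (a : ZMod 2) : tact g a = h ↔ g = tact h a := by
  revert g h a; decide

theorem tact_involutive (a : ZMod 2) : Function.Involutive fun g : KG => tact g a := by
  unfold Function.Involutive; revert a; decide

theorem tact_eq_neg_tact_iff (l u : KG) (a b : ZMod 2) :
    tact l b = -tact u a ↔ u = -tact l (a + b) := by
  revert l u a b; decide

/-- The left side collects the signs of the one surviving term of h₂ · v₀ ⊗ h₃ v₁ S⁻¹(h₁): two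
values of τ from the iterated coproduct, the sign of the antipode, and two values of σ from the
products. -/
theorem theta_coact (g l : KG) (a b : ZMod 2) :
    tau (-tact l (a + b)) (g - -tact l (a + b)) a *
        tau (g - -tact l (a + b) - tact l a) (tact l a) a * ssign (-tact l (a + b)) a *
        sigma l b a * sigma (tact l a) a (b + a) =
      theta (g - -tact l (a + b) - tact l a) a l b := by
  rcases g with ⟨i, j⟩; rcases l with ⟨k, m⟩; revert i j k m a b; decide

/-- The analogue for h₁ v₋₁ S(h₃) ⊗ h₂ · v₀. The factors `ssign l b` and `ssign (tact l a) b` come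
from writing the coaction before and after in the basis S(e_g # tᵃ); with them the sign is again
`theta`. -/
theorem theta_coact_left (g l : KG) (a b : ZMod 2) :
    tau (-tact l (a + b)) (g - -tact l (a + b)) a *
        tau (g - -tact l (a + b) - tact l a) (tact l a) a * ssign (tact l a) a *
        sigma (-tact l b) b a * sigma (-tact l (a + b)) a (b + a) * ssign l b =
      theta (g - -tact l (a + b) - tact l a) a l b * ssign (tact l a) b := by
  rcases g with ⟨i, j⟩; rcases l with ⟨k, m⟩; revert i j k m a b; decide

/-- The analogue for ⟨φ, S⁻¹(h₃) · h₁⟩ in the product of D(H). That all three computations give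
`theta` is what makes the three lists coincide. -/
theorem theta_double (g m : KG) (a b : ZMod 2) :
    tau (tact m (a + b)) (g - tact m (a + b)) a *
        tau (g - tact m (a + b) - -tact m a) (-tact m a) a * ssign (-tact m a) a *
        sigma (tact m a) b a * sigma m a (b + a) =
      theta g a m b := by
  rcases g with ⟨i, j⟩; rcases m with ⟨k, l⟩; revert i j k l a b; decide

end KG

/-! ### Coefficients of tensors with respect to a basis of one factor. -/

section Coefficients

variable {k : Type*} [Field k] {H : Type*} [AddCommGroup H] [Module k H] {ι : Type*}
  (b : Module.Basis ι k H) {V : Type*} [AddCommGroup V] [Module k V]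

/-- The coefficient of `b i` in an element of `V ⊗ H`. -/
noncomputable def coeffRight (i : ι) : V ⊗[k] H →ₗ[k] V :=
  (TensorProduct.rid k V).toLinearMap ∘ₗ (b.coord i).lTensor V

/-- The coefficient of `b i` in an element of `H ⊗ V`. -/
noncomputable def coeffLeft (i : ι) : H ⊗[k] V →ₗ[k] V :=
  (TensorProduct.lid k V).toLinearMap ∘ₗ (b.coord i).rTensor V

theorem coeffRight_tmul (i : ι) (v : V) (x : H) : coeffRight b i (v ⊗ₜ x) = b.coord i x • v := by
  simp [coeffRight]

theorem coeffLeft_tmul (i : ι) (v : V) (x : H) : coeffLeft b i (x ⊗ₜ v) = b.coord i x • v := by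
  simp [coeffLeft]

theorem coeffRight_tmul_basis [DecidableEq ι] (i j : ι) (v : V) :
    coeffRight b i (v ⊗ₜ b j) = if j = i then v else 0 := by
  simp [coeffRight_tmul, Finsupp.single_apply]

theorem coeffLeft_tmul_basis [DecidableEq ι] (i j : ι) (v : V) :
    coeffLeft b i (b j ⊗ₜ v) = if j = i then v else 0 := by
  simp [coeffLeft_tmul, Finsupp.single_apply]

theorem coeffRight_rTensor {W : Type*} [AddCommGroup W] [Module k W] (f : V →ₗ[k] W) (i : ι)
    (z : V ⊗[k] H) : coeffRight b i (f.rTensor H z) = f (coeffRight b i z) := by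
  induction z with
  | zero => simp
  | tmul v x => simp [coeffRight_tmul]
  | add y z hy hz => simp only [map_add, hy, hz]

theorem coeffLeft_lTensor {W : Type*} [AddCommGroup W] [Module k W] (f : V →ₗ[k] W) (i : ι)
    (z : H ⊗[k] V) : coeffLeft b i (f.lTensor H z) = f (coeffLeft b i z) := by
  induction z with
  | zero => simp
  | tmul v x => simp [coeffLeft_tmul]
  | add y z hy hz => simp only [map_add, hy, hz]

variable [Fintype ι]

theorem sum_coeffRight (z : V ⊗[k] H) : ∑ i, coeffRight b i z ⊗ₜ[k] b i = z := by
  induction z with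
  | zero => simp
  | tmul v x =>
    simp only [coeffRight_tmul, TensorProduct.smul_tmul, ← TensorProduct.tmul_sum,
      Module.Basis.coord_apply, b.sum_repr]
  | add y z hy hz => simp only [map_add, TensorProduct.add_tmul, Finset.sum_add_distrib, hy, hz]

theorem sum_coeffLeft (z : H ⊗[k] V) : ∑ i, b i ⊗ₜ[k] coeffLeft b i z = z := by
  induction z with
  | zero => simp
  | tmul x v =>
    simp only [coeffLeft_tmul, TensorProduct.tmul_smul, TensorProduct.smul_tmul',
      ← TensorProduct.sum_tmul, Module.Basis.coord_apply, b.sum_repr]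
  | add y z hy hz => simp only [map_add, TensorProduct.tmul_add, Finset.sum_add_distrib, hy, hz]

theorem coeffRight_ext {y z : V ⊗[k] H} (h : ∀ i, coeffRight b i y = coeffRight b i z) : y = z := by
  rw [← sum_coeffRight b y, ← sum_coeffRight b z]; simp [h]

theorem coeffLeft_ext {y z : H ⊗[k] V} (h : ∀ i, coeffLeft b i y = coeffLeft b i z) : y = z := by
  rw [← sum_coeffLeft b y, ← sum_coeffLeft b z]; simp [h]

theorem coeffRight_sum [DecidableEq ι] (x : ι → V) (i : ι) :
    coeffRight b i (∑ j, x j ⊗ₜ[k] b j) = x i := by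
  simp [coeffRight_tmul_basis]

theorem coeffLeft_sum [DecidableEq ι] (x : ι → V) (i : ι) :
    coeffLeft b i (∑ j, b j ⊗ₜ[k] x j) = x i := by
  simp [coeffLeft_tmul_basis]

/-- Turns "U is a subcomodule" into stability of U under the operators of the dual basis. -/
theorem mem_range_rTensor_iff (U : Submodule k V) (z : V ⊗[k] H) :
    z ∈ LinearMap.range (U.subtype.rTensor H) ↔ ∀ i, coeffRight b i z ∈ U := by
  constructor
  · rintro ⟨y, rfl⟩ i
    rw [coeffRight_rTensor]
    exact Subtype.property _
  · intro h
    rw [← sum_coeffRight b z]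
    exact Submodule.sum_mem _ fun i _ => ⟨(⟨_, h i⟩ : U) ⊗ₜ b i, by simp⟩

theorem mem_range_lTensor_iff (U : Submodule k V) (z : H ⊗[k] V) :
    z ∈ LinearMap.range (U.subtype.lTensor H) ↔ ∀ i, coeffLeft b i z ∈ U := by
  constructor
  · rintro ⟨y, rfl⟩ i
    rw [coeffLeft_lTensor]
    exact Subtype.property _
  · intro h
    rw [← sum_coeffLeft b z]
    exact Submodule.sum_mem _ fun i _ => ⟨b i ⊗ₜ (⟨_, h i⟩ : U), by simp⟩

end Coefficients

/-! ### Structure constants of H and of its dual. -/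

namespace KashinaH

open KG

variable (k : Type*) [Field k]

theorem intCast_inv_eq {n : ℤ} (hn : n * n = 1) : (n : k)⁻¹ = n :=
  inv_eq_of_mul_eq_one_left (by rw [← Int.cast_mul, hn, Int.cast_one])

theorem antipode_basis (g : KG) (a : ZMod 2) :
    HopfAlgebra.antipode k (basis k (g, a)) = (ssign g a : k) • basis k (-tact g a, a) := by
  have ha : -a = a := by revert a; decide
  refine (antipodeMap_basis k g a).trans ?_
  rw [ha, intCast_inv_eq k (sigma_mul_self _ _ _), intCast_inv_eq k (tau_mul_self _ _ _), ssign]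
  push_cast
  rfl

theorem antipodeInv_eq : antipodeInv k (KashinaH k) = HopfAlgebra.antipode k := by
  ext1 x
  rw [antipodeInv, LinearEquiv.coe_coe, LinearEquiv.symm_apply_eq, LinearEquiv.ofBijective_apply,
    antipode_antipode]

theorem comul₃_basis (g : KG) (a : ZMod 2) : comul₃ k (KashinaH k) (basis k (g, a)) =
    ∑ u : KG, ∑ w : KG, ((tau u (g - u) a * tau (g - u - w) w a : ℤ) : k) •
      (basis k (u, a) ⊗ₜ[k] (basis k (g - u - w, a) ⊗ₜ[k] basis k (w, a))) := by
  simp only [comul₃, LinearMap.comp_apply, comul_basis, map_sum, map_smul, LinearMap.lTensor_tmul,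
    TensorProduct.tmul_sum, Finset.smul_sum]
  refine Finset.sum_congr rfl fun u _ => ?_
  -- The inner sum is reindexed by its last factor w, since the twisted products below constrain the
  -- two outer factors u and w and leave the middle one to be determined.
  rw [← Equiv.sum_comp (Equiv.subLeft (g - u))]
  refine Finset.sum_congr rfl fun w _ => ?_
  simp only [Equiv.subLeft_apply, sub_sub_cancel, TensorProduct.tmul_smul, smul_smul]
  push_cast
  rfl

/-- `(e_w # tᵃ)(e_l # tᵇ) S(e_u # tᵃ)`. -/
theorem basis_mul_mul_antipode (w l u : KG) (a b : ZMod 2) :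
    basis k (w, a) * (basis k (l, b) * HopfAlgebra.antipode k (basis k (u, a))) =
      if u = -tact l (a + b) ∧ w = tact l a then
        ((ssign u a * sigma l b a * sigma w a (b + a) : ℤ) : k) • basis k (w, b) else 0 := by
  rw [antipode_basis, mul_smul_comm, basis_mul, ite_and]
  by_cases hu : u = -tact l (a + b)
  · rw [if_pos hu, if_pos ((tact_eq_neg_tact_iff _ _ _ _).2 hu), smul_smul, mul_smul_comm, basis_mul]
    by_cases hw : w = tact l a
    · rw [if_pos ((tact_eq_iff _ _ _).2 hw), if_pos hw, smul_smul, add_self_zmod2]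
      push_cast; rfl
    · rw [if_neg (fun h => hw ((tact_eq_iff _ _ _).1 h)), if_neg hw, smul_zero]
  · rw [if_neg hu, if_neg (fun h => hu ((tact_eq_neg_tact_iff _ _ _ _).1 h)), smul_zero, mul_zero]

/-- `S(e_w # tᵃ)(e_l # tᵇ)(e_u # tᵃ)`. -/
theorem antipode_mul_basis_mul (w l u : KG) (a b : ZMod 2) :
    HopfAlgebra.antipode k (basis k (w, a)) * (basis k (l, b) * basis k (u, a)) =
      if u = tact l b ∧ w = -l then
        ((ssign w a * sigma l b a * sigma (-tact w a) a (b + a) : ℤ) : k) •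
          basis k (-tact w a, b) else 0 := by
  rw [antipode_basis, basis_mul, ite_and]
  by_cases hu : u = tact l b
  · rw [if_pos hu, if_pos hu.symm, mul_smul_comm, smul_mul_assoc, basis_mul]
    by_cases hw : w = -l
    · have : tact (-tact w a) a = l := by subst hw; clear hu; revert l a; decide
      rw [if_pos this, if_pos hw, smul_smul, smul_smul, add_self_zmod2]
      push_cast
      congr 1
      ring
    · have : tact (-tact w a) a ≠ l := by
        clear hu; contrapose! hw; revert w l a; decide
      rw [if_neg this, if_neg hw, smul_zero, smul_zero]
  · rw [if_neg hu, if_neg (Ne.symm hu), mul_zero]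

/-- These coefficients of the coproduct are the structure constants of the convolution product; they
serve both for coassociativity of a coaction and for the product of H*. -/
theorem coord_comul_basis (p q r : KG × ZMod 2) :
    ((basis k).tensorProduct (basis k)).coord (p, q) (Coalgebra.comul (R := k) (basis k r)) =
      if p.2 = q.2 ∧ r = (p.1 + q.1, p.2) then (tau p.1 q.1 p.2 : k) else 0 := by
  obtain ⟨g, a⟩ := r
  obtain ⟨u, b⟩ := p
  obtain ⟨v, c⟩ := q
  simp only [comul_basis, map_sum, map_smul, Module.Basis.coord_apply,
    Module.Basis.tensorProduct_repr_tmul_apply, Module.Basis.repr_self, Finsupp.single_apply,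
    Prod.mk.injEq, smul_eq_mul]
  rw [Finset.sum_eq_single u]
  · by_cases h1 : a = b
    · by_cases h2 : a = c
      · by_cases h3 : g = u + v
        · subst h1 h2 h3; simp
        · have : g - u ≠ v := fun h => h3 (by rw [← h, add_sub_cancel])
          simp [h3, this]
      · have : ¬ (b = c ∧ g = u + v ∧ a = b) := fun h => h2 (h1.trans h.1)
        simp [h2, this]
    · simp [h1]
  · intro h _ hu
    simp [hu]
  · simp

end KashinaH

/-! ### Modules as systems of operators with relations. -/

/-- Operators by which the basis `e_g # tᵃ` of `H` and its dual basis act in a module over the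
Drinfel'd double of `H`, with the relations between them. -/
@[ext]
structure BasisRep (k : Type u) [Field k] (V : Type w) [AddCommGroup V] [Module k V] where
  A : KG × ZMod 2 → Module.End k V
  B : KG × ZMod 2 → Module.End k V
  A_one : ∑ g : KG, A (g, 0) = 1
  A_mul : ∀ g h a b, A (g, a) * A (h, b) =
    if KG.tact g a = h then (KG.sigma g a b : k) • A (g, a + b) else 0
  B_one : B (0, 0) + B (0, 1) = 1
  B_mul : ∀ g h a b, B (g, a) * B (h, b) = if a = b then (KG.tau g h a : k) • B (g + h, a) else 0
  cross : ∀ g a m b, A (g, a) * B (m, b) =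
    (KG.theta g a m b : k) • (B (KG.tact m a, b) * A (g - KG.tact m (a + b) + KG.tact m a, a))

namespace BasisRep

variable {k : Type*} [Field k] {V : Type*} [AddCommGroup V] [Module k V]
  {W : Type*} [AddCommGroup W] [Module k W]

/-- The module is nonzero and has no proper nonzero submodules. -/
def IsSimple (M : BasisRep k V) : Prop :=
  Nontrivial V ∧ ∀ U : Submodule k V, (∀ p, ∀ v ∈ U, M.A p v ∈ U) → (∀ p, ∀ v ∈ U, M.B p v ∈ U) →
    U = ⊥ ∨ U = ⊤

/-- Isomorphism of modules. -/
def Isomorphic (M : BasisRep k V) (N : BasisRep k W) : Prop :=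
  ∃ f : V ≃ₗ[k] W, (∀ p v, f (M.A p v) = N.A p (f v)) ∧ ∀ p v, f (M.B p v) = N.B p (f v)

/-- `e_g`, `t`, `ζ_g`, `χ_g` act by the matrices of the table. -/
def HasTable {n : ℕ} (M : BasisRep k (Fin n → k)) (T : ActionTable k n) : Prop :=
  (∀ g, M.A (g, 0) = (T.e g).toLin') ∧ ∑ g : KG, M.A (g, 1) = T.t.toLin' ∧
    (∀ g, M.B (g, 0) = (T.zeta g).toLin') ∧ ∀ g, M.B (g, 1) = (T.chi g).toLin'

/-- The action of `H`. -/
noncomputable def actH (M : BasisRep k V) : KashinaH k →ₐ[k] Module.End k V :=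
  AlgHom.ofLinearMap ((KashinaH.basis k).constr k M.A)
    (by rw [KashinaH.one_def, map_sum]; simpa using M.A_one)
    (by
      have : (LinearMap.mul k (KashinaH k)).compr₂ ((KashinaH.basis k).constr k M.A) =
          (LinearMap.mul k (Module.End k V)).compl₁₂ ((KashinaH.basis k).constr k M.A)
            ((KashinaH.basis k).constr k M.A) := by
        refine (KashinaH.basis k).ext fun ⟨g, a⟩ => (KashinaH.basis k).ext fun ⟨h, b⟩ => ?_
        simp only [LinearMap.compr₂_apply, LinearMap.mul_apply', LinearMap.compl₁₂_apply,
          KashinaH.basis_mul, Module.Basis.constr_basis, M.A_mul]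
        split_ifs <;> simp
      intro x y
      simpa only [LinearMap.compr₂_apply, LinearMap.mul_apply', LinearMap.compl₁₂_apply] using
        congrArg (fun F => F x y) this)

@[simp]
theorem actH_basis (M : BasisRep k V) (p : KG × ZMod 2) : M.actH (KashinaH.basis k p) = M.A p := by
  exact (KashinaH.basis k).constr_basis k M.A p

theorem A_one_of_algHom (f : KashinaH k →ₐ[k] Module.End k V) :
    ∑ g : KG, f (KashinaH.basis k (g, 0)) = 1 := by
  rw [← map_sum, ← KashinaH.one_def, map_one]

theorem A_mul_of_algHom (f : KashinaH k →ₐ[k] Module.End k V) (g h : KG) (a b : ZMod 2) :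
    f (KashinaH.basis k (g, a)) * f (KashinaH.basis k (h, b)) =
      if KG.tact g a = h then (KG.sigma g a b : k) • f (KashinaH.basis k (g, a + b)) else 0 := by
  rw [← map_mul, KashinaH.basis_mul]
  split_ifs <;> simp

end BasisRep

/-! ### Left-right Yetter–Drinfel'd modules as operator systems. -/

namespace KashinaH

open KG

variable {k : Type*} [Field k] {V : Type*} [AddCommGroup V] [Module k V]

/-- The iterated coproduct has 64 terms, but the product h₃ (e_l # tᵇ) S⁻¹(h₁) vanishes unless both
outer factors take one prescribed value. The middle factor is then forced as well. -/
theorem twistLR_comul₃_basis (act : KashinaH k →ₐ[k] Module.End k V) (g l : KG) (a b : ZMod 2)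
    (v : V) :
    lift₃ (twistLR act) (comul₃ k (KashinaH k) (basis k (g, a))) (v ⊗ₜ basis k (l, b)) =
      ((theta (g - -tact l (a + b) - tact l a) a l b : ℤ) : k) •
        (act (basis k (g - -tact l (a + b) - tact l a, a)) v ⊗ₜ[k] basis k (tact l a, b)) := by
  have key : ∀ u w : KG, lift₃ (twistLR act)
      (basis k (u, a) ⊗ₜ[k] (basis k (g - u - w, a) ⊗ₜ[k] basis k (w, a)))
      (v ⊗ₜ basis k (l, b)) =
      if u = -tact l (a + b) ∧ w = tact l a then
        ((ssign u a * sigma l b a * sigma w a (b + a) : ℤ) : k) •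
          (act (basis k (g - u - w, a)) v ⊗ₜ[k] basis k (w, b)) else 0 := by
    intro u w
    change act (basis k (g - u - w, a)) v ⊗ₜ[k]
      (basis k (w, a) * (basis k (l, b) * antipodeInv k (KashinaH k) (basis k (u, a)))) = _
    rw [antipodeInv_eq, basis_mul_mul_antipode]
    split_ifs
    · rw [TensorProduct.tmul_smul]
    · rw [TensorProduct.tmul_zero]
  simp only [comul₃_basis, map_sum, map_smul, LinearMap.sum_apply, LinearMap.smul_apply, key]
  rw [Finset.sum_eq_single (-tact l (a + b)), Finset.sum_eq_single (tact l a), if_pos ⟨rfl, rfl⟩,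
    smul_smul, ← theta_coact]
  · push_cast; congr 1; ring
  · intro w _ hw; rw [if_neg (fun h => hw h.2), smul_zero]
  · simp
  · intro u _ hu
    exact Finset.sum_eq_zero fun w _ => by rw [if_neg (fun h => hu h.1), smul_zero]
  · simp

theorem e_mul_t (g : KG) : e k g * t k = basis k (g, 1) := by
  simp [e, t, Finset.mul_sum, basis_mul, tact_zero, sigma_left]

end KashinaH

namespace LeftRightYD

open KG KashinaH Coalgebra

variable {k : Type*} [Field k] {V : Type*} [AddCommGroup V] [Module k V]
  {W : Type*} [AddCommGroup W] [Module k W]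

section Coaction

variable (coact : V →ₗ[k] V ⊗[k] KashinaH k)

/-- The operators through which the dual basis acts on a right comodule. -/
noncomputable def dualAct (p : KG × ZMod 2) : Module.End k V := coeffRight (basis k) p ∘ₗ coact

theorem coact_eq_sum (v : V) : coact v = ∑ p, dualAct coact p v ⊗ₜ[k] basis k p :=
  (sum_coeffRight (basis k) (coact v)).symm

/-- A right comodule is a left module over H*: the coefficient of b_p ⊗ b_q is B_p B_q v on one
side, and on the other it is given by the structure constants of convolution. -/
theorem coassoc_iff :
    (TensorProduct.assoc k V (KashinaH k) (KashinaH k)).toLinearMap ∘ₗ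
        coact.rTensor (KashinaH k) ∘ₗ coact =
      (comul : KashinaH k →ₗ[k] KashinaH k ⊗[k] KashinaH k).lTensor V ∘ₗ coact ↔
    ∀ g h a b, dualAct coact (g, a) * dualAct coact (h, b) =
      if a = b then (tau g h a : k) • dualAct coact (g + h, a) else 0 := by
  have hl : ∀ v p q, coeffRight ((basis k).tensorProduct (basis k)) (p, q)
      ((TensorProduct.assoc k V (KashinaH k) (KashinaH k)) (coact.rTensor (KashinaH k) (coact v))) =
      dualAct coact p (dualAct coact q v) := by
    intro v p q
    conv_lhs => rw [coact_eq_sum coact v]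
    simp only [map_sum, LinearMap.rTensor_tmul]
    have : ∀ r, coact (dualAct coact r v) = ∑ s, dualAct coact s (dualAct coact r v) ⊗ₜ[k] basis k s :=
      fun r => coact_eq_sum coact _
    simp only [this, TensorProduct.sum_tmul, map_sum, TensorProduct.assoc_tmul, coeffRight_tmul,
      Module.Basis.coord_apply, Module.Basis.tensorProduct_repr_tmul_apply,
      Module.Basis.repr_self, Finsupp.single_apply, smul_eq_mul]
    simp only [mul_smul, ite_smul, one_smul, zero_smul, smul_ite, smul_zero]
    simp
  have hr : ∀ v g h a b, coeffRight ((basis k).tensorProduct (basis k)) ((g, a), (h, b))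
      ((comul : KashinaH k →ₗ[k] KashinaH k ⊗[k] KashinaH k).lTensor V (coact v)) =
      (if a = b then (tau g h a : k) • dualAct coact (g + h, a) else 0) v := by
    intro v g h a b
    conv_lhs => rw [coact_eq_sum coact v]
    simp only [map_sum, LinearMap.lTensor_tmul, coeffRight_tmul, coord_comul_basis]
    split_ifs with hab
    · simp [hab, ite_smul]
    · simp [hab]
  constructor
  · intro H g h a b
    ext v
    rw [← hr, Module.End.mul_apply, ← hl]
    exact congrArg _ (LinearMap.congr_fun H v)
  · intro H
    ext1 v
    refine coeffRight_ext ((basis k).tensorProduct (basis k)) fun ⟨⟨g, a⟩, (h, b)⟩ => ?_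
    simp only [LinearMap.comp_apply, LinearEquiv.coe_coe]
    rw [hr, hl, ← H]
    rfl

theorem counit_iff :
    (TensorProduct.rid k V).toLinearMap ∘ₗ (counit : KashinaH k →ₗ[k] k).lTensor V ∘ₗ coact =
      LinearMap.id ↔ dualAct coact (0, 0) + dualAct coact (0, 1) = 1 := by
  have : (TensorProduct.rid k V).toLinearMap ∘ₗ (counit : KashinaH k →ₗ[k] k).lTensor V ∘ₗ coact =
      dualAct coact (0, 0) + dualAct coact (0, 1) := by
    ext v
    simp only [LinearMap.comp_apply]
    rw [coact_eq_sum coact v]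
    simp only [map_sum, LinearMap.lTensor_tmul, Fintype.sum_prod_type_right, counit_basis]
    simp [show (Finset.univ : Finset (ZMod 2)) = {0, 1} from rfl, ite_smul]
    rfl
  rw [this]
  rfl

/-- Comparing coefficients of basis elements of H leaves one term on each side. The two forms differ
by a shift of the grade g and by moving `theta`, whose square is 1, across the equation. -/
theorem compat_iff (act : KashinaH k →ₐ[k] Module.End k V) :
    (∀ h v, coact (act h v) = lift₃ (twistLR act) (comul₃ k (KashinaH k) h) (coact v)) ↔
    ∀ g a m b, act (basis k (g, a)) * dualAct coact (m, b) =
      (theta g a m b : k) •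
        (dualAct coact (tact m a, b) * act (basis k (g - tact m (a + b) + tact m a, a))) := by
  have hr : ∀ g a m b v, coeffRight (basis k) (tact m a, b)
      (lift₃ (twistLR act) (comul₃ k (KashinaH k) (basis k (g, a))) (coact v)) =
      ((theta (g - -tact m (a + b) - tact m a) a m b : ℤ) : k) •
        act (basis k (g - -tact m (a + b) - tact m a, a)) (dualAct coact (m, b) v) := by
    intro g a m b v
    conv_lhs => rw [coact_eq_sum coact v]
    simp only [map_sum]
    rw [Finset.sum_eq_single (m, b)]
    · rw [twistLR_comul₃_basis, map_smul, coeffRight_tmul_basis, if_pos rfl]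
    · rintro ⟨l, c⟩ - hne
      rw [twistLR_comul₃_basis, map_smul, coeffRight_tmul_basis, if_neg, smul_zero]
      rintro h
      rw [Prod.mk.injEq] at h
      exact hne (by rw [(tact_involutive a).injective h.1, h.2])
    · simp
  have hsq : ∀ g a m b, (theta g a m b : k) * theta g a m b = 1 := fun g a m b => by
    rw [← Int.cast_mul, theta_mul_self, Int.cast_one]
  constructor
  · intro H g a m b
    ext v
    -- The grade is shifted so that the middle factor of the coproduct becomes e_g # tᵃ.
    have h1 := hr (g - tact m (a + b) + tact m a) a m b v
    rw [← H] at h1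
    have h2 : g - tact m (a + b) + tact m a - -tact m (a + b) - tact m a = g := by abel
    rw [h2] at h1
    simp only [LinearMap.smul_apply, Module.End.mul_apply]
    change dualAct coact (tact m a, b) (act (basis k (g - tact m (a + b) + tact m a, a)) v) = _ at h1
    rw [h1, smul_smul, hsq, one_smul]
  · intro H
    -- The condition is stated as an equality of linear maps in h, so that it suffices to test it on
    -- the basis. The coefficient at m is reached from `hr` at `tact m a`, because acting twice by
    -- tᵃ is the identity.
    have : (LinearMap.llcomp k V V (V ⊗[k] KashinaH k) coact) ∘ₗ act.toLinearMap =
        (LinearMap.lcomp k (V ⊗[k] KashinaH k) coact) ∘ₗ lift₃ (twistLR act) ∘ₗ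
          comul₃ k (KashinaH k) := by
      refine (basis k).ext fun ⟨g, a⟩ => LinearMap.ext fun v => coeffRight_ext (basis k) ?_
      rintro ⟨m, b⟩
      have h1 := hr g a (tact m a) b v
      have h2 : tact (tact m a) a = m := tact_involutive a m
      have h3 := LinearMap.congr_fun (H (g - -tact (tact m a) (a + b) - m) a (tact m a) b) v
      have h4 : g - -tact (tact m a) (a + b) - m - tact (tact m a) (a + b) + m = g := by abel
      simp only [LinearMap.smul_apply, Module.End.mul_apply] at h3
      rw [h2] at h1
      rw [h2, h4] at h3
      rw [h3, smul_smul, hsq, one_smul] at h1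
      exact h1.symm
    exact fun h v => LinearMap.congr_fun (LinearMap.congr_fun this h) v

end Coaction

/-- The operators by which the basis of `H` and its dual basis act. -/
noncomputable def toBasisRep (N : LeftRightYD k (KashinaH k) V) : BasisRep k V where
  A p := N.act (basis k p)
  B := dualAct N.coact
  A_one := BasisRep.A_one_of_algHom N.act
  A_mul := BasisRep.A_mul_of_algHom N.act
  B_one := (counit_iff _).1 N.counit_coact
  B_mul := (coassoc_iff _).1 N.coassoc
  cross := (compat_iff _ _).1 N.compat

theorem isSimple_iff (N : LeftRightYD k (KashinaH k) V) : N.IsSimple ↔ N.toBasisRep.IsSimple := by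
  refine and_congr Iff.rfl (forall_congr' fun U => ?_)
  have hA : (∀ h, ∀ v ∈ U, N.act h v ∈ U) ↔ ∀ p, ∀ v ∈ U, N.toBasisRep.A p v ∈ U := by
    refine ⟨fun h p => h _, fun H h v hv => ?_⟩
    rw [← (basis k).sum_repr h, map_sum, LinearMap.sum_apply]
    exact Submodule.sum_mem _ fun p _ => by
      rw [map_smul]; exact Submodule.smul_mem _ _ (H p v hv)
  have hB : (∀ v ∈ U, N.coact v ∈ LinearMap.range (U.subtype.rTensor (KashinaH k))) ↔
      ∀ p, ∀ v ∈ U, N.toBasisRep.B p v ∈ U := by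
    simp only [mem_range_rTensor_iff (basis k)]
    exact ⟨fun h p v hv => h v hv p, fun h v hv p => h p v hv⟩
  rw [hA, hB]

theorem isomorphic_iff (M : LeftRightYD k (KashinaH k) V) (N : LeftRightYD k (KashinaH k) W) :
    M.Isomorphic N ↔ M.toBasisRep.Isomorphic N.toBasisRep := by
  refine exists_congr fun f => and_congr ⟨fun h p => h _, fun H h v => ?_⟩ ⟨fun H p v => ?_, fun H v => ?_⟩
  · rw [← (basis k).sum_repr h]
    simp only [map_sum, LinearMap.sum_apply, map_smul, LinearMap.smul_apply]
    exact Finset.sum_congr rfl fun p _ => congrArg _ (H p v)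
  · have := congrArg (coeffRight (basis k) p) (H v)
    rw [coeffRight_rTensor] at this
    exact this.symm
  · refine coeffRight_ext (basis k) fun p => ?_
    rw [coeffRight_rTensor]
    exact (H p v).symm

/-- The right coaction `v ↦ ∑ B_p v ⊗ b_p`. -/
noncomputable def coactOf (B : KG × ZMod 2 → Module.End k V) : V →ₗ[k] V ⊗[k] KashinaH k :=
  ∑ p, (TensorProduct.mk k V (KashinaH k)).flip (basis k p) ∘ₗ B p

theorem coactOf_apply (B : KG × ZMod 2 → Module.End k V) (v : V) :
    coactOf B v = ∑ p, B p v ⊗ₜ[k] basis k p := by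
  simp [coactOf]

theorem dualAct_coactOf (B : KG × ZMod 2 → Module.End k V) : dualAct (coactOf B) = B := by
  funext p
  ext v
  rw [dualAct, LinearMap.comp_apply, coactOf_apply, coeffRight_sum]

/-- The Yetter–Drinfel'd module with given operators. -/
noncomputable def ofBasisRep (M : BasisRep k V) : LeftRightYD k (KashinaH k) V where
  act := M.actH
  coact := coactOf M.B
  coassoc := (coassoc_iff _).2 (by rw [dualAct_coactOf]; exact M.B_mul)
  counit_coact := (counit_iff _).2 (by rw [dualAct_coactOf]; exact M.B_one)
  compat := (compat_iff _ _).2 (by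
    simp only [dualAct_coactOf, BasisRep.actH_basis]
    exact M.cross)

theorem toBasisRep_ofBasisRep (M : BasisRep k V) : (ofBasisRep M).toBasisRep = M :=
  BasisRep.ext (funext fun p => M.actH_basis p) (dualAct_coactOf M.B)

theorem hasTable_of_toBasisRep {n : ℕ} {N : LeftRightYD k (KashinaH k) (Fin n → k)}
    {T : ActionTable k n} (h : N.toBasisRep.HasTable T) : N.HasTable T := by
  obtain ⟨h1, h2, h3, h4⟩ := h
  refine ⟨h1, by rw [t, map_sum]; exact h2, fun v => ?_⟩
  rw [coact_eq_sum N.coact v, Fintype.sum_prod_type]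
  refine Finset.sum_congr rfl fun g _ => ?_
  rw [e_mul_t, ← Matrix.toLin'_apply, ← h3, ← Matrix.toLin'_apply, ← h4]
  exact Fin.sum_univ_two _

end LeftRightYD

/-! ### Left-left Yetter–Drinfel'd modules, expanded in the image of the basis under the antipode.
-/

namespace KG

/-- The signs in Δ(S(h)) = S(h₂) ⊗ S(h₁). -/
theorem ssign_comul (g h : KG) (a : ZMod 2) :
    ssign g a * tau (-tact (g - h) a) (-tact h a) a * (ssign (g - h) a * ssign h a) =
      tau h (g - h) a := by
  revert g h a; decide

end KG

namespace KashinaH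

open KG

variable {k : Type*} [Field k] {V : Type*} [AddCommGroup V] [Module k V]

variable (k) in
/-- The image of the standard basis under the antipode. -/
noncomputable def antipodeBasis : Module.Basis (KG × ZMod 2) k (KashinaH k) :=
  (basis k).map (LinearEquiv.ofBijective _ (BijectiveAntipode.bijective (k := k) (H := KashinaH k)))

theorem antipodeBasis_apply (p : KG × ZMod 2) :
    antipodeBasis k p = HopfAlgebra.antipode k (basis k p) := by
  simp [antipodeBasis]

theorem ssign_sq (g : KG) (a : ZMod 2) : (ssign g a : k) * ssign g a = 1 := by
  rw [← Int.cast_mul, ssign_mul_self, Int.cast_one]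

theorem basis_neg_tact (g : KG) (a : ZMod 2) :
    basis k (-tact g a, a) = (ssign g a : k) • antipodeBasis k (g, a) := by
  rw [antipodeBasis_apply, antipode_basis, smul_smul, ssign_sq, one_smul]

theorem comul_antipodeBasis (g : KG) (a : ZMod 2) :
    Coalgebra.comul (R := k) (antipodeBasis k (g, a)) =
      ∑ h : KG, (tau h (g - h) a : k) •
        (antipodeBasis k (g - h, a) ⊗ₜ[k] antipodeBasis k (h, a)) := by
  have hinv : Function.Involutive fun h : KG => -tact h a := neg_tact_involutive a
  rw [antipodeBasis_apply, antipode_basis, map_smul, comul_basis, Finset.smul_sum,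
    ← Equiv.sum_comp ((Equiv.subLeft g).trans hinv.toPerm)]
  refine Finset.sum_congr rfl fun h _ => ?_
  have h1 : -tact g a - -tact (g - h) a = -tact h a := by
    conv_lhs => rw [← sub_add_cancel g h, tact_add, add_sub_cancel_right]
    abel
  simp only [Equiv.trans_apply, Equiv.subLeft_apply, Function.Involutive.coe_toPerm]
  rw [h1, basis_neg_tact, basis_neg_tact, ← TensorProduct.smul_tmul', TensorProduct.tmul_smul,
    smul_smul, smul_smul, smul_smul, ← ssign_comul]
  push_cast
  congr 1
  ring

theorem coord_comul_antipodeBasis (p q r : KG × ZMod 2) :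
    ((antipodeBasis k).tensorProduct (antipodeBasis k)).coord (p, q)
        (Coalgebra.comul (R := k) (antipodeBasis k r)) =
      if q.2 = p.2 ∧ r = (q.1 + p.1, q.2) then (tau q.1 p.1 q.2 : k) else 0 := by
  obtain ⟨g, a⟩ := r
  obtain ⟨u, b⟩ := p
  obtain ⟨v, c⟩ := q
  simp only [comul_antipodeBasis, map_sum, map_smul, Module.Basis.coord_apply,
    Module.Basis.tensorProduct_repr_tmul_apply, Module.Basis.repr_self, Finsupp.single_apply,
    Prod.mk.injEq, smul_eq_mul]
  rw [Finset.sum_eq_single v]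
  · by_cases h1 : a = c
    · by_cases h2 : a = b
      · by_cases h3 : g = v + u
        · subst h1 h2 h3; simp
        · have : g - v ≠ u := fun h => h3 (by rw [← h, add_sub_cancel])
          simp [h3, this]
      · have : ¬ (c = b ∧ g = v + u ∧ a = c) := fun h => h2 (h1.trans h.1)
        simp [h2, this]
    · simp [h1]
  · intro h _ hu
    simp [hu]
  · simp

theorem counit_antipodeBasis (g : KG) (a : ZMod 2) :
    Coalgebra.counit (R := k) (antipodeBasis k (g, a)) = if g = 0 then 1 else 0 := by
  rw [antipodeBasis_apply, antipode_basis, map_smul, counit_basis]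
  by_cases hg : g = 0
  · subst hg
    rw [if_pos (by rw [zero_tact, neg_zero]), if_pos rfl]
    have : ssign 0 a = 1 := by revert a; decide
    simp [this]
  · have : ¬ -tact g a = 0 := by revert g a; decide
    rw [if_neg this, if_neg hg, smul_zero]

/-- Up to sign S(e_l # tᵇ) is a basis element, so the triple product collapses by
`basis_mul_mul_antipode`, with the outer factors in exchanged roles. Writing the result in the
antipode basis gives exactly the coefficients of the left-right case. -/
theorem twistLL_comul₃_basis (act : KashinaH k →ₐ[k] Module.End k V) (g l : KG) (a b : ZMod 2)
    (v : V) :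
    lift₃ (twistLL act) (comul₃ k (KashinaH k) (basis k (g, a))) (antipodeBasis k (l, b) ⊗ₜ v) =
      ((theta (g - -tact l (a + b) - tact l a) a l b : ℤ) : k) •
        (antipodeBasis k (tact l a, b) ⊗ₜ[k]
          act (basis k (g - -tact l (a + b) - tact l a, a)) v) := by
  have hu : ∀ u : KG, u = tact (-tact l b) a ↔ u = -tact l (a + b) := by
    intro u; revert l u a b; decide
  have hw : ∀ w : KG, w = -tact (-tact l b) (a + b) ↔ w = tact l a := by
    intro w; revert l w a b; decide
  have h3 : -tact (tact l a) b = -tact l (a + b) := by rw [tact_tact]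
  have key : ∀ u w : KG, lift₃ (twistLL act)
      (basis k (u, a) ⊗ₜ[k] (basis k (g - u - w, a) ⊗ₜ[k] basis k (w, a)))
      (antipodeBasis k (l, b) ⊗ₜ v) =
      if w = tact l a ∧ u = -tact l (a + b) then
        ((ssign w a * sigma (-tact l b) b a * sigma u a (b + a) * ssign l b : ℤ) : k) •
          (basis k (u, b) ⊗ₜ[k] act (basis k (g - u - w, a)) v) else 0 := by
    intro u w
    change (basis k (u, a) * (antipodeBasis k (l, b) * HopfAlgebra.antipode k (basis k (w, a)))) ⊗ₜ[k]
      act (basis k (g - u - w, a)) v = _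
    rw [antipodeBasis_apply, antipode_basis, smul_mul_assoc, mul_smul_comm, basis_mul_mul_antipode]
    simp only [hu, hw]
    split_ifs
    · rw [smul_smul, ← TensorProduct.smul_tmul']
      push_cast; congr 1; ring
    · rw [smul_zero, TensorProduct.zero_tmul]
  simp only [comul₃_basis, map_sum, map_smul, LinearMap.sum_apply, LinearMap.smul_apply, key]
  rw [Finset.sum_eq_single (-tact l (a + b)), Finset.sum_eq_single (tact l a), if_pos ⟨rfl, rfl⟩,
    smul_smul, ← h3, basis_neg_tact, ← TensorProduct.smul_tmul', smul_smul, h3]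
  · congr 1
    have h5 := congrArg (Int.cast : ℤ → k) (theta_coact_left g l a b)
    push_cast at h5 ⊢
    linear_combination (ssign (tact l a) b : k) * h5 +
      (theta (g - -tact l (a + b) - tact l a) a l b : k) * ssign_sq (k := k) (tact l a) b
  · intro w _ hw; rw [if_neg (fun h => hw h.1), smul_zero]
  · simp
  · intro u _ hu
    exact Finset.sum_eq_zero fun w _ => by rw [if_neg (fun h => hu h.2), smul_zero]
  · simp

end KashinaH

namespace LeftLeftYD

open KG KashinaH Coalgebra

variable {k : Type*} [Field k] {V : Type*} [AddCommGroup V] [Module k V]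
  {W : Type*} [AddCommGroup W] [Module k W]

section Coaction

variable (coact : V →ₗ[k] KashinaH k ⊗[k] V)

/-- The operators through which the dual basis acts on a left comodule, twisted by the antipode. -/
noncomputable def dualAct (p : KG × ZMod 2) : Module.End k V :=
  coeffLeft (antipodeBasis k) p ∘ₗ coact

theorem coact_eq_sum (v : V) : coact v = ∑ p, antipodeBasis k p ⊗ₜ[k] dualAct coact p v :=
  (sum_coeffLeft (antipodeBasis k) (coact v)).symm

/-- Two reversals cancel: a left coaction composes its operators in the opposite order, and S
reverses the coproduct. Reading coefficients at the swapped pair therefore yields a left module over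
H*, as for right comodules. -/
theorem coassoc_iff :
    (TensorProduct.assoc k (KashinaH k) (KashinaH k) V).toLinearMap ∘ₗ
        (comul : KashinaH k →ₗ[k] KashinaH k ⊗[k] KashinaH k).rTensor V ∘ₗ coact =
      coact.lTensor (KashinaH k) ∘ₗ coact ↔
    ∀ g h a b, dualAct coact (g, a) * dualAct coact (h, b) =
      if a = b then (tau g h a : k) • dualAct coact (g + h, a) else 0 := by
  have hr : ∀ v p q, coeffLeft ((antipodeBasis k).tensorProduct (antipodeBasis k)) (q, p)
      ((TensorProduct.assoc k (KashinaH k) (KashinaH k) V).symm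
        (coact.lTensor (KashinaH k) (coact v))) =
      dualAct coact p (dualAct coact q v) := by
    intro v p q
    conv_lhs => rw [coact_eq_sum coact v]
    simp only [map_sum, LinearMap.lTensor_tmul]
    have : ∀ r, coact (dualAct coact r v) =
        ∑ s, antipodeBasis k s ⊗ₜ[k] dualAct coact s (dualAct coact r v) :=
      fun r => coact_eq_sum coact _
    simp only [this, TensorProduct.tmul_sum, map_sum, TensorProduct.assoc_symm_tmul,
      coeffLeft_tmul, Module.Basis.coord_apply, Module.Basis.tensorProduct_repr_tmul_apply,
      Module.Basis.repr_self, Finsupp.single_apply, smul_eq_mul]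
    simp only [mul_smul, ite_smul, one_smul, zero_smul, smul_ite, smul_zero]
    simp
  have hl : ∀ v g h a b,
      coeffLeft ((antipodeBasis k).tensorProduct (antipodeBasis k)) ((h, b), (g, a))
      ((comul : KashinaH k →ₗ[k] KashinaH k ⊗[k] KashinaH k).rTensor V (coact v)) =
      (if a = b then (tau g h a : k) • dualAct coact (g + h, a) else 0) v := by
    intro v g h a b
    conv_lhs => rw [coact_eq_sum coact v]
    simp only [map_sum, LinearMap.rTensor_tmul, coeffLeft_tmul, coord_comul_antipodeBasis]
    split_ifs with hab
    · simp [hab, ite_smul]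
    · simp [hab]
  constructor
  · intro H g h a b
    ext v
    rw [← hl, Module.End.mul_apply, ← hr]
    exact congrArg _ ((LinearEquiv.symm_apply_eq _).2 (LinearMap.congr_fun H v).symm)
  · intro H
    ext1 v
    simp only [LinearMap.comp_apply, LinearEquiv.coe_coe]
    rw [← LinearEquiv.eq_symm_apply]
    refine coeffLeft_ext ((antipodeBasis k).tensorProduct (antipodeBasis k))
      fun ⟨⟨h, b⟩, (g, a)⟩ => ?_
    rw [hr, hl, ← H]
    rfl

theorem counit_iff :
    (TensorProduct.lid k V).toLinearMap ∘ₗ (counit : KashinaH k →ₗ[k] k).rTensor V ∘ₗ coact =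
      LinearMap.id ↔ dualAct coact (0, 0) + dualAct coact (0, 1) = 1 := by
  have : (TensorProduct.lid k V).toLinearMap ∘ₗ (counit : KashinaH k →ₗ[k] k).rTensor V ∘ₗ coact =
      dualAct coact (0, 0) + dualAct coact (0, 1) := by
    ext v
    simp only [LinearMap.comp_apply]
    rw [coact_eq_sum coact v]
    simp only [map_sum, LinearMap.rTensor_tmul, Fintype.sum_prod_type_right, counit_antipodeBasis]
    simp [show (Finset.univ : Finset (ZMod 2)) = {0, 1} from rfl, ite_smul]
    rfl
  rw [this]
  rfl

theorem compat_iff (act : KashinaH k →ₐ[k] Module.End k V) :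
    (∀ h v, coact (act h v) = lift₃ (twistLL act) (comul₃ k (KashinaH k) h) (coact v)) ↔
    ∀ g a m b, act (basis k (g, a)) * dualAct coact (m, b) =
      (theta g a m b : k) •
        (dualAct coact (tact m a, b) * act (basis k (g - tact m (a + b) + tact m a, a))) := by
  have hr : ∀ g a m b v, coeffLeft (antipodeBasis k) (tact m a, b)
      (lift₃ (twistLL act) (comul₃ k (KashinaH k) (basis k (g, a))) (coact v)) =
      ((theta (g - -tact m (a + b) - tact m a) a m b : ℤ) : k) •
        act (basis k (g - -tact m (a + b) - tact m a, a)) (dualAct coact (m, b) v) := by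
    intro g a m b v
    conv_lhs => rw [coact_eq_sum coact v]
    simp only [map_sum]
    rw [Finset.sum_eq_single (m, b)]
    · rw [twistLL_comul₃_basis, map_smul, coeffLeft_tmul_basis, if_pos rfl]
    · rintro ⟨l, c⟩ - hne
      rw [twistLL_comul₃_basis, map_smul, coeffLeft_tmul_basis, if_neg, smul_zero]
      rintro h
      rw [Prod.mk.injEq] at h
      exact hne (by rw [(tact_involutive a).injective h.1, h.2])
    · simp
  have hsq : ∀ g a m b, (theta g a m b : k) * theta g a m b = 1 := fun g a m b => by
    rw [← Int.cast_mul, theta_mul_self, Int.cast_one]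
  constructor
  · intro H g a m b
    ext v
    have h1 := hr (g - tact m (a + b) + tact m a) a m b v
    rw [← H] at h1
    have h2 : g - tact m (a + b) + tact m a - -tact m (a + b) - tact m a = g := by abel
    rw [h2] at h1
    simp only [LinearMap.smul_apply, Module.End.mul_apply]
    change dualAct coact (tact m a, b) (act (basis k (g - tact m (a + b) + tact m a, a)) v) = _ at h1
    rw [h1, smul_smul, hsq, one_smul]
  · intro H
    have : (LinearMap.llcomp k V V (KashinaH k ⊗[k] V) coact) ∘ₗ act.toLinearMap =
        (LinearMap.lcomp k (KashinaH k ⊗[k] V) coact) ∘ₗ lift₃ (twistLL act) ∘ₗ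
          comul₃ k (KashinaH k) := by
      refine (basis k).ext fun ⟨g, a⟩ => LinearMap.ext fun v => coeffLeft_ext (antipodeBasis k) ?_
      rintro ⟨m, b⟩
      have h1 := hr g a (tact m a) b v
      have h2 : tact (tact m a) a = m := tact_involutive a m
      have h3 := LinearMap.congr_fun (H (g - -tact (tact m a) (a + b) - m) a (tact m a) b) v
      have h4 : g - -tact (tact m a) (a + b) - m - tact (tact m a) (a + b) + m = g := by abel
      simp only [LinearMap.smul_apply, Module.End.mul_apply] at h3
      rw [h2] at h1
      rw [h2, h4] at h3
      rw [h3, smul_smul, hsq, one_smul] at h1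
      exact h1.symm
    exact fun h v => LinearMap.congr_fun (LinearMap.congr_fun this h) v

end Coaction

/-- The operators by which the basis of `H` and its dual basis act. -/
noncomputable def toBasisRep (N : LeftLeftYD k (KashinaH k) V) : BasisRep k V where
  A p := N.act (basis k p)
  B := dualAct N.coact
  A_one := BasisRep.A_one_of_algHom N.act
  A_mul := BasisRep.A_mul_of_algHom N.act
  B_one := (counit_iff _).1 N.counit_coact
  B_mul := (coassoc_iff _).1 N.coassoc
  cross := (compat_iff _ _).1 N.compat

theorem isSimple_iff (N : LeftLeftYD k (KashinaH k) V) : N.IsSimple ↔ N.toBasisRep.IsSimple := by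
  refine and_congr Iff.rfl (forall_congr' fun U => ?_)
  have hA : (∀ h, ∀ v ∈ U, N.act h v ∈ U) ↔ ∀ p, ∀ v ∈ U, N.toBasisRep.A p v ∈ U := by
    refine ⟨fun h p => h _, fun H h v hv => ?_⟩
    rw [← (basis k).sum_repr h, map_sum, LinearMap.sum_apply]
    exact Submodule.sum_mem _ fun p _ => by
      rw [map_smul]; exact Submodule.smul_mem _ _ (H p v hv)
  have hB : (∀ v ∈ U, N.coact v ∈ LinearMap.range (U.subtype.lTensor (KashinaH k))) ↔
      ∀ p, ∀ v ∈ U, N.toBasisRep.B p v ∈ U := by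
    simp only [mem_range_lTensor_iff (antipodeBasis k)]
    exact ⟨fun h p v hv => h v hv p, fun h v hv p => h p v hv⟩
  rw [hA, hB]

theorem isomorphic_iff (M : LeftLeftYD k (KashinaH k) V) (N : LeftLeftYD k (KashinaH k) W) :
    M.Isomorphic N ↔ M.toBasisRep.Isomorphic N.toBasisRep := by
  refine exists_congr fun f =>
    and_congr ⟨fun h p => h _, fun H h v => ?_⟩ ⟨fun H p v => ?_, fun H v => ?_⟩
  · rw [← (basis k).sum_repr h]
    simp only [map_sum, LinearMap.sum_apply, map_smul, LinearMap.smul_apply]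
    exact Finset.sum_congr rfl fun p _ => congrArg _ (H p v)
  · have := congrArg (coeffLeft (antipodeBasis k) p) (H v)
    rw [coeffLeft_lTensor] at this
    exact this.symm
  · refine coeffLeft_ext (antipodeBasis k) fun p => ?_
    rw [coeffLeft_lTensor]
    exact (H p v).symm

/-- The left coaction `v ↦ ∑ S(b_p) ⊗ B_p v`. -/
noncomputable def coactOf (B : KG × ZMod 2 → Module.End k V) : V →ₗ[k] KashinaH k ⊗[k] V :=
  ∑ p, TensorProduct.mk k (KashinaH k) V (antipodeBasis k p) ∘ₗ B p

theorem coactOf_apply (B : KG × ZMod 2 → Module.End k V) (v : V) :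
    coactOf B v = ∑ p, antipodeBasis k p ⊗ₜ[k] B p v := by
  simp [coactOf]

theorem dualAct_coactOf (B : KG × ZMod 2 → Module.End k V) : dualAct (coactOf B) = B := by
  funext p
  ext v
  rw [dualAct, LinearMap.comp_apply, coactOf_apply, coeffLeft_sum]

/-- The Yetter–Drinfel'd module with given operators. -/
noncomputable def ofBasisRep (M : BasisRep k V) : LeftLeftYD k (KashinaH k) V where
  act := M.actH
  coact := coactOf M.B
  coassoc := (coassoc_iff _).2 (by rw [dualAct_coactOf]; exact M.B_mul)
  counit_coact := (counit_iff _).2 (by rw [dualAct_coactOf]; exact M.B_one)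
  compat := (compat_iff _ _).2 (by
    simp only [dualAct_coactOf, BasisRep.actH_basis]
    exact M.cross)

theorem toBasisRep_ofBasisRep (M : BasisRep k V) : (ofBasisRep M).toBasisRep = M :=
  BasisRep.ext (funext fun p => M.actH_basis p) (dualAct_coactOf M.B)

theorem hasTable_of_toBasisRep {n : ℕ} {N : LeftLeftYD k (KashinaH k) (Fin n → k)}
    {T : ActionTable k n} (h : N.toBasisRep.HasTable T) : N.HasTable T := by
  obtain ⟨h1, h2, h3, h4⟩ := h
  refine ⟨h1, by rw [t, map_sum]; exact h2, fun v => ?_⟩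
  rw [coact_eq_sum N.coact v, Fintype.sum_prod_type]
  refine Finset.sum_congr rfl fun g _ => ?_
  rw [e_mul_t, ← Matrix.toLin'_apply, ← h3, ← Matrix.toLin'_apply, ← h4, e,
    ← antipodeBasis_apply, ← antipodeBasis_apply]
  exact Fin.sum_univ_two _

end LeftLeftYD

/-! ### Modules over the Drinfel'd double as operator systems. -/

namespace KashinaH

open KG

variable (k : Type*) [Field k]

theorem coord_basis (p q : KG × ZMod 2) :
    (basis k).coord p (basis k q) = if q = p then 1 else 0 := by
  rw [Module.Basis.coord_apply, Module.Basis.repr_self, Finsupp.single_apply]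

theorem counit_eq : (Coalgebra.counit : KashinaH k →ₗ[k] k) =
    (basis k).coord (0, 0) + (basis k).coord (0, 1) := by
  refine (basis k).ext fun ⟨g, a⟩ => ?_
  rw [counit_basis, LinearMap.add_apply, coord_basis, coord_basis]
  have : a = 0 ∨ a = 1 := by revert a; decide
  by_cases hg : g = 0
  · rcases this with rfl | rfl <;> simp [hg]
  · simp [hg]

theorem dualMul_coord (g h : KG) (a b : ZMod 2) :
    dualMul k (KashinaH k) ((basis k).coord (g, a)) ((basis k).coord (h, b)) =
      if a = b then (tau g h a : k) • (basis k).coord (g + h, a) else 0 := by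
  have h1 : LinearMap.mul' k k ∘ₗ
      TensorProduct.map ((basis k).coord (g, a)) ((basis k).coord (h, b)) =
      ((basis k).tensorProduct (basis k)).coord ((g, a), (h, b)) := by
    ext x y
    simp
    ring
  refine (basis k).ext fun r => ?_
  change (LinearMap.mul' k k ∘ₗ
      TensorProduct.map ((basis k).coord (g, a)) ((basis k).coord (h, b)))
      (Coalgebra.comul (R := k) (basis k r)) = _
  rw [h1, coord_comul_basis, ite_and]
  split_ifs with hab hr
  · simp [hr]
  · rw [LinearMap.smul_apply, coord_basis, if_neg hr, smul_zero]
  · rfl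

/-- For a coordinate functional φ, the functional z ↦ ⟨φ, S⁻¹(h₃) z h₁⟩ vanishes for all but one
pair of outer factors, where it is plus or minus a coordinate functional (`hf`). -/
theorem doubleCross_basis (g m : KG) (a b : ZMod 2) :
    doubleCross (basis k (g, a)) ((basis k).coord (m, b)) =
      (theta g a m b : k) • ((basis k).coord (tact m a, b) ⊗ₜ[k]
        basis k (g - tact m (a + b) + tact m a, a)) := by
  have hf : ∀ u w : KG, (basis k).coord (m, b) ∘ₗ
      LinearMap.mulLeft k (antipodeInv k (KashinaH k) (basis k (w, a))) ∘ₗ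
        LinearMap.mulRight k (basis k (u, a)) =
      if u = tact m (a + b) ∧ w = -tact m a then
        ((ssign w a * sigma (tact m a) b a * sigma m a (b + a) : ℤ) : k) •
          (basis k).coord (tact m a, b) else 0 := by
    intro u w
    refine (basis k).ext fun ⟨l, c⟩ => ?_
    simp only [LinearMap.comp_apply, LinearMap.mulLeft_apply, LinearMap.mulRight_apply,
      antipodeInv_eq, antipode_mul_basis_mul]
    by_cases hc : c = b
    · subst hc
      by_cases hl : l = tact m a
      · subst hl
        have h1 : -tact (-tact m a) a = m := neg_tact_involutive a m
        rw [tact_tact]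
        split_ifs with h
        · obtain ⟨rfl, rfl⟩ := h
          rw [map_smul, LinearMap.smul_apply, h1, coord_basis, coord_basis, if_pos rfl, if_pos rfl]
        · simp
      · have h1 : -tact (-l) a ≠ m := by
          contrapose! hl; revert l m a; decide
        have h2 : ((if u = tact m (a + c) ∧ w = -tact m a then
            ((ssign w a * sigma (tact m a) c a * sigma m a (c + a) : ℤ) : k) •
              (basis k).coord (tact m a, c) else 0) : Module.Dual k (KashinaH k))
              (basis k (l, c)) = 0 := by
          split_ifs
          · rw [LinearMap.smul_apply, coord_basis, if_neg (by simp [hl]), smul_zero]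
          · rfl
        rw [h2]
        split_ifs with h
        · rw [h.2, map_smul, coord_basis, if_neg (by simp [h1]), smul_zero]
        · rw [map_zero]
    · have h1 : ∀ g h : KG, ¬ ((g, c) = (h, b)) := fun g h H => hc (Prod.mk.inj H).2
      split_ifs <;> simp [h1]
  have key : ∀ u w : KG, lift₃ (twistDouble k (KashinaH k))
      (basis k (u, a) ⊗ₜ[k] (basis k (g - u - w, a) ⊗ₜ[k] basis k (w, a)))
      ((basis k).coord (m, b)) =
      if u = tact m (a + b) ∧ w = -tact m a then
        ((ssign w a * sigma (tact m a) b a * sigma m a (b + a) : ℤ) : k) •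
          ((basis k).coord (tact m a, b) ⊗ₜ[k] basis k (g - u - w, a)) else 0 := by
    intro u w
    change ((basis k).coord (m, b) ∘ₗ
      LinearMap.mulLeft k (antipodeInv k (KashinaH k) (basis k (w, a))) ∘ₗ
        LinearMap.mulRight k (basis k (u, a))) ⊗ₜ[k] basis k (g - u - w, a) = _
    rw [hf]
    split_ifs
    · rw [TensorProduct.smul_tmul']
    · rw [TensorProduct.zero_tmul]
  simp only [doubleCross, comul₃_basis, map_sum, map_smul, LinearMap.sum_apply,
    LinearMap.smul_apply, key]
  rw [Finset.sum_eq_single (tact m (a + b)), Finset.sum_eq_single (-tact m a), if_pos ⟨rfl, rfl⟩,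
    smul_smul, ← theta_double, sub_neg_eq_add]
  · push_cast; congr 1; ring
  · intro w _ hw; rw [if_neg (fun h => hw h.2), smul_zero]
  · simp
  · intro u _ hu
    exact Finset.sum_eq_zero fun w _ => by rw [if_neg (fun h => hu h.1), smul_zero]
  · simp

end KashinaH

namespace DoubleModule

open KG KashinaH Coalgebra

variable {k : Type*} [Field k] {V : Type*} [AddCommGroup V] [Module k V]
  {W : Type*} [AddCommGroup W] [Module k W]

theorem doubleMul_counit (g : KG) (a : ZMod 2) (p : KG × ZMod 2) :
    doubleMul k (KashinaH k) (counit ⊗ₜ basis k (g, a)) (counit ⊗ₜ basis k p) =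
      counit ⊗ₜ (basis k (g, a) * basis k p) := by
  have ht : theta g a 0 0 = 1 ∧ theta g a 0 1 = 1 := by revert g a; decide
  have h1 : (1 : ZMod 2) ≠ 0 := by decide
  simp only [counit_eq, TensorProduct.add_tmul, map_add, LinearMap.add_apply, doubleMul_tmul,
    doubleCross_basis, TensorProduct.map_tmul, dualMul_coord, zero_tact, ht.1, ht.2,
    LinearMap.mulRight_apply, tau_left, h1, h1.symm, if_true, if_false, sub_zero, add_zero,
    Int.cast_one, one_smul, TensorProduct.zero_tmul, zero_add]

theorem doubleMul_coord_counit (q p : KG × ZMod 2) :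
    doubleMul k (KashinaH k) ((basis k).coord q ⊗ₜ 1) (counit ⊗ₜ basis k p) =
      (basis k).coord q ⊗ₜ basis k p := by
  obtain ⟨g, a⟩ := q
  have ht : ∀ g : KG, theta g 0 0 0 = 1 ∧ theta g 0 0 1 = 1 := by decide
  have h1 : (1 : ZMod 2) ≠ 0 := by decide
  have h2 : a = 0 ∨ a = 1 := by revert a; decide
  have h3 : ∑ h : KG, basis k (h, 0) * basis k p = basis k p := by
    rw [← Finset.sum_mul, ← one_def, one_mul]
  simp only [counit_eq, one_def, TensorProduct.tmul_sum, TensorProduct.add_tmul, map_add, map_sum,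
    LinearMap.sum_apply, doubleMul_tmul, doubleCross_basis, TensorProduct.map_tmul, dualMul_coord,
    zero_tact, (ht _).1,
    (ht _).2, LinearMap.mulRight_apply, tau_right, sub_zero, add_zero, Int.cast_one, one_smul]
  rcases h2 with rfl | rfl
  · simp [← TensorProduct.tmul_sum, h3, h1.symm]
  · simp [← TensorProduct.tmul_sum, h3, h1]

theorem doubleMul_coord (g h : KG) (a b : ZMod 2) :
    doubleMul k (KashinaH k) ((basis k).coord (g, a) ⊗ₜ 1) ((basis k).coord (h, b) ⊗ₜ 1) =
      (if a = b then (tau g h a : k) • (basis k).coord (g + h, a) else 0) ⊗ₜ 1 := by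
  have ht : ∀ g : KG, theta g 0 h b = 1 := by revert h b; decide
  simp only [doubleMul_tmul]
  conv_lhs => rw [one_def]
  have h0 : doubleCross (∑ l : KG, basis k (l, 0)) ((basis k).coord (h, b)) =
      ∑ l : KG, doubleCross (basis k (l, 0)) ((basis k).coord (h, b)) := by
    simp [doubleCross]
  have h4 : ∑ l : KG, basis k (l - tact h (0 + b) + tact h 0, 0) = 1 := by
    rw [one_def]
    refine Equiv.sum_comp (Equiv.addRight (-tact h (0 + b) + tact h 0))
      (fun l => basis k (l, 0)) |>.symm.trans ?_ |>.symm
    refine Finset.sum_congr rfl fun l _ => ?_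
    simp only [Equiv.coe_addRight, ← add_assoc, sub_eq_add_neg]
  rw [h0, map_sum]
  simp only [doubleCross_basis, ht, tact_zero, Int.cast_one, one_smul, TensorProduct.map_tmul,
    LinearMap.mulRight_apply, dualMul_coord, ← one_def, mul_one, ← TensorProduct.tmul_sum]
  rw [tact_zero] at h4
  rw [h4]

theorem doubleMul_counit_coord (g m : KG) (a b : ZMod 2) :
    doubleMul k (KashinaH k) (counit ⊗ₜ basis k (g, a)) ((basis k).coord (m, b) ⊗ₜ 1) =
      (theta g a m b : k) • ((basis k).coord (tact m a, b) ⊗ₜ[k]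
        basis k (g - tact m (a + b) + tact m a, a)) := by
  have hc : dualMul k (KashinaH k) counit ((basis k).coord (tact m a, b)) =
      (basis k).coord (tact m a, b) := by
    have h1 : (1 : ZMod 2) ≠ 0 := by decide
    have h2 : b = 0 ∨ b = 1 := by revert b; decide
    rw [counit_eq, map_add, LinearMap.add_apply, dualMul_coord, dualMul_coord]
    rcases h2 with rfl | rfl
    · simp [tau_left]
    · simp [tau_left]
  rw [doubleMul_tmul, doubleCross_basis, map_smul, TensorProduct.map_tmul, hc,
    LinearMap.mulRight_apply, mul_one]

/-- Since φ ⊗ h = (φ ⊗ 1)(ε ⊗ h), the copies of H* and H determine the action of all of D(H). -/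
theorem act_coord_basis (N : DoubleModule k (KashinaH k) V) (q p : KG × ZMod 2) :
    N.act ((basis k).coord q ⊗ₜ basis k p) =
      N.act ((basis k).coord q ⊗ₜ 1) * N.act (counit ⊗ₜ basis k p) := by
  rw [← N.act_mul, doubleMul_coord_counit]

/-- The operators by which the basis of `H` and its dual basis act. -/
noncomputable def toBasisRep (N : DoubleModule k (KashinaH k) V) : BasisRep k V where
  A p := N.act (counit ⊗ₜ basis k p)
  B p := N.act ((basis k).coord p ⊗ₜ 1)
  A_one := by
    rw [← map_sum, ← TensorProduct.tmul_sum, ← one_def]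
    exact N.act_one
  A_mul g h a b := by
    rw [← N.act_mul, doubleMul_counit, basis_mul]
    split_ifs <;> simp
  B_one := by
    rw [← map_add, ← TensorProduct.add_tmul, ← counit_eq]
    exact N.act_one
  B_mul g h a b := by
    rw [← N.act_mul, doubleMul_coord]
    split_ifs
    · rw [← TensorProduct.smul_tmul', map_smul]
    · rw [TensorProduct.zero_tmul, map_zero]
  cross g a m b := by
    rw [← N.act_mul, doubleMul_counit_coord, map_smul, act_coord_basis]

theorem span_coord_tmul_basis (z : DrinfeldDouble k (KashinaH k)) :
    z = ∑ r : (KG × ZMod 2) × (KG × ZMod 2),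
      ((basis k).dualBasis.tensorProduct (basis k)).repr z r •
        ((basis k).coord r.1 ⊗ₜ[k] basis k r.2) := by
  conv_lhs => rw [← ((basis k).dualBasis.tensorProduct (basis k)).sum_repr z]
  simp [Module.Basis.tensorProduct_apply']

theorem isSimple_iff (N : DoubleModule k (KashinaH k) V) :
    N.IsSimple ↔ N.toBasisRep.IsSimple := by
  refine and_congr Iff.rfl (forall_congr' fun U => ?_)
  have : (∀ a, ∀ v ∈ U, N.act a v ∈ U) ↔
      (∀ p, ∀ v ∈ U, N.toBasisRep.A p v ∈ U) ∧ ∀ p, ∀ v ∈ U, N.toBasisRep.B p v ∈ U := by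
    refine ⟨fun h => ⟨fun p => h _, fun p => h _⟩, fun ⟨hA, hB⟩ a v hv => ?_⟩
    rw [span_coord_tmul_basis a, map_sum, LinearMap.sum_apply]
    refine Submodule.sum_mem _ fun r _ => ?_
    rw [map_smul, act_coord_basis]
    exact Submodule.smul_mem _ _ (hB _ _ (hA _ v hv))
  rw [this, and_imp]

theorem isomorphic_iff (M : DoubleModule k (KashinaH k) V) (N : DoubleModule k (KashinaH k) W) :
    M.Isomorphic N ↔ M.toBasisRep.Isomorphic N.toBasisRep := by
  refine exists_congr fun f =>
    ⟨fun h => ⟨fun p => h _, fun p => h _⟩, fun ⟨hA, hB⟩ a v => ?_⟩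
  rw [span_coord_tmul_basis a]
  simp only [map_sum, LinearMap.sum_apply, map_smul, LinearMap.smul_apply, act_coord_basis,
    Module.End.mul_apply]
  exact Finset.sum_congr rfl fun r _ => congrArg _ ((hB _ _).trans (congrArg _ (hA _ v)))

/-- The linear map by which the Drinfel'd double acts through given operators. -/
noncomputable def actOf (M : BasisRep k V) : DrinfeldDouble k (KashinaH k) →ₗ[k] Module.End k V :=
  ((basis k).dualBasis.tensorProduct (basis k)).constr k fun r => M.B r.1 * M.A r.2

theorem actOf_coord_basis (M : BasisRep k V) (q p : KG × ZMod 2) :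
    actOf M ((basis k).coord q ⊗ₜ basis k p) = M.B q * M.A p := by
  have := ((basis k).dualBasis.tensorProduct (basis k)).constr_basis k
    (fun r => M.B r.1 * M.A r.2) (q, p)
  rwa [Module.Basis.tensorProduct_apply, Module.Basis.coe_dualBasis] at this

theorem actOf_counit_basis (M : BasisRep k V) (p : KG × ZMod 2) :
    actOf M (counit ⊗ₜ basis k p) = M.A p := by
  rw [counit_eq, TensorProduct.add_tmul, map_add, actOf_coord_basis, actOf_coord_basis, ← add_mul,
    M.B_one, one_mul]

theorem actOf_coord_one (M : BasisRep k V) (q : KG × ZMod 2) :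
    actOf M ((basis k).coord q ⊗ₜ 1) = M.B q := by
  simp only [one_def, TensorProduct.tmul_sum, map_sum, actOf_coord_basis, ← Finset.mul_sum,
    M.A_one, mul_one]

/-- The module over the Drinfel'd double with given operators. -/
noncomputable def ofBasisRep (M : BasisRep k V) : DoubleModule k (KashinaH k) V where
  act := actOf M
  act_one := by
    simp only [doubleOne, one_def, TensorProduct.tmul_sum, map_sum, actOf_counit_basis, M.A_one]
  act_mul := by
    have : (doubleMul k (KashinaH k)).compr₂ (actOf M) =
        (LinearMap.mul k (Module.End k V)).compl₁₂ (actOf M) (actOf M) := by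
      refine ((basis k).dualBasis.tensorProduct (basis k)).ext fun ⟨⟨g, a⟩, (h, b)⟩ =>
        ((basis k).dualBasis.tensorProduct (basis k)).ext fun ⟨⟨g', a'⟩, (h', b')⟩ => ?_
      simp only [LinearMap.compr₂_apply, LinearMap.mul_apply', LinearMap.compl₁₂_apply,
        Module.Basis.tensorProduct_apply, Module.Basis.coe_dualBasis, actOf_coord_basis]
      -- Moving the inner A past the inner B brings B A B A into the form B B A A, which matches the
      -- product of D(H) term by term.
      rw [mul_assoc, ← mul_assoc (M.A _), M.cross, smul_mul_assoc, mul_smul_comm, mul_assoc,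
        M.A_mul, ← mul_assoc, M.B_mul, doubleMul_tmul, doubleCross_basis, map_smul, map_smul,
        TensorProduct.map_tmul, LinearMap.mulRight_apply, dualMul_coord, basis_mul]
      congr 1
      split_ifs
      · rw [← TensorProduct.smul_tmul', TensorProduct.tmul_smul, map_smul, map_smul,
          actOf_coord_basis, smul_mul_smul_comm, smul_smul]
      all_goals simp
    intro x y
    simpa only [LinearMap.compr₂_apply, LinearMap.mul_apply', LinearMap.compl₁₂_apply] using
      congrArg (fun F => F x y) this

theorem toBasisRep_ofBasisRep (M : BasisRep k V) : (ofBasisRep M).toBasisRep = M :=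
  BasisRep.ext (funext fun p => actOf_counit_basis M p) (funext fun p => actOf_coord_one M p)

theorem hasTable_of_toBasisRep {n : ℕ} {N : DoubleModule k (KashinaH k) (Fin n → k)}
    {T : ActionTable k n} (h : N.toBasisRep.HasTable T) : N.HasTable T := by
  obtain ⟨h1, h2, h3, h4⟩ := h
  refine ⟨h1, ?_, h3, h4⟩
  rw [t, TensorProduct.tmul_sum, map_sum]
  exact h2

end DoubleModule

/-! ### Building modules from a grading, t, and two operators X and Y. -/

namespace KG

/-- Consistency of the commutation rule with products of dual basis elements: A passes B_m with one
sign, then passes B_m' in the shifted grade with another. Hence the rule for x and y implies it for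
all of G. -/
theorem theta_add (g m m' : KG) (a b : ZMod 2) :
    tau m m' b * theta g a m b * theta (g - tact m (a + b) + tact m a) a m' b *
      tau (tact m a) (tact m' a) b = theta g a (m + m') b := by
  rcases g with ⟨i, j⟩; rcases m with ⟨i', j'⟩; rcases m' with ⟨i'', j''⟩
  revert i j i' j' i'' j'' a b; decide

theorem induction_xy {P : KG → Prop} (hx : P (1, 0)) (hy : P (0, 1))
    (hadd : ∀ m m', P m → P m' → P (m + m')) (m : KG) : P m := by
  have h2 := hadd _ _ hx hx
  have h3 := hadd _ _ h2 hx
  -- As y² = 1, the identity element is itself a product of generators and needs no separate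
  -- hypothesis.
  have h0 := hadd _ _ hy hy
  have h1' := hadd _ _ hx hy
  have h2' := hadd _ _ h2 hy
  have h3' := hadd _ _ h3 hy
  have : ∀ m : KG, m = (0, 1) + (0, 1) ∨ m = (0, 1) ∨ m = (1, 0) ∨ m = (1, 0) + (0, 1) ∨
      m = (1, 0) + (1, 0) ∨ m = (1, 0) + (1, 0) + (0, 1) ∨ m = (1, 0) + (1, 0) + (1, 0) ∨
      m = (1, 0) + (1, 0) + (1, 0) + (0, 1) := by decide
  rcases this m with h | h | h | h | h | h | h | h <;> rw [h] <;> assumption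

theorem zmod2_cases (a : ZMod 2) : a = 0 ∨ a = 1 := by
  revert a; decide

end KG

namespace BasisRep

open KG

variable {k : Type*} [Field k] {V : Type*} [AddCommGroup V] [Module k V]

theorem tau_sq (g h : KG) (a : ZMod 2) : (tau g h a : k) * tau g h a = 1 := by
  rw [← Int.cast_mul, tau_mul_self, Int.cast_one]

/-- A module is determined by the grading, `t`, and the action of the dual basis, with the
commutation rules only for `x` and `y`. -/
noncomputable def ofGrading (E : KG → Module.End k V) (T : Module.End k V)
    (B : KG × ZMod 2 → Module.End k V)
    (hE : ∀ g h, E g * E h = if g = h then E g else 0) (hE1 : ∑ g, E g = 1)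
    (hET : ∀ g, E g * T = T * E (tact g 1)) (hTT : ∀ g, E g * (T * T) = (sigma g 1 1 : k) • E g)
    (hB1 : B (0, 0) + B (0, 1) = 1)
    (hB : ∀ g h a b, B (g, a) * B (h, b) = if a = b then (tau g h a : k) • B (g + h, a) else 0)
    (hEx : ∀ g b, E g * B ((1, 0), b) = B ((1, 0), b) * E (g - tact (1, 0) b + (1, 0)))
    (hEy : ∀ g b, E g * B ((0, 1), b) = B ((0, 1), b) * E g)
    (hTx : ∀ g b, E g * (T * B ((1, 0), b)) = (theta g 1 (1, 0) b : k) •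
      (B ((1, 1), b) * T * E (tact (g - tact (1, 0) (1 + b) + (1, 1)) 1)))
    (hTy : ∀ g b, E g * (T * B ((0, 1), b)) = (theta g 1 (0, 1) b : k) •
      (B ((0, 1), b) * T * E (tact g 1))) :
    BasisRep k V where
  A p := if p.2 = 0 then E p.1 else E p.1 * T
  B := B
  A_one := by simpa using hE1
  A_mul g h a b := by
    have h10 : (1 : ZMod 2) ≠ 0 := by decide
    have h11 : (1 : ZMod 2) + 1 = 0 := by decide
    have hTE : ∀ g, T * E g = E (tact g 1) * T := fun g => by
      rw [hET, tact_tact, h11, tact_zero]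
    rcases zmod2_cases a with rfl | rfl <;> rcases zmod2_cases b with rfl | rfl
    · simp [hE, tact_zero, sigma_left]
    · simp only [h10, if_true, if_false, tact_zero, sigma_left, zero_add, Int.cast_one, one_smul]
      rw [← mul_assoc, hE]
      split_ifs <;> simp
    · simp only [h10, if_true, if_false, sigma_right, add_zero, Int.cast_one, one_smul]
      rw [mul_assoc, hTE, ← mul_assoc, hE]
      simp only [tact_eq_iff]
      split_ifs <;> simp
    · simp only [h10, if_true, if_false, h11]
      rw [mul_assoc, ← mul_assoc T, hTE, mul_assoc, ← mul_assoc (E g), hE]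
      simp only [tact_eq_iff]
      split_ifs
      · rw [hTT]
      · rw [zero_mul]
  B_one := hB1
  B_mul := hB
  cross := by
    have h10 : (1 : ZMod 2) ≠ 0 := by decide
    have ht : ∀ g m b, theta g 0 m b = 1 := by decide
    intro g a m b
    -- The grade must vary in the induction, since moving A past B_m changes it before A meets B_m'.
    induction m using induction_xy generalizing g with
    | hx =>
      rcases zmod2_cases a with rfl | rfl
      · simp only [if_true, ht, Int.cast_one, one_smul, tact_zero, zero_add, hEx]
      · simp only [h10, if_false]
        rw [mul_assoc, hTx, hET, ← mul_assoc]
        rfl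
    | hy =>
      rcases zmod2_cases a with rfl | rfl
      · have hc : ∀ b, g - tact (0, 1) b + (0, 1) = g := by revert g; decide
        simp only [if_true, ht, Int.cast_one, one_smul, tact_zero, zero_add, hEy, hc]
      · have hc : ∀ b, g - tact (0, 1) b + (0, 1) = g := by revert g; decide
        have hd : tact (0, 1) 1 = (0, 1) := rfl
        simp only [h10, if_false]
        rw [mul_assoc, hTy, hET, ← mul_assoc, hd, hc]
    | hadd m m' hm hm' =>
      have h1 : B (m + m', b) = (tau m m' b : k) • (B (m, b) * B (m', b)) := by
        rw [hB, if_pos rfl, smul_smul, tau_sq, one_smul]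
      have h2 : g - tact m (a + b) + tact m a - tact m' (a + b) + tact m' a =
          g - tact (m + m') (a + b) + tact (m + m') a := by
        rw [tact_add, tact_add]; abel
      rw [h1, mul_smul_comm, ← mul_assoc, hm, smul_mul_assoc, mul_assoc, hm', mul_smul_comm,
        ← mul_assoc, hB, if_pos rfl, h2, tact_add m m' a, smul_mul_assoc,
          smul_smul, smul_smul, smul_smul,
        ← theta_add]
      push_cast
      rfl

end BasisRep

section Powers

variable {R : Type*} [Ring R]

theorem pow_val_add_four {X : R} (hX : X ^ 4 = 1) (a b : ZMod 4) :
    X ^ (a + b).val = X ^ a.val * X ^ b.val := by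
  rw [ZMod.val_add, ← pow_add, ← pow_eq_pow_mod _ hX]

theorem pow_val_add_two {X : R} (hX : X ^ 2 = 1) (a b : ZMod 2) :
    X ^ (a + b).val = X ^ a.val * X ^ b.val := by
  rw [ZMod.val_add, ← pow_add, ← pow_eq_pow_mod _ hX]

end Powers

namespace BasisRep

open KG

variable {k : Type*} [Field k] {V : Type*} [AddCommGroup V] [Module k V]

/-- The operators of the dual basis in a module on which only the `ζ_g`, resp. only the `χ_g`, act
nontrivially. -/
def powers (X Y : Module.End k V) (c : ZMod 2) (p : KG × ZMod 2) : Module.End k V :=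
  if p.2 = c then X ^ p.1.1.val * Y ^ p.1.2.val else 0

theorem powers_one {X Y : Module.End k V} (c : ZMod 2) :
    powers X Y c (0, 0) + powers X Y c (0, 1) = 1 := by
  rcases zmod2_cases c with rfl | rfl <;> simp [powers]

theorem pow_mul_comm_sign {X Y : Module.End k V} {s : k} (hYX : Y * X = s • (X * Y)) (m n : ℕ) :
    Y ^ n * X ^ m = s ^ (n * m) • (X ^ m * Y ^ n) := by
  have h1 : ∀ m, Y * X ^ m = s ^ m • (X ^ m * Y) := by
    intro m
    induction m with
    | zero => simp
    | succ m ih =>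
      rw [pow_succ, ← mul_assoc, ih, smul_mul_assoc, mul_assoc, hYX, mul_smul_comm, smul_smul,
        ← pow_succ, mul_assoc]
  induction n with
  | zero => simp
  | succ n ih =>
    rw [pow_succ, mul_assoc, h1, mul_smul_comm, ← mul_assoc, ih, smul_mul_assoc, smul_smul,
      mul_assoc, ← pow_add]
    congr 2
    ring

/-- Moving Yʲ past Xᵏ costs (-1)^(jk) when YX = -XY, and this is exactly τ(xⁱyʲ, xᵏyˡ; t). For c = 0
there is no sign, and τ is trivial. -/
theorem powers_mul {X Y : Module.End k V} (c : ZMod 2) (hX : X ^ 4 = 1) (hY : Y ^ 2 = 1)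
    (hYX : Y * X = (if c = 1 then -1 else 1 : k) • (X * Y)) (g h : KG) (a b : ZMod 2) :
    powers X Y c (g, a) * powers X Y c (h, b) =
      if a = b then (tau g h a : k) • powers X Y c (g + h, a) else 0 := by
  simp only [powers]
  by_cases ha : a = c
  · by_cases hb : b = c
    · subst ha; subst hb
      simp only [if_true, Prod.fst_add, Prod.snd_add, pow_val_add_four hX, pow_val_add_two hY]
      rw [mul_assoc, ← mul_assoc (Y ^ _), pow_mul_comm_sign hYX, smul_mul_assoc, mul_smul_comm]
      simp only [mul_assoc]
      congr 1
      simp only [tau]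
      split_ifs <;> simp
    · have : a ≠ b := fun h => hb (h ▸ ha)
      simp [hb, this]
  · simp [ha]

/-- A module on which the `χ_g` act by zero. -/
noncomputable def ofZeta (E : KG → Module.End k V) (T X Y : Module.End k V)
    (hE : ∀ g h, E g * E h = if g = h then E g else 0) (hE1 : ∑ g, E g = 1)
    (hET : ∀ g, E g * T = T * E (tact g 1)) (hTT : ∀ g, E g * (T * T) = (sigma g 1 1 : k) • E g)
    (hX : X ^ 4 = 1) (hY : Y ^ 2 = 1) (hYX : Y * X = X * Y)
    (hEX : ∀ g, E g * X = X * E g) (hEY : ∀ g, E g * Y = Y * E g)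
    (hTX : ∀ g, E g * (T * X) = ((theta g 1 (1, 0) 0 : k) • (X * Y * T)) * E (tact g 1))
    (hTY : ∀ g, E g * (T * Y) = ((theta g 1 (0, 1) 0 : k) • (Y * T)) * E (tact g 1)) :
    BasisRep k V :=
  ofGrading E T (powers X Y 0) hE hE1 hET hTT (powers_one 0)
    (powers_mul 0 hX hY (by simpa using hYX))
    (fun g b => by
      have hc : ∀ g : KG, g - tact (1, 0) 0 + (1, 0) = g := by decide
      rcases zmod2_cases b with rfl | rfl <;> simp [powers, ZMod.val_one'', hEX, hc])
    (fun g b => by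
      rcases zmod2_cases b with rfl | rfl <;> simp [powers, ZMod.val_one'', hEY])
    (fun g b => by
      have hc : ∀ g : KG, g - tact (1, 0) 1 + (1, 1) = g := by decide
      rcases zmod2_cases b with rfl | rfl <;> simp [powers, ZMod.val_one'', hTX, hc])
    (fun g b => by
      rcases zmod2_cases b with rfl | rfl <;> simp [powers, ZMod.val_one'', hTY])

/-- A module on which the `ζ_g` act by zero. -/
noncomputable def ofChi (E : KG → Module.End k V) (T X Y : Module.End k V)
    (hE : ∀ g h, E g * E h = if g = h then E g else 0) (hE1 : ∑ g, E g = 1)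
    (hET : ∀ g, E g * T = T * E (tact g 1)) (hTT : ∀ g, E g * (T * T) = (sigma g 1 1 : k) • E g)
    (hX : X ^ 4 = 1) (hY : Y ^ 2 = 1) (hYX : Y * X = -(X * Y))
    (hEX : ∀ g, E g * X = X * E (g + (0, 1))) (hEY : ∀ g, E g * Y = Y * E g)
    (hTX : ∀ g, E g * (T * X) =
      ((theta g 1 (1, 0) 1 : k) • (X * Y * T)) * E (tact (g + (0, 1)) 1))
    (hTY : ∀ g, E g * (T * Y) = ((theta g 1 (0, 1) 1 : k) • (Y * T)) * E (tact g 1)) :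
    BasisRep k V :=
  ofGrading E T (powers X Y 1) hE hE1 hET hTT (powers_one 1)
    (powers_mul 1 hX hY (by simpa using hYX))
    (fun g b => by
      have hc : ∀ g : KG, g - tact (1, 0) 1 + (1, 0) = g + (0, 1) := by decide
      rcases zmod2_cases b with rfl | rfl <;> simp [powers, ZMod.val_one'', hEX, hc])
    (fun g b => by
      rcases zmod2_cases b with rfl | rfl <;> simp [powers, ZMod.val_one'', hEY])
    (fun g b => by
      have h11 : (1 : ZMod 2) + 1 = 0 := by decide
      have hc : ∀ g : KG, g - tact (1, 0) 0 + (1, 1) = g + (0, 1) := by decide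
      rcases zmod2_cases b with rfl | rfl <;> simp [powers, ZMod.val_one'', hTX, hc, h11])
    (fun g b => by
      rcases zmod2_cases b with rfl | rfl <;> simp [powers, ZMod.val_one'', hTY])

end BasisRep

/-! ### The listed matrices satisfy the relations. -/

namespace BasisRep

open KG Label

variable {k : Type*} [Field k]

theorem exists_hasTable_zeta {n : ℕ} (E : KG → Matrix (Fin n) (Fin n) k)
    (T X Y : Matrix (Fin n) (Fin n) k)
    (hE : ∀ g h, E g * E h = if g = h then E g else 0) (hE1 : ∑ g, E g = 1)
    (hET : ∀ g, E g * T = T * E (tact g 1)) (hTT : ∀ g, E g * (T * T) = (sigma g 1 1 : k) • E g)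
    (hX : X ^ 4 = 1) (hY : Y ^ 2 = 1) (hYX : Y * X = X * Y)
    (hEX : ∀ g, E g * X = X * E g) (hEY : ∀ g, E g * Y = Y * E g)
    (hTX : ∀ g, E g * (T * X) = ((theta g 1 (1, 0) 0 : k) • (X * Y * T)) * E (tact g 1))
    (hTY : ∀ g, E g * (T * Y) = ((theta g 1 (0, 1) 0 : k) • (Y * T)) * E (tact g 1)) :
    ∃ M : BasisRep k (Fin n → k), M.HasTable ⟨E, T, fun g => X ^ g.1.val * Y ^ g.2.val, 0⟩ := by
  let Φ : Matrix (Fin n) (Fin n) k ≃ₐ[k] Module.End k (Fin n → k) := Matrix.toLinAlgEquiv'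
  have h1 : ∑ g, Φ (E g) = 1 := by rw [← map_sum, hE1, map_one]
  refine ⟨ofZeta (fun g => Φ (E g)) (Φ T) (Φ X) (Φ Y)
    (fun g h => by rw [← map_mul, hE]; split_ifs <;> simp) h1
    (fun g => by simp only [← map_mul, hET]) (fun g => by simp only [← map_mul, hTT, map_smul])
    (by rw [← map_pow, hX, map_one]) (by rw [← map_pow, hY, map_one])
    (by simp only [← map_mul, hYX])
    (fun g => by simp only [← map_mul, hEX]) (fun g => by simp only [← map_mul, hEY])
    (fun g => by simp only [← map_mul, hTX]; simp only [map_mul, map_smul])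
    (fun g => by simp only [← map_mul, hTY]; simp only [map_mul, map_smul]),
    fun g => ?_, ?_, fun g => ?_, fun g => ?_⟩
  · rfl
  · change ∑ g, Φ (E g) * Φ T = Φ T
    rw [← Finset.sum_mul, h1, one_mul]
  · change Φ X ^ _ * Φ Y ^ _ = Φ (X ^ _ * Y ^ _)
    rw [map_mul, map_pow, map_pow]
  · exact (map_zero Matrix.toLin').symm

theorem exists_hasTable_chi {n : ℕ} (E : KG → Matrix (Fin n) (Fin n) k)
    (T X Y : Matrix (Fin n) (Fin n) k)
    (hE : ∀ g h, E g * E h = if g = h then E g else 0) (hE1 : ∑ g, E g = 1)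
    (hET : ∀ g, E g * T = T * E (tact g 1)) (hTT : ∀ g, E g * (T * T) = (sigma g 1 1 : k) • E g)
    (hX : X ^ 4 = 1) (hY : Y ^ 2 = 1) (hYX : Y * X = -(X * Y))
    (hEX : ∀ g, E g * X = X * E (g + (0, 1))) (hEY : ∀ g, E g * Y = Y * E g)
    (hTX : ∀ g, E g * (T * X) =
      ((theta g 1 (1, 0) 1 : k) • (X * Y * T)) * E (tact (g + (0, 1)) 1))
    (hTY : ∀ g, E g * (T * Y) = ((theta g 1 (0, 1) 1 : k) • (Y * T)) * E (tact g 1)) :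
    ∃ M : BasisRep k (Fin n → k), M.HasTable ⟨E, T, 0, fun g => X ^ g.1.val * Y ^ g.2.val⟩ := by
  let Φ : Matrix (Fin n) (Fin n) k ≃ₐ[k] Module.End k (Fin n → k) := Matrix.toLinAlgEquiv'
  have h1 : ∑ g, Φ (E g) = 1 := by rw [← map_sum, hE1, map_one]
  refine ⟨ofChi (fun g => Φ (E g)) (Φ T) (Φ X) (Φ Y)
    (fun g h => by rw [← map_mul, hE]; split_ifs <;> simp) h1
    (fun g => by simp only [← map_mul, hET]) (fun g => by simp only [← map_mul, hTT, map_smul])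
    (by rw [← map_pow, hX, map_one]) (by rw [← map_pow, hY, map_one])
    (by simp only [← map_mul, hYX, map_neg])
    (fun g => by simp only [← map_mul, hEX]) (fun g => by simp only [← map_mul, hEY])
    (fun g => by simp only [← map_mul, hTX]; simp only [map_mul, map_smul])
    (fun g => by simp only [← map_mul, hTY]; simp only [map_mul, map_smul]),
    fun g => ?_, ?_, fun g => ?_, fun g => ?_⟩
  · rfl
  · change ∑ g, Φ (E g) * Φ T = Φ T
    rw [← Finset.sum_mul, h1, one_mul]
  · exact (map_zero Matrix.toLin').symm
  · change Φ X ^ _ * Φ Y ^ _ = Φ (X ^ _ * Y ^ _)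
    rw [map_mul, map_pow, map_pow]

theorem ite_mul_ite_of_ne {g h : KG} (hgh : g ≠ h) (μ : KG) :
    ((if g = μ then 1 else 0) * (if h = μ then 1 else 0) : k) = 0 := by
  by_cases hg : g = μ
  · rw [if_neg (fun hh : h = μ => hgh (hg.trans hh.symm)), mul_zero]
  · rw [if_neg hg, zero_mul]

theorem eMat_mul_eMat (μ ν g h : KG) :
    (eMat μ ν g * eMat μ ν h : Matrix (Fin 2) (Fin 2) k) = if g = h then eMat μ ν g else 0 := by
  by_cases hgh : g = h
  · subst hgh
    rw [if_pos rfl, eMat, Matrix.mul_fin_two]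
    split_ifs <;> simp
  · rw [if_neg hgh, eMat, eMat, Matrix.mul_fin_two]
    simp only [ite_mul_ite_of_ne hgh, mul_zero, zero_mul, add_zero]
    ext i j
    fin_cases i <;> fin_cases j <;> rfl

theorem sum_eMat (μ ν : KG) : ∑ g, (eMat μ ν g : Matrix (Fin 2) (Fin 2) k) = 1 := by
  ext i j
  rw [Matrix.sum_apply]
  fin_cases i <;> fin_cases j <;> simp [eMat]

theorem eMat_mul_antidiag {μ ν g g' : KG} {p q p' q' : k} (h1 : g = μ ↔ g' = ν)
    (h2 : g = ν ↔ g' = μ) (hp : g = μ → p = p') (hq : g = ν → q = q') :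
    eMat μ ν g * !![0, p; q, 0] = !![0, p'; q', 0] * eMat μ ν g' := by
  ext i j
  fin_cases i <;> fin_cases j <;> simp [eMat, ← h1, ← h2] <;> split_ifs <;> simp_all

theorem eMat_mul_diag {μ ν g g' : KG} {p q p' q' : k} (h1 : g = μ ↔ g' = μ)
    (h2 : g = ν ↔ g' = ν) (hp : g = μ → p = p') (hq : g = ν → q = q') :
    eMat μ ν g * !![p, 0; 0, q] = !![p', 0; 0, q'] * eMat μ ν g' := by
  ext i j
  fin_cases i <;> fin_cases j <;> simp [eMat, ← h1, ← h2] <;> split_ifs <;> simp_all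

theorem eMat_mul_diag' {μ ν g : KG} {p q s : k} (hp : g = μ → p = s) (hq : g = ν → q = s) :
    eMat μ ν g * !![p, 0; 0, q] = s • eMat μ ν g := by
  ext i j
  fin_cases i <;> fin_cases j <;> simp [eMat] <;> split_ifs <;> simp_all

theorem diag_pow (p q : k) (n : ℕ) : !![p, 0; 0, q] ^ n = !![p ^ n, 0; 0, q ^ n] := by
  induction n with
  | zero => ext i j; fin_cases i <;> fin_cases j <;> simp
  | succ n ih => rw [pow_succ, ih]; simp [pow_succ]

theorem diag_eq_one {p q : k} (hp : p = 1) (hq : q = 1) : !![p, 0; 0, q] = 1 := by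
  rw [hp, hq, Matrix.one_fin_two]

/-- The modules `W` and `X`. -/
theorem exists_hasTable_zetaTable (μ : KG) {p r r' s s' : k} (hp : p = sigma μ 1 1)
    (hr : r ^ 4 = 1) (hr' : r' ^ 4 = 1) (hs : s ^ 2 = 1) (hs' : s' ^ 2 = 1)
    (h1 : r = theta (tact μ 1) 1 (1, 0) 0 * (r' * s')) (h2 : r' = theta μ 1 (1, 0) 0 * (r * s))
    (h3 : s = theta (tact μ 1) 1 (0, 1) 0 * s') (h4 : s' = theta μ 1 (0, 1) 0 * s) :
    ∃ M : BasisRep k (Fin 2 → k), M.HasTable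
      (zetaTable μ (tact μ 1) !![0, p; 1, 0] !![r, 0; 0, r'] !![s, 0; 0, s']) := by
  have hi : ∀ g, tact g 1 = μ ↔ g = tact μ 1 := fun g => tact_eq_iff _ _ _
  have hi' : ∀ g, tact g 1 = tact μ 1 ↔ g = μ := fun g => (tact_involutive 1).injective.eq_iff
  -- The sign σ(g; t, t) depends only on the exponent of x, which the action of t preserves.
  have hσ : sigma (tact μ 1) 1 1 = sigma μ 1 1 := rfl
  refine exists_hasTable_zeta (eMat μ (tact μ 1)) _ _ _ (eMat_mul_eMat _ _) (sum_eMat _ _)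
    (fun g => ?_) (fun g => ?_) ?_ ?_ ?_ (fun g => ?_) (fun g => ?_) (fun g => ?_) (fun g => ?_)
  · exact eMat_mul_antidiag (hi' g).symm (hi g).symm (fun _ => rfl) (fun _ => rfl)
  · rw [Matrix.mul_fin_two]
    simp only [zero_mul, mul_zero, add_zero, zero_add, mul_one, one_mul]
    exact eMat_mul_diag' (fun h => by rw [h, hp]) (fun h => by rw [h, hσ, hp])
  · rw [diag_pow]; exact diag_eq_one hr hr'
  · rw [diag_pow]; exact diag_eq_one hs hs'
  · simp [mul_comm]
  · exact eMat_mul_diag Iff.rfl Iff.rfl (fun _ => rfl) (fun _ => rfl)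
  · exact eMat_mul_diag Iff.rfl Iff.rfl (fun _ => rfl) (fun _ => rfl)
  · simp only [Matrix.mul_fin_two, zero_mul, mul_zero, add_zero, zero_add, mul_one, one_mul,
      Matrix.smul_of, Matrix.smul_cons, smul_eq_mul, Matrix.smul_empty]
    exact eMat_mul_antidiag (hi' g).symm (hi g).symm
      (fun h => by subst h; linear_combination p * h2) (fun h => by subst h; exact h1)
  · simp only [Matrix.mul_fin_two, zero_mul, mul_zero, add_zero, zero_add, mul_one, one_mul,
      Matrix.smul_of, Matrix.smul_cons, smul_eq_mul, Matrix.smul_empty]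
    exact eMat_mul_antidiag (hi' g).symm (hi g).symm
      (fun h => by subst h; linear_combination p * h4) (fun h => by subst h; exact h3)

theorem antidiag_pow_four {ε : k} (hε : ε ^ 2 = 1) : !![0, ε; 1, 0] ^ 4 = 1 := by
  rw [show (4 : ℕ) = 2 * 2 from rfl, pow_mul, pow_two !![0, ε; 1, 0], Matrix.mul_fin_two]
  simp only [zero_mul, mul_zero, add_zero, zero_add, mul_one, one_mul]
  rw [diag_pow]
  exact diag_eq_one hε hε

/-- For μ = x, x³ both t and multiplication by y exchange μ and μy, so t and χ_x are both
antidiagonal in the modules Y. -/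
theorem odd_facts : ∀ c : Fin 2,
    (∀ g, g = xy (1 + 2 * c.val) 0 ↔ tact g 1 = xy (1 + 2 * c.val) 1) ∧
    (∀ g, g = xy (1 + 2 * c.val) 1 ↔ tact g 1 = xy (1 + 2 * c.val) 0) ∧
    (∀ g, g = xy (1 + 2 * c.val) 0 ↔ g + (0, 1) = xy (1 + 2 * c.val) 1) ∧
    (∀ g, g = xy (1 + 2 * c.val) 1 ↔ g + (0, 1) = xy (1 + 2 * c.val) 0) ∧
    (sigma (xy (1 + 2 * c.val) 0) 1 1 = (-1) ^ c.val ∧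
      sigma (xy (1 + 2 * c.val) 1) 1 1 = (-1) ^ c.val) ∧
    theta (xy (1 + 2 * c.val) 0) 1 (1, 0) 1 = 1 ∧ theta (xy (1 + 2 * c.val) 1) 1 (1, 0) 1 = -1 ∧
      theta (xy (1 + 2 * c.val) 0) 1 (0, 1) 1 = -1 ∧
      theta (xy (1 + 2 * c.val) 1) 1 (0, 1) 1 = -1 := by
  decide

/-- For μ = 1, x² the action of t fixes μ and μy while multiplication by y exchanges them, so in the
modules Z the matrix of t is diagonal and that of χ_x antidiagonal. -/
theorem even_facts : ∀ c : Fin 2,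
    (∀ g, g = xy (2 * c.val) 0 ↔ tact g 1 = xy (2 * c.val) 0) ∧
    (∀ g, g = xy (2 * c.val) 1 ↔ tact g 1 = xy (2 * c.val) 1) ∧
    (∀ g, g = xy (2 * c.val) 0 ↔ g + (0, 1) = xy (2 * c.val) 1) ∧
    (∀ g, g = xy (2 * c.val) 1 ↔ g + (0, 1) = xy (2 * c.val) 0) ∧
    (sigma (xy (2 * c.val) 0) 1 1 = (-1) ^ c.val ∧ sigma (xy (2 * c.val) 1) 1 1 = (-1) ^ c.val) ∧
    theta (xy (2 * c.val) 0) 1 (1, 0) 1 = 1 ∧ theta (xy (2 * c.val) 1) 1 (1, 0) 1 = -1 ∧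
      theta (xy (2 * c.val) 0) 1 (0, 1) 1 = 1 ∧ theta (xy (2 * c.val) 1) 1 (0, 1) 1 = 1 := by
  decide

theorem fixed_facts : ∀ a b : Fin 2,
    (∀ g, tact g 1 = xy (2 * a.val) b.val ↔ g = xy (2 * a.val) b.val) ∧
    sigma (xy (2 * a.val) b.val) 1 1 = (-1) ^ a.val ∧
    theta (xy (2 * a.val) b.val) 1 (1, 0) 0 = (-1) ^ b.val ∧
      theta (xy (2 * a.val) b.val) 1 (0, 1) 0 = 1 := by
  decide

/-- The modules `Y`. -/
theorem exists_hasTable_chiTable_odd (c : Fin 2) {q ε d : k} (hε : ε ^ 2 = 1) (hd : d ^ 2 = 1)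
    (hq : q ^ 2 = -(-1) ^ c.val * ε * d) :
    ∃ M : BasisRep k (Fin 2 → k), M.HasTable
      (chiTable (xy (1 + 2 * c.val) 0) (xy (1 + 2 * c.val) 1)
        !![0, -(ε * d * q); q, 0] !![0, ε; 1, 0] !![d, 0; 0, -d]) := by
  obtain ⟨hi, hi', ha, ha', hσ, ht⟩ := odd_facts c
  set μ := xy (1 + 2 * c.val) 0
  set ν := xy (1 + 2 * c.val) 1
  refine exists_hasTable_chi (eMat μ ν) _ _ _ (eMat_mul_eMat _ _) (sum_eMat _ _)
    (fun g => ?_) (fun g => ?_) (antidiag_pow_four hε) ?_ ?_ (fun g => ?_) (fun g => ?_)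
    (fun g => ?_) (fun g => ?_)
  · exact eMat_mul_antidiag (hi g) (hi' g) (fun _ => rfl) (fun _ => rfl)
  · rw [Matrix.mul_fin_two]
    simp only [zero_mul, mul_zero, add_zero, zero_add]
    -- This product is the scalar by which t² acts; it has to equal σ(μ; t, t).
    have h1 : -(ε * d * q) * q = (-1) ^ c.val := by
      linear_combination -(ε * d) * hq + (-1) ^ c.val * d ^ 2 * hε + (-1) ^ c.val * hd
    refine eMat_mul_diag' (fun h => ?_) (fun h => ?_)
    · rw [h, hσ.1, h1]; simp
    · rw [h, hσ.2, mul_comm, h1]; simp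
  · rw [diag_pow]; exact diag_eq_one hd (by rw [neg_sq, hd])
  · simp [mul_comm]
  · exact eMat_mul_antidiag (ha g) (ha' g) (fun _ => rfl) (fun _ => rfl)
  · exact eMat_mul_diag Iff.rfl Iff.rfl (fun _ => rfl) (fun _ => rfl)
  · simp only [Matrix.mul_fin_two, zero_mul, mul_zero, add_zero, zero_add, mul_one, one_mul,
      Matrix.smul_of, Matrix.smul_cons, smul_eq_mul, Matrix.smul_empty]
    refine eMat_mul_diag ((ha g).trans (hi' _)) ((ha' g).trans (hi _)) (fun h => ?_) (fun h => ?_)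
    · rw [h, ht.1]; push_cast; ring
    · rw [h, ht.2.1]; push_cast; linear_combination -ε * q * hd
  · simp only [Matrix.mul_fin_two, zero_mul, mul_zero, add_zero, zero_add,
      Matrix.smul_of, Matrix.smul_cons, smul_eq_mul, Matrix.smul_empty]
    refine eMat_mul_antidiag (hi g) (hi' g) (fun h => ?_) (fun h => ?_)
    · rw [h, ht.2.2.1]; push_cast; ring
    · rw [h, ht.2.2.2]; push_cast; ring

/-- The modules `Z`. -/
theorem exists_hasTable_chiTable_even (c : Fin 2) {p ε d : k} (hε : ε ^ 2 = 1) (hd : d ^ 2 = 1)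
    (hp : p ^ 2 = (-1) ^ c.val) :
    ∃ M : BasisRep k (Fin 2 → k), M.HasTable
      (chiTable (xy (2 * c.val) 0) (xy (2 * c.val) 1)
        !![p, 0; 0, -(d * p)] !![0, ε; 1, 0] !![d, 0; 0, -d]) := by
  obtain ⟨hi, hi', ha, ha', hσ, ht⟩ := even_facts c
  set μ := xy (2 * c.val) 0
  set ν := xy (2 * c.val) 1
  refine exists_hasTable_chi (eMat μ ν) _ _ _ (eMat_mul_eMat _ _) (sum_eMat _ _)
    (fun g => ?_) (fun g => ?_) (antidiag_pow_four hε) ?_ ?_ (fun g => ?_) (fun g => ?_)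
    (fun g => ?_) (fun g => ?_)
  · exact eMat_mul_diag (hi g) (hi' g) (fun _ => rfl) (fun _ => rfl)
  · rw [Matrix.mul_fin_two]
    simp only [zero_mul, mul_zero, add_zero, zero_add]
    refine eMat_mul_diag' (fun h => ?_) (fun h => ?_)
    · rw [h, hσ.1]; push_cast; linear_combination hp
    · rw [h, hσ.2]; push_cast; linear_combination p ^ 2 * hd + hp
  · rw [diag_pow]; exact diag_eq_one hd (by rw [neg_sq, hd])
  · simp [mul_comm]
  · exact eMat_mul_antidiag (ha g) (ha' g) (fun _ => rfl) (fun _ => rfl)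
  · exact eMat_mul_diag Iff.rfl Iff.rfl (fun _ => rfl) (fun _ => rfl)
  · simp only [Matrix.mul_fin_two, zero_mul, mul_zero, add_zero, zero_add, mul_one, one_mul,
      Matrix.smul_of, Matrix.smul_cons, smul_eq_mul, Matrix.smul_empty]
    refine eMat_mul_antidiag ((ha g).trans (hi' _)) ((ha' g).trans (hi _)) (fun h => ?_)
      (fun h => ?_)
    · rw [h, ht.1]; push_cast; linear_combination -p * ε * hd
    · rw [h, ht.2.1]; push_cast; ring
  · simp only [Matrix.mul_fin_two, zero_mul, mul_zero, add_zero, zero_add,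
      Matrix.smul_of, Matrix.smul_cons, smul_eq_mul, Matrix.smul_empty]
    refine eMat_mul_diag (hi g) (hi' g) (fun h => ?_) (fun h => ?_)
    · rw [h, ht.2.2.1]; push_cast; ring
    · rw [h, ht.2.2.2]; push_cast; ring

theorem mat_one_eq {R : Type*} {p q : R} : (!![p] : Matrix (Fin 1) (Fin 1) R) = !![q] ↔ p = q := by
  simp

/-- The modules `V`. -/
theorem exists_hasTable_one (a b : Fin 2) {p r : k} (hr : r ^ 4 = 1) (hp : p ^ 2 = (-1) ^ a.val) :
    ∃ M : BasisRep k (Fin 1 → k), M.HasTable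
      ⟨fun g => !![if g = xy (2 * a.val) b.val then 1 else 0], !![p],
        fun g => !![r] ^ g.1.val * !![(-1) ^ b.val] ^ g.2.val, 0⟩ := by
  obtain ⟨hi, hσ, ht⟩ := fixed_facts a b
  set μ := xy (2 * a.val) b.val
  have hb : ((-1) ^ b.val * (-1) ^ b.val : k) = 1 := by rw [← mul_pow]; simp
  have hpow : ∀ (r : k) (n : ℕ), !![r] ^ n = !![r ^ n] := fun r n => by
    induction n with
    | zero => ext i j; fin_cases i; fin_cases j; simp
    | succ n ih => rw [pow_succ, ih, pow_succ]; ext i j; fin_cases i; fin_cases j; simp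
  have hmul : ∀ r s : k, !![r] * !![s] = !![r * s] := fun r s => by
    ext i j; fin_cases i; fin_cases j; simp
  have hsmul : ∀ r s : k, r • !![s] = !![r * s] := fun r s => by
    ext i j; fin_cases i; fin_cases j; simp
  have hone : (1 : Matrix (Fin 1) (Fin 1) k) = !![1] := by
    ext i j; fin_cases i; fin_cases j; simp
  refine exists_hasTable_zeta _ _ _ _ (fun g h => ?_) ?_ (fun g => ?_) (fun g => ?_) ?_ ?_ ?_
    (fun g => ?_) (fun g => ?_) (fun g => ?_) (fun g => ?_)
  · by_cases hgh : g = h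
    · subst hgh; rw [if_pos rfl, hmul]; split_ifs <;> simp
    · rw [if_neg hgh, hmul, ite_mul_ite_of_ne hgh]
      ext i j; fin_cases i; fin_cases j; rfl
  · ext i j; rw [Matrix.sum_apply]; fin_cases i; fin_cases j; simp
  · simp only [hmul, hi, mul_comm]
  · rw [hmul, hmul, hsmul, mat_one_eq]
    split_ifs with h
    · rw [h, hσ]; push_cast; linear_combination hp
    · simp
  · rw [hpow, hr, hone]
  · rw [hpow, pow_two, hb, hone]
  · simp only [hmul, mul_comm]
  · simp only [hmul, mul_comm]
  · simp only [hmul, mul_comm]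
  · rw [hmul, hmul, hmul, hmul, hsmul, hmul, mat_one_eq]
    simp only [hi]
    split_ifs with h
    · rw [h, ht.1]; push_cast; linear_combination -p * r * hb
    · simp
  · rw [hmul, hmul, hmul, hsmul, hmul, mat_one_eq]
    simp only [hi]
    split_ifs with h
    · rw [h, ht.2]; push_cast; ring
    · simp

end BasisRep

namespace Label

open KG BasisRep

variable {k : Type*} [Field k] (ξ : k)

/-- The lower left entry of `t` in `Y`. -/
def paramYq (j : Fin 8) : k := ![ξ, -ξ, ξ, -ξ, 1, -1, 1, -1] j

/-- The scalar by which `χ_x²` acts on `Y`. -/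
def paramYε (c : Fin 2) (j : Fin 8) : k := (-1) ^ c.val * ![1, 1, -1, -1, -1, -1, 1, 1] j

/-- The upper left entry of `χ_y` in `Y`. -/
def paramYd (j : Fin 8) : k := ![1, 1, -1, -1, 1, 1, -1, -1] j

/-- The upper left entry of `t` in `Z`. -/
def paramZp (c : Fin 2) (j : Fin 8) : k := ξ ^ c.val * ![1, -1, 1, -1, 1, -1, 1, -1] j

/-- The scalar by which `χ_x²` acts on `Z`. -/
def paramZε (j : Fin 8) : k := ![1, 1, -1, -1, 1, 1, -1, -1] j

/-- The upper left entry of `χ_y` in `Z`. -/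
def paramZd (j : Fin 8) : k := ![-1, -1, -1, -1, 1, 1, 1, 1] j

/-- One formula for the listed tables. With w = χ_x v, the parameters are χ_x² = ε, χ_y v = dv and
tv = qw. The rest is forced: χ_y w = -dw by anticommutation, and tw = χ_x χ_y tv = -εdq v. The
condition on t² becomes the equation for q² in `paramY_rel`. -/
theorem table_Y (c : Fin 2) (j : Fin 8) : (table ξ (Y c j) : ActionTable k 2) =
    chiTable (xy (1 + 2 * c.val) 0) (xy (1 + 2 * c.val) 1)
      !![0, -(paramYε c j * paramYd j * paramYq ξ j); paramYq ξ j, 0]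
      !![0, paramYε c j; 1, 0] !![paramYd j, 0; 0, -paramYd j] := by
  fin_cases c <;> fin_cases j <;>
    (simp [table, tableYx, tableYx3, paramYq, paramYε, paramYd]; rfl)

/-- Here tv = pv, and with w = χ_x v the last entry is forced by tw = -χ_x χ_y tv = -dp w. -/
theorem table_Z (c : Fin 2) (j : Fin 8) : (table ξ (Z c j) : ActionTable k 2) =
    chiTable (xy (2 * c.val) 0) (xy (2 * c.val) 1)
      !![paramZp ξ c j, 0; 0, -(paramZd j * paramZp ξ c j)]
      !![0, paramZε j; 1, 0] !![paramZd j, 0; 0, -paramZd j] := by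
  fin_cases j <;> (simp [table, tableZ, paramZp, paramZε, paramZd]; rfl)

theorem sgn_sq (s : Bool) : (sgn s : k) ^ 2 = 1 := by
  cases s <;> simp [sgn]

variable {ξ}

theorem paramY_rel (hξ : ξ ^ 2 = -1) (c : Fin 2) (j : Fin 8) :
    (paramYε c j : k) ^ 2 = 1 ∧ (paramYd j : k) ^ 2 = 1 ∧
      paramYq ξ j ^ 2 = -(-1) ^ c.val * paramYε c j * paramYd j := by
  fin_cases c <;> fin_cases j <;> simp [paramYq, paramYε, paramYd, hξ]

theorem paramZ_rel (hξ : ξ ^ 2 = -1) (c : Fin 2) (j : Fin 8) :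
    (paramZε j : k) ^ 2 = 1 ∧ (paramZd j : k) ^ 2 = 1 ∧ paramZp ξ c j ^ 2 = (-1) ^ c.val := by
  fin_cases c <;> fin_cases j <;> simp [paramZp, paramZε, paramZd, hξ]

theorem exists_hasTable (hξ : ξ ^ 2 = -1) (l : Label) :
    ∃ M : BasisRep k (Fin l.dim → k), M.HasTable (l.table ξ) := by
  have h4 : ∀ n : ℕ, (ξ ^ n) ^ 4 = 1 := fun n => by
    rw [← pow_mul, mul_comm, pow_mul, show ξ ^ 4 = 1 by linear_combination (ξ ^ 2 - 1) * hξ,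
      one_pow]
  have hm : ∀ n : ℕ, ((-1 : k) ^ n) ^ 2 = 1 := fun n => by
    rw [← pow_mul, mul_comm, pow_mul, neg_one_sq, one_pow]
  rcases l with ⟨a, b, s, i⟩ | ⟨c, s, i⟩ | ⟨a, b, i⟩ | ⟨c, j⟩ | ⟨c, j⟩
  · have hpow : ∀ (r : k) (n : ℕ), !![r] ^ n = !![r ^ n] := fun r n => by
      induction n with
      | zero => ext i j; fin_cases i; fin_cases j; simp
      | succ n ih => rw [pow_succ, ih, pow_succ]; ext i j; fin_cases i; fin_cases j; simp
    have hmul : ∀ r s : k, !![r] * !![s] = !![r * s] := fun r s => by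
      ext i j; fin_cases i; fin_cases j; simp
    have h := exists_hasTable_one (k := k) a b (p := sgn s * ξ ^ a.val) (r := ξ ^ i.val) (h4 _)
      (by rw [mul_pow, sgn_sq, ← pow_mul, mul_comm a.val, pow_mul, hξ, one_mul])
    simp only [hpow, hmul, ← pow_mul] at h
    exact h
  · have hs := sgn_sq (k := k) s
    have hμ : tact (xy (1 + 2 * c.val) 0) 1 = xy (1 + 2 * c.val) 1 :=
      ((odd_facts c).1 _).1 rfl
    have ht : theta (xy (1 + 2 * c.val) 1) 1 (1, 0) 0 = 1 ∧
        theta (xy (1 + 2 * c.val) 0) 1 (1, 0) 0 = -1 ∧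
        theta (xy (1 + 2 * c.val) 1) 1 (0, 1) 0 = -1 ∧
        theta (xy (1 + 2 * c.val) 0) 1 (0, 1) 0 = -1 := by revert c; decide
    have h := exists_hasTable_zetaTable (k := k) (xy (1 + 2 * c.val) 0) (p := (-1) ^ c.val)
      (r := sgn s * ξ ^ i.val) (r' := ξ ^ i.val) (s := -sgn s) (s' := sgn s)
      (by rw [(odd_facts c).2.2.2.2.1.1]; simp)
      (by rw [mul_pow, h4, show (4 : ℕ) = 2 * 2 from rfl, pow_mul, hs]; simp) (h4 _)
      (by rw [neg_sq, hs]) hs (by rw [hμ, ht.1]; push_cast; ring)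
      (by rw [ht.2.1]; push_cast; linear_combination -ξ ^ i.val * hs)
      (by rw [hμ, ht.2.2.1]; push_cast; ring) (by rw [ht.2.2.2]; push_cast; ring)
    rw [hμ] at h
    exact h
  · have hb := hm b.val
    obtain ⟨h1, h2, h3, h5⟩ := fixed_facts a b
    have hμ : tact (xy (2 * a.val) b.val) 1 = xy (2 * a.val) b.val := (h1 _).2 rfl
    have h := exists_hasTable_zetaTable (k := k) (xy (2 * a.val) b.val) (p := (-1) ^ a.val)
      (r := ξ ^ i.val) (r' := -ξ ^ i.val) (s := -(-1) ^ b.val) (s' := -(-1) ^ b.val)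
      (by rw [h2]; simp) (h4 _) (by rw [Even.neg_pow (by decide), h4]) (by rw [neg_sq, hb])
      (by rw [neg_sq, hb]) (by rw [hμ, h3]; push_cast; linear_combination -ξ ^ i.val * hb)
      (by rw [h3]; push_cast; linear_combination ξ ^ i.val * hb)
      (by rw [hμ, h5]; push_cast; ring) (by rw [h5]; push_cast; ring)
    rw [hμ] at h
    exact h
  · obtain ⟨h1, h2, h3⟩ := paramY_rel hξ c j
    have h := exists_hasTable_chiTable_odd c h1 h2 h3
    rw [← table_Y] at h
    exact h
  · obtain ⟨h1, h2, h3⟩ := paramZ_rel hξ c j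
    have h := exists_hasTable_chiTable_even c h1 h2 h3
    rw [← table_Z] at h
    exact h

end Label

/-! ### Simplicity of the listed modules, and traces as invariants. -/

namespace BasisRep

open KG Label

variable {k : Type*} [Field k]

/-- Distinct diagonal entries make U contain the coordinate components of each of its vectors, and
the antidiagonal matrix carries each axis onto the other. -/
theorem submodule_eq_bot_or_top {U : Submodule k (Fin 2 → k)} {p q a b : k} (hpq : p ≠ q)
    (ha : a ≠ 0) (hb : b ≠ 0) (hD : ∀ u ∈ U, !![p, 0; 0, q].mulVec u ∈ U)
    (hA : ∀ u ∈ U, !![0, a; b, 0].mulVec u ∈ U) : U = ⊥ ∨ U = ⊤ := by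
  refine or_iff_not_imp_left.2 fun hU => ?_
  obtain ⟨u, hu, hu0⟩ := Submodule.exists_mem_ne_zero_of_ne_bot hU
  -- The operator (D - q)/(p - q) is the projection onto the first axis.
  have h0 : (![u 0, 0] : Fin 2 → k) ∈ U := by
    have := U.smul_mem (p - q)⁻¹ (U.sub_mem (hD u hu) (U.smul_mem q hu))
    convert this using 1
    have := sub_ne_zero.2 hpq
    ext i; fin_cases i <;> simp [Matrix.vecHead, Matrix.vecTail, ← sub_mul, this]
  have h1 : (![0, u 1] : Fin 2 → k) ∈ U := by
    have := U.sub_mem hu h0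
    convert this using 1
    ext i; fin_cases i <;> simp
  have h0' : (![0, b * u 0] : Fin 2 → k) ∈ U := by
    convert hA _ h0 using 1
    ext i; fin_cases i <;> simp [Matrix.mulVec]
  have h1' : (![a * u 1, 0] : Fin 2 → k) ∈ U := by
    convert hA _ h1 using 1
    ext i; fin_cases i <;> simp [Matrix.mulVec]
  have key : ∀ x y : k, x ≠ 0 → y ≠ 0 → (![x, 0] : Fin 2 → k) ∈ U → (![0, y] : Fin 2 → k) ∈ U →
      U = ⊤ := by
    intro x y hx hy h h'
    refine (Submodule.eq_top_iff').2 fun v => ?_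
    convert U.add_mem (U.smul_mem (v 0 * x⁻¹) h) (U.smul_mem (v 1 * y⁻¹) h') using 1
    ext i; fin_cases i <;> simp [hx, hy]
  by_cases h : u 0 = 0
  · have h' : u 1 ≠ 0 := fun h' => hu0 (by ext i; fin_cases i <;> simp [h, h'])
    exact key _ _ (mul_ne_zero ha h') h' h1' h1
  · exact key _ _ h (mul_ne_zero hb h) h0 h0'

theorem HasTable.isSimple_of_two {M : BasisRep k (Fin 2 → k)} {T : ActionTable k 2}
    (h : M.HasTable T) {p q a b : k} (hpq : p ≠ q) (ha : a ≠ 0) (hb : b ≠ 0)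
    (hD : (∃ g, T.e g = !![p, 0; 0, q]) ∨ ∃ g, T.zeta g = !![p, 0; 0, q])
    (hA : T.t = !![0, a; b, 0] ∨ ∃ g, T.chi g = !![0, a; b, 0]) : M.IsSimple := by
  refine ⟨inferInstance, fun U hUA hUB => submodule_eq_bot_or_top hpq ha hb (fun u hu => ?_)
    fun u hu => ?_⟩
  · rcases hD with ⟨g, hg⟩ | ⟨g, hg⟩
    · rw [← hg, ← Matrix.toLin'_apply, ← h.1]
      exact hUA _ u hu
    · rw [← hg, ← Matrix.toLin'_apply, ← h.2.2.1]
      exact hUB _ u hu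
  · rcases hA with hg | ⟨g, hg⟩
    · rw [← hg, ← Matrix.toLin'_apply, ← h.2.1, LinearMap.sum_apply]
      exact U.sum_mem fun g _ => hUA _ u hu
    · rw [← hg, ← Matrix.toLin'_apply, ← h.2.2.2]
      exact hUB _ u hu

theorem eMat_left {μ ν : KG} (h : μ ≠ ν) :
    (eMat μ ν μ : Matrix (Fin 2) (Fin 2) k) = !![1, 0; 0, 0] := by
  simp [eMat, h]

theorem xy_odd_ne (c : Fin 2) : xy (1 + 2 * c.val) 0 ≠ xy (1 + 2 * c.val) 1 := by
  revert c; decide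

theorem xy_even_ne (c : Fin 2) : xy (2 * c.val) 0 ≠ xy (2 * c.val) 1 := by
  revert c; decide

/-- The separating diagonal matrix is e_μ in W, Y, Z and ζ_x in X, where e_μ is scalar. The matrix
exchanging the axes is t in W, X and χ_x in Y, Z. -/
theorem HasTable.isSimple {ξ : k} [CharZero k] (hξ : ξ ^ 2 = -1) {l : Label}
    {M : BasisRep k (Fin l.dim → k)} (h : M.HasTable (l.table ξ)) : M.IsSimple := by
  have hξ0 : ξ ≠ 0 := by rintro rfl; simp at hξ
  have hm : ∀ n : ℕ, ((-1 : k) ^ n) ≠ 0 := fun n => pow_ne_zero _ (by simp)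
  have hne : ∀ {x : k}, x ≠ 0 → x ≠ -x := fun hx h => hx (self_eq_neg.1 h)
  have hx1 : ∀ X Y : Matrix (Fin 2) (Fin 2) k, X ^ (1 : ZMod 4).val * Y ^ (0 : ZMod 2).val = X :=
    fun X Y => by simp [ZMod.val_one'']
  rcases l with ⟨a, b, s, i⟩ | ⟨c, s, i⟩ | ⟨a, b, i⟩ | ⟨c, j⟩ | ⟨c, j⟩
  · refine ⟨inferInstanceAs (Nontrivial (Fin 1 → k)), fun U _ _ => ?_⟩
    have : IsSimpleModule k (Fin 1 → k) := isSimpleModule_iff_finrank_eq_one.2 (by simp)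
    exact eq_bot_or_eq_top (α := Submodule k (Fin 1 → k)) U
  · exact isSimple_of_two (M := M) h one_ne_zero (hm c.val) one_ne_zero
      (.inl ⟨_, eMat_left (xy_odd_ne c)⟩) (.inl rfl)
  · exact isSimple_of_two (M := M) h (hne (pow_ne_zero i.val hξ0)) (hm a.val) one_ne_zero
      (.inr ⟨(1, 0), hx1 _ _⟩) (.inl rfl)
  · have h0 : (paramYε c j : k) ≠ 0 := fun h0 => by
      simpa [h0] using (paramY_rel hξ c j).1
    have h' : BasisRep.HasTable (n := 2) M _ := (table_Y ξ c j) ▸ h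
    exact isSimple_of_two h' one_ne_zero h0 one_ne_zero
      (.inl ⟨_, eMat_left (xy_odd_ne c)⟩) (.inr ⟨(1, 0), hx1 _ _⟩)
  · have h0 : (paramZε j : k) ≠ 0 := fun h0 => by
      simpa [h0] using (paramZ_rel hξ c j).1
    have h' : BasisRep.HasTable (n := 2) M _ := (table_Z ξ c j) ▸ h
    exact isSimple_of_two h' one_ne_zero h0 one_ne_zero
      (.inl ⟨_, eMat_left (xy_even_ne c)⟩) (.inr ⟨(1, 0), hx1 _ _⟩)

section Traces

variable {n m : ℕ} {M : BasisRep k (Fin n → k)} {N : BasisRep k (Fin m → k)}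
  {S : ActionTable k n} {T : ActionTable k m}

/-- The traces of the operators that distinguish the modules of the list. -/
structure SameTraces (S : ActionTable k n) (T : ActionTable k m) : Prop where
  dim : n = m
  e : ∀ g, (S.e g).trace = (T.e g).trace
  zeta : ∀ g, (S.zeta g).trace = (T.zeta g).trace
  chi : ∀ g, (S.chi g).trace = (T.chi g).trace
  e_t : ∀ g, (S.e g * S.t).trace = (T.e g * T.t).trace
  e_zeta : ∀ g h, (S.e g * S.zeta h).trace = (T.e g * T.zeta h).trace
  e_chi : ∀ g h, (S.e g * S.chi h).trace = (T.e g * T.chi h).trace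
  e_t_chi : ∀ g h, (S.e g * (S.t * S.chi h)).trace = (T.e g * (T.t * T.chi h)).trace

theorem trace_eq_of_intertwine (f : (Fin n → k) ≃ₗ[k] (Fin m → k)) {P : Matrix (Fin n) (Fin n) k}
    {Q : Matrix (Fin m) (Fin m) k} (h : ∀ v, f (P.toLin' v) = Q.toLin' (f v)) :
    P.trace = Q.trace := by
  rw [← Matrix.trace_toLin'_eq, ← Matrix.trace_toLin'_eq, ← LinearMap.trace_conj' _ f]
  congr 1
  refine LinearMap.ext fun v => ?_
  rw [LinearEquiv.conj_apply_apply, h, LinearEquiv.apply_symm_apply]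

theorem intertwine_mul (f : (Fin n → k) ≃ₗ[k] (Fin m → k)) {P P' : Matrix (Fin n) (Fin n) k}
    {Q Q' : Matrix (Fin m) (Fin m) k} (h : ∀ v, f (P.toLin' v) = Q.toLin' (f v))
    (h' : ∀ v, f (P'.toLin' v) = Q'.toLin' (f v)) (v : Fin n → k) :
    f ((P * P').toLin' v) = (Q * Q').toLin' (f v) := by
  rw [Matrix.toLin'_mul, Matrix.toLin'_mul, LinearMap.comp_apply, LinearMap.comp_apply, h, h']

theorem Isomorphic.sameTraces (h : M.Isomorphic N) (hM : M.HasTable S) (hN : N.HasTable T) :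
    SameTraces S T := by
  obtain ⟨f, hA, hB⟩ := h
  have he : ∀ g v, f ((S.e g).toLin' v) = (T.e g).toLin' (f v) := fun g v => by
    rw [← hM.1, ← hN.1, hA]
  have ht : ∀ v, f (S.t.toLin' v) = T.t.toLin' (f v) := fun v => by
    rw [← hM.2.1, ← hN.2.1]; simp [hA]
  have hz : ∀ g v, f ((S.zeta g).toLin' v) = (T.zeta g).toLin' (f v) := fun g v => by
    rw [← hM.2.2.1, ← hN.2.2.1, hB]
  have hc : ∀ g v, f ((S.chi g).toLin' v) = (T.chi g).toLin' (f v) := fun g v => by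
    rw [← hM.2.2.2, ← hN.2.2.2, hB]
  exact
    { dim := by simpa using f.finrank_eq
      e := fun g => trace_eq_of_intertwine f (he g)
      zeta := fun g => trace_eq_of_intertwine f (hz g)
      chi := fun g => trace_eq_of_intertwine f (hc g)
      e_t := fun g => trace_eq_of_intertwine f (intertwine_mul f (he g) ht)
      e_zeta := fun g h => trace_eq_of_intertwine f (intertwine_mul f (he g) (hz h))
      e_chi := fun g h => trace_eq_of_intertwine f (intertwine_mul f (he g) (hc h))
      e_t_chi := fun g h =>
        trace_eq_of_intertwine f (intertwine_mul f (he g) (intertwine_mul f ht (hc h))) }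

end Traces

end BasisRep

/-! ### The listed modules are pairwise non-isomorphic. -/

namespace Label

open KG BasisRep

variable {k : Type*} [Field k] {ξ : k}

theorem trace_eMat (μ ν g : KG) : (eMat μ ν g : Matrix (Fin 2) (Fin 2) k).trace =
    (if g = μ then 1 else 0) + if g = ν then 1 else 0 := by
  simp [eMat]

theorem trace_eMat_mul (μ ν g : KG) (a b c d : k) : (eMat μ ν g * !![a, b; c, d]).trace =
    (if g = μ then a else 0) + if g = ν then d else 0 := by
  rw [eMat, Matrix.mul_fin_two, Matrix.trace_fin_two_of]
  simp

theorem sgn_injective [CharZero k] {s s' : Bool} (h : (sgn s : k) = sgn s') : s = s' := by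
  have : (1 : k) ≠ -1 := fun h => one_ne_zero (self_eq_neg.1 h)
  cases s <;> cases s' <;> simp [sgn, this, this.symm] at h ⊢

section Table

variable (μ ν : KG) (T X Y : Matrix (Fin 2) (Fin 2) k)

theorem zetaTable_zeta_x : (zetaTable μ ν T X Y).zeta (1, 0) = X := by
  simp [zetaTable, ZMod.val_one'']

theorem zetaTable_zeta_zero : (zetaTable μ ν T X Y).zeta (0, 0) = 1 := by
  simp [zetaTable]

theorem zetaTable_zeta_x_sq : (zetaTable μ ν T X Y).zeta (2, 0) = X * X := by
  have : (2 : ZMod 4).val = 2 := rfl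
  simp [zetaTable, this, pow_two]

theorem chiTable_chi_x : (chiTable μ ν T X Y).chi (1, 0) = X := by
  simp [chiTable, ZMod.val_one'']

theorem chiTable_chi_y : (chiTable μ ν T X Y).chi (0, 1) = Y := by
  simp [chiTable, ZMod.val_one'']

theorem chiTable_chi_x_sq : (chiTable μ ν T X Y).chi (2, 0) = X * X := by
  have : (2 : ZMod 4).val = 2 := rfl
  simp [chiTable, this, pow_two]

end Table

theorem eq_of_sameTraces_V [CharZero k] (hξ : IsPrimitiveRoot ξ 4) {a b : Fin 2} {s : Bool}
    {i : Fin 4} {a' b' : Fin 2} {s' : Bool} {i' : Fin 4}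
    (h : SameTraces (tableV ξ a b s i) (tableV ξ a' b' s' i')) :
    V a b s i = V a' b' s' i' := by
  have hξ0 : ξ ≠ 0 := hξ.ne_zero (by norm_num)
  have hinj : ∀ a b a' b' : Fin 2, xy (2 * a.val) b.val = xy (2 * a'.val) b'.val →
      a = a' ∧ b = b' := by decide
  have h1 := h.e (xy (2 * a.val) b.val)
  have h2 := h.e_t (xy (2 * a.val) b.val)
  have h3 := h.zeta (1, 0)
  have hμ : xy (2 * a.val) b.val = xy (2 * a'.val) b'.val := by
    by_contra hne
    simp [tableV, hne] at h1
  obtain ⟨rfl, rfl⟩ := hinj _ _ _ _ hμ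
  have hi : i = i' := by
    simp only [tableV, Matrix.trace_fin_one_of] at h3
    simp [ZMod.val_one''] at h3
    exact Fin.ext (hξ.pow_inj i.2 i'.2 h3)
  have hs : s = s' := by
    simp only [tableV, if_true] at h2
    simp [Matrix.trace, hξ0] at h2
    exact sgn_injective h2
  rw [hi, hs]

/-- The trace of e_μ gives c; those of e_g ζ_x for g = μy and g = μ read off the diagonal entries ξⁱ
and ±ξⁱ. -/
theorem eq_of_sameTraces_W [CharZero k] (hξ : IsPrimitiveRoot ξ 4) {c : Fin 2} {s : Bool}
    {i : Fin 4} {c' : Fin 2} {s' : Bool} {i' : Fin 4}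
    (h : SameTraces (tableW ξ c s i) (tableW ξ c' s' i')) : W c s i = W c' s' i' := by
  have hξ0 : ξ ≠ 0 := hξ.ne_zero (by norm_num)
  have hinj : ∀ c c' : Fin 2, xy (1 + 2 * c.val) 0 = xy (1 + 2 * c'.val) 0 ∨
      xy (1 + 2 * c.val) 0 = xy (1 + 2 * c'.val) 1 → c = c' := by decide
  have h1 := h.e (xy (1 + 2 * c.val) 0)
  have h2 := h.e_zeta (xy (1 + 2 * c.val) 0) (1, 0)
  have h3 := h.e_zeta (xy (1 + 2 * c.val) 1) (1, 0)
  simp only [tableW, zetaTable_zeta_x] at h1 h2 h3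
  simp only [zetaTable, trace_eMat, trace_eMat_mul, if_true, if_neg (xy_odd_ne c),
    if_neg (xy_odd_ne c).symm, zero_add, add_zero] at h1 h2 h3
  have hc : c = c' := by
    by_contra hne
    rw [if_neg fun h => hne (hinj c c' (.inl h)), if_neg fun h => hne (hinj c c' (.inr h))] at h1
    simp at h1
  subst hc
  simp only [if_true, if_neg (xy_odd_ne c), if_neg (xy_odd_ne c).symm, zero_add, add_zero] at h2 h3
  have hi : i = i' := Fin.ext (hξ.pow_inj i.2 i'.2 h3)
  subst hi
  rw [sgn_injective (mul_right_cancel₀ (pow_ne_zero _ hξ0) h2)]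

/-- Since ζ_x has trace 0, the trace 2ξ²ⁱ of its square is used; it determines i because i is 0 or
1. -/
theorem eq_of_sameTraces_X [CharZero k] (hξ : IsPrimitiveRoot ξ 4) {a b i a' b' i' : Fin 2}
    (h : SameTraces (tableX ξ a b i) (tableX ξ a' b' i')) : X a b i = X a' b' i' := by
  have hinj : ∀ a b a' b' : Fin 2, xy (2 * a.val) b.val = xy (2 * a'.val) b'.val →
      a = a' ∧ b = b' := by decide
  have h1 := h.e (xy (2 * a.val) b.val)
  have h2 := h.zeta (2, 0)
  simp only [tableX, zetaTable_zeta_x_sq] at h1 h2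
  simp only [zetaTable, trace_eMat, if_true] at h1
  have hμ : xy (2 * a.val) b.val = xy (2 * a'.val) b'.val := by
    by_contra hne
    rw [if_neg hne] at h1
    norm_num at h1
  obtain ⟨rfl, rfl⟩ := hinj _ _ _ _ hμ
  rw [Matrix.mul_fin_two, Matrix.mul_fin_two, Matrix.trace_fin_two_of, Matrix.trace_fin_two_of] at h2
  have h3 : ξ ^ (2 * i.val) = ξ ^ (2 * i'.val) := by
    rw [pow_mul', pow_mul']
    linear_combination h2 / 2
  have h4 := hξ.pow_inj (by omega) (by omega) h3
  rw [Fin.ext (show i.val = i'.val by omega)]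

/-- The traces of e_μ, e_μ χ_y and χ_x² give c, d and 2ε. As t has zero diagonal, q is recovered
from the trace qε of e_{μy} t χ_x. For given c, the pair (d, q) determines j. -/
theorem eq_of_sameTraces_Y [CharZero k] (hξ : ξ ^ 2 = -1) {c : Fin 2} {j : Fin 8} {c' : Fin 2}
    {j' : Fin 8}
    (h : SameTraces (n := 2) (m := 2) ((Y c j).table ξ) ((Y c' j').table ξ)) :
    Y c j = Y c' j' := by
  have hinj : ∀ c c' : Fin 2, xy (1 + 2 * c.val) 0 = xy (1 + 2 * c'.val) 0 ∨
      xy (1 + 2 * c.val) 0 = xy (1 + 2 * c'.val) 1 → c = c' := by decide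
  rw [table_Y, table_Y] at h
  have h1 := h.e (xy (1 + 2 * c.val) 0)
  have h2 := h.e_chi (xy (1 + 2 * c.val) 0) (0, 1)
  have h3 := h.chi (2, 0)
  have h4 := h.e_t_chi (xy (1 + 2 * c.val) 1) (1, 0)
  rw [chiTable_chi_y, chiTable_chi_y] at h2
  rw [chiTable_chi_x_sq, chiTable_chi_x_sq, Matrix.mul_fin_two, Matrix.mul_fin_two,
    Matrix.trace_fin_two_of, Matrix.trace_fin_two_of] at h3
  rw [chiTable_chi_x, chiTable_chi_x] at h4
  simp only [chiTable, Matrix.mul_fin_two, trace_eMat, trace_eMat_mul, if_true,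
    if_neg (xy_odd_ne c), if_neg (xy_odd_ne c).symm, zero_add, add_zero, zero_mul, mul_zero,
    one_mul, mul_one] at h1 h2 h3 h4
  have hc : c = c' := by
    by_contra hne
    rw [if_neg fun h => hne (hinj c c' (.inl h)), if_neg fun h => hne (hinj c c' (.inr h))] at h1
    simp at h1
  subst hc
  simp only [if_true, if_neg (xy_odd_ne c), if_neg (xy_odd_ne c).symm, zero_add, add_zero] at h2 h4
  have hε : (paramYε c j : k) = paramYε c j' := by linear_combination h3 / 2
  rw [hε] at h4
  have hε0 : (paramYε c j' : k) ≠ 0 := fun h0 => by simpa [h0] using (paramY_rel hξ c j').1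
  have hq := mul_right_cancel₀ hε0 h4
  have hm : (1 : k) ≠ -1 := fun h => one_ne_zero (self_eq_neg.1 h)
  have hξ0 : ξ ≠ 0 := by rintro rfl; simp at hξ
  have hξm : ξ ≠ -ξ := fun h => hξ0 (self_eq_neg.1 h)
  have hξ1 : ξ ≠ 1 := by rintro rfl; exact hm (by linear_combination hξ)
  have hξ2 : ξ ≠ -1 := by rintro rfl; exact hm (by linear_combination hξ)
  have hξ3 : -ξ ≠ 1 := fun h => hξ2 (by linear_combination -h)
  have : j = j' := by
    fin_cases j <;> fin_cases j' <;> first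
      | rfl
      | (exfalso; simp [paramYd, hm, hm.symm] at h2; done)
      | (exfalso
         simp [paramYq, hm, hm.symm, hξm, hξm.symm, hξ1, hξ1.symm, hξ2, hξ2.symm, hξ3, hξ3.symm] at hq)
  rw [this]

/-- Here t is diagonal, so p is the trace of e_μ t; together with d and ε it determines j. -/
theorem eq_of_sameTraces_Z [CharZero k] (hξ : ξ ^ 2 = -1) {c : Fin 2} {j : Fin 8} {c' : Fin 2}
    {j' : Fin 8}
    (h : SameTraces (n := 2) (m := 2) ((Z c j).table ξ) ((Z c' j').table ξ)) :
    Z c j = Z c' j' := by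
  have hinj : ∀ c c' : Fin 2, xy (2 * c.val) 0 = xy (2 * c'.val) 0 ∨
      xy (2 * c.val) 0 = xy (2 * c'.val) 1 → c = c' := by decide
  rw [table_Z, table_Z] at h
  have h1 := h.e (xy (2 * c.val) 0)
  have h2 := h.e_chi (xy (2 * c.val) 0) (0, 1)
  have h3 := h.chi (2, 0)
  have h4 := h.e_t (xy (2 * c.val) 0)
  rw [chiTable_chi_y, chiTable_chi_y] at h2
  rw [chiTable_chi_x_sq, chiTable_chi_x_sq, Matrix.mul_fin_two, Matrix.mul_fin_two,
    Matrix.trace_fin_two_of, Matrix.trace_fin_two_of] at h3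
  simp only [chiTable, trace_eMat, trace_eMat_mul, if_true,
    if_neg (xy_even_ne c), zero_add, add_zero, mul_zero,
    one_mul, mul_one] at h1 h2 h3 h4
  have hc : c = c' := by
    by_contra hne
    rw [if_neg fun h => hne (hinj c c' (.inl h)), if_neg fun h => hne (hinj c c' (.inr h))] at h1
    simp at h1
  subst hc
  simp only [if_true, if_neg (xy_even_ne c), add_zero] at h2 h4
  have hε : (paramZε j : k) = paramZε j' := by linear_combination h3 / 2
  have hξ0 : ξ ≠ 0 := by rintro rfl; simp at hξ
  have hq := mul_left_cancel₀ (pow_ne_zero _ hξ0) h4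
  have hm : (1 : k) ≠ -1 := fun h => one_ne_zero (self_eq_neg.1 h)
  have : j = j' := by
    fin_cases j <;> fin_cases j' <;> first
      | rfl
      | (exfalso; simp [paramZd, hm, hm.symm] at h2; done)
      | (exfalso; simp [paramZε, hm, hm.symm] at hε; done)
      | (exfalso; simp [hm, hm.symm] at hq)
  rw [this]

theorem sameTraces_symm {n m : ℕ} {S : ActionTable k n} {T : ActionTable k m}
    (h : SameTraces S T) : SameTraces T S :=
  ⟨h.dim.symm, fun g => (h.e g).symm, fun g => (h.zeta g).symm, fun g => (h.chi g).symm,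
    fun g => (h.e_t g).symm, fun g g' => (h.e_zeta g g').symm, fun g g' => (h.e_chi g g').symm,
    fun g g' => (h.e_t_chi g g').symm⟩

/-- The operator ζ_1 is the identity, of trace 2, on one side and zero on the other. -/
theorem not_sameTraces_zeta_chi [CharZero k] {μ ν μ' ν' : KG}
    {T X Y T' X' Y' : Matrix (Fin 2) (Fin 2) k} :
    ¬ SameTraces (zetaTable μ ν T X Y) (chiTable μ' ν' T' X' Y') := fun h => by
  have := h.zeta (0, 0)
  rw [zetaTable_zeta_zero] at this
  simp [chiTable] at this

theorem not_sameTraces_odd_even [CharZero k] {S T : ActionTable k 2} (c : Fin 2) {μ ν : KG}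
    (hS : S.e = eMat (xy (1 + 2 * c.val) 0) (xy (1 + 2 * c.val) 1)) (hT : T.e = eMat μ ν)
    (hμ : xy (1 + 2 * c.val) 0 ≠ μ) (hν : xy (1 + 2 * c.val) 0 ≠ ν) : ¬ SameTraces S T := fun h => by
  have := h.e (xy (1 + 2 * c.val) 0)
  rw [hS, hT, trace_eMat, trace_eMat, if_pos rfl, if_neg (xy_odd_ne c), if_neg hμ, if_neg hν] at this
  simp at this

theorem not_sameTraces_W_X [CharZero k] {c : Fin 2} {s : Bool} {i : Fin 4} {a b i' : Fin 2} :
    ¬ SameTraces (tableW ξ c s i) (tableX ξ a b i') :=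
  have h : ∀ c a b : Fin 2, xy (1 + 2 * c.val) 0 ≠ xy (2 * a.val) b.val := by decide
  not_sameTraces_odd_even c rfl rfl (h c a b) (h c a b)

theorem not_sameTraces_Y_Z [CharZero k] {c : Fin 2} {j : Fin 8} {c' : Fin 2} {j' : Fin 8} :
    ¬ SameTraces (n := 2) (m := 2) ((Y c j).table ξ) ((Z c' j').table ξ) := by
  have h : ∀ c c' : Fin 2, xy (1 + 2 * c.val) 0 ≠ xy (2 * c'.val) 0 ∧
      xy (1 + 2 * c.val) 0 ≠ xy (2 * c'.val) 1 := by decide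
  rw [table_Y, table_Z]
  exact not_sameTraces_odd_even c rfl rfl (h c c').1 (h c c').2

/-- The modules of the list are distinguished by traces. -/
theorem eq_of_sameTraces [CharZero k] (hξ : IsPrimitiveRoot ξ 4) (hξ2 : ξ ^ 2 = -1) {l m : Label}
    (h : SameTraces (l.table ξ) (m.table ξ)) : l = m := by
  have hYc : ∀ {S : ActionTable k 2} {c j}, SameTraces (n := 2) (m := 2) S ((Y c j).table ξ) →
      SameTraces S (chiTable (xy (1 + 2 * c.val) 0) (xy (1 + 2 * c.val) 1)
      !![0, -(paramYε c j * paramYd j * paramYq ξ j); paramYq ξ j, 0]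
      !![0, paramYε c j; 1, 0] !![paramYd j, 0; 0, -paramYd j]) := fun h => by rwa [← table_Y]
  have hZc : ∀ {S : ActionTable k 2} {c j}, SameTraces (n := 2) (m := 2) S ((Z c j).table ξ) →
      SameTraces S (chiTable (xy (2 * c.val) 0) (xy (2 * c.val) 1)
      !![paramZp ξ c j, 0; 0, -(paramZd j * paramZp ξ c j)]
      !![0, paramZε j; 1, 0] !![paramZd j, 0; 0, -paramZd j]) := fun h => by rwa [← table_Z]
  have h' := sameTraces_symm h
  rcases l with ⟨a, b, s, i⟩ | ⟨c, s, i⟩ | ⟨a, b, i⟩ | ⟨c, j⟩ | ⟨c, j⟩ <;>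
    rcases m with ⟨a', b', s', i'⟩ | ⟨c', s', i'⟩ | ⟨a', b', i'⟩ | ⟨c', j'⟩ | ⟨c', j'⟩
  · exact eq_of_sameTraces_V hξ h
  -- These are V against the four two-dimensional families, and W against V.
  iterate 5 exact absurd h.dim (by simp [dim])
  · exact eq_of_sameTraces_W hξ h
  · exact absurd h not_sameTraces_W_X
  · exact absurd (hYc h) not_sameTraces_zeta_chi
  · exact absurd (hZc h) not_sameTraces_zeta_chi
  · exact absurd h.dim (by simp [dim])
  · exact absurd h' not_sameTraces_W_X
  · exact eq_of_sameTraces_X hξ h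
  · exact absurd (hYc h) not_sameTraces_zeta_chi
  · exact absurd (hZc h) not_sameTraces_zeta_chi
  · exact absurd h.dim (by simp [dim])
  · exact absurd (hYc h') not_sameTraces_zeta_chi
  · exact absurd (hYc h') not_sameTraces_zeta_chi
  · exact eq_of_sameTraces_Y hξ2 h
  · exact absurd h not_sameTraces_Y_Z
  · exact absurd h.dim (by simp [dim])
  · exact absurd (hZc h') not_sameTraces_zeta_chi
  · exact absurd (hZc h') not_sameTraces_zeta_chi
  · exact absurd h' not_sameTraces_Y_Z
  · exact eq_of_sameTraces_Z hξ2 h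

end Label

/-! ### Families of vectors realising a table, and general facts on simple modules. -/

namespace BasisRep

open KG

variable {k : Type*} [Field k] {V : Type*} [AddCommGroup V] [Module k V]

section ActsBy

variable {n : ℕ} {v : Fin n → V} {F G : Module.End k V} {P Q : Matrix (Fin n) (Fin n) k}

/-- The operator `F` acts on the family `v` by the matrix `P`. -/
def ActsBy (v : Fin n → V) (F : Module.End k V) (P : Matrix (Fin n) (Fin n) k) : Prop :=
  ∀ j, F (v j) = ∑ i, P i j • v i

theorem ActsBy.zero : ActsBy v (0 : Module.End k V) 0 := fun j => by simp

theorem ActsBy.one : ActsBy v (1 : Module.End k V) 1 := fun j => by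
  simp [Matrix.one_apply]

theorem ActsBy.mul (hF : ActsBy v F P) (hG : ActsBy v G Q) : ActsBy v (F * G) (P * Q) := fun j => by
  simp only [Module.End.mul_apply, hG j, map_sum, map_smul, hF _, Finset.smul_sum, smul_smul,
    Matrix.mul_apply, Finset.sum_smul]
  rw [Finset.sum_comm]
  simp only [mul_comm]

theorem ActsBy.pow (hF : ActsBy v F P) (m : ℕ) : ActsBy v (F ^ m) (P ^ m) := by
  induction m with
  | zero => simpa using ActsBy.one
  | succ m ih => rw [pow_succ, pow_succ]; exact ih.mul hF

theorem ActsBy.of_one {v : V} {r : k} (h : F v = r • v) : ActsBy ![v] F !![r] := fun j => by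
  fin_cases j; simpa using h

theorem ActsBy.of_two {v w : V} {a b c d : k} (hv : F v = a • v + c • w)
    (hw : F w = b • v + d • w) : ActsBy ![v, w] F !![a, b; c, d] := fun j => by
  fin_cases j <;> simpa using ‹_›

theorem ActsBy.linearCombination (h : ActsBy v F P) (c : Fin n → k) :
    F (Fintype.linearCombination k v c) = Fintype.linearCombination k v (P.toLin' c) := by
  have : F ∘ₗ Fintype.linearCombination k v = Fintype.linearCombination k v ∘ₗ P.toLin' := by
    refine (Pi.basisFun k (Fin n)).ext fun j => ?_
    simp [Fintype.linearCombination_apply, h j, Pi.single_apply]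
  exact LinearMap.congr_fun this c

/-- The module has a nonzero family of vectors on which it acts by the matrices of the table. -/
def Realizes (N : BasisRep k V) (T : ActionTable k n) : Prop :=
  ∃ v : Fin n → V, v ≠ 0 ∧ (∀ g, ActsBy v (N.A (g, 0)) (T.e g)) ∧
    ActsBy v (∑ g, N.A (g, 1)) T.t ∧ (∀ g, ActsBy v (N.B (g, 0)) (T.zeta g)) ∧
    ∀ g, ActsBy v (N.B (g, 1)) (T.chi g)

theorem A_one_eq (N : BasisRep k V) (g : KG) : N.A (g, 1) = N.A (g, 0) * ∑ h, N.A (h, 1) := by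
  rw [Finset.mul_sum]
  simp [N.A_mul, tact_zero, sigma_left]

/-- Schur's lemma: the family defines a nonzero homomorphism f from kⁿ to V, whose kernel and range
are submodules of simple modules. Linear independence of the family is thus a consequence and need
not be checked beforehand. -/
theorem Realizes.isomorphic {N : BasisRep k V} {S : BasisRep k (Fin n → k)} {T : ActionTable k n}
    (h : N.Realizes T) (hS : S.HasTable T) (hS' : S.IsSimple) (hN : N.IsSimple) :
    N.Isomorphic S := by
  obtain ⟨v, hv, he, ht, hz, hc⟩ := h
  set f := Fintype.linearCombination k v with hf
  have hfA0 : ∀ g u, N.A (g, 0) (f u) = f (S.A (g, 0) u) := fun g u => by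
    rw [hS.1]; exact (he g).linearCombination u
  have hfA : ∀ p u, N.A p (f u) = f (S.A p u) := by
    rintro ⟨g, a⟩ u
    rcases zmod2_cases a with rfl | rfl
    · exact hfA0 g u
    · rw [A_one_eq, A_one_eq S, Module.End.mul_apply, Module.End.mul_apply, ← hfA0, hS.2.1,
        ← ht.linearCombination]
  have hfB : ∀ p u, N.B p (f u) = f (S.B p u) := by
    rintro ⟨g, a⟩ u
    rcases zmod2_cases a with rfl | rfl
    · rw [hS.2.2.1]; exact (hz g).linearCombination u
    · rw [hS.2.2.2]; exact (hc g).linearCombination u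
  have hne : f ≠ 0 := fun h0 => hv <| funext fun i => by
    simpa [hf, Fintype.linearCombination_apply, Pi.single_apply] using
      LinearMap.congr_fun h0 (Pi.single i 1)
  have hker : LinearMap.ker f = ⊥ := by
    refine (hS'.2 _ (fun p u hu => ?_) fun p u hu => ?_).resolve_right
      fun h => hne (LinearMap.ker_eq_top.1 h)
    · rw [LinearMap.mem_ker] at hu ⊢
      rw [← hfA, hu, map_zero]
    · rw [LinearMap.mem_ker] at hu ⊢
      rw [← hfB, hu, map_zero]
  have hrange : LinearMap.range f = ⊤ := by
    refine (hN.2 _ ?_ ?_).resolve_left fun h => hne (LinearMap.range_eq_bot.1 h)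
    · rintro p _ ⟨u, rfl⟩
      exact ⟨_, (hfA p u).symm⟩
    · rintro p _ ⟨u, rfl⟩
      exact ⟨_, (hfB p u).symm⟩
  let F := LinearEquiv.ofBijective f ⟨LinearMap.ker_eq_bot.1 hker, LinearMap.range_eq_top.1 hrange⟩
  refine ⟨F.symm, fun p x => ?_, fun p x => ?_⟩
  · rw [LinearEquiv.symm_apply_eq]
    exact ((hfA p (F.symm x)).symm.trans (congrArg _ (F.apply_symm_apply x))).symm
  · rw [LinearEquiv.symm_apply_eq]
    exact ((hfB p (F.symm x)).symm.trans (congrArg _ (F.apply_symm_apply x))).symm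

end ActsBy

/-- Only the `ζ_g` (`c = 0`), resp. only the `χ_g` (`c = 1`), act nontrivially. -/
structure IsPure (N : BasisRep k V) (c : ZMod 2) : Prop where
  one : N.B (0, c) = 1
  zero : ∀ b ≠ c, ∀ m, N.B (m, b) = 0

/-- The idempotent B_(1,1) of ζ_1 commutes with every operator of the module, so its kernel is a
submodule and it is 0 or 1. Once ζ_1 or χ_1 vanishes, so does its whole family, because the product
with it reproduces every member. -/
theorem IsSimple.exists_isPure {N : BasisRep k V} (hN : N.IsSimple) : ∃ c, N.IsPure c := by
  have hA : ∀ p, N.A p * N.B (0, 0) = N.B (0, 0) * N.A p := by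
    rintro ⟨g, a⟩
    have ht : ∀ g a, theta g a 0 0 = 1 := by decide
    have := N.cross g a 0 0
    simpa [ht, zero_tact] using this
  have hB : ∀ p, N.B p * N.B (0, 0) = N.B (0, 0) * N.B p := by
    rintro ⟨m, b⟩
    rw [N.B_mul, N.B_mul]
    by_cases hb : b = 0
    · subst hb; simp [tau_left, tau_right]
    · rw [if_neg hb, if_neg (Ne.symm hb)]
  have hsum : N.B (0, 0) + N.B (0, 1) = 1 := N.B_one
  have hidem : N.B (0, 0) * N.B (0, 0) = N.B (0, 0) := by
    rw [N.B_mul]; simp [tau_left]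
  have hzero : ∀ c, N.B (0, c) = 0 → ∀ m, N.B (m, c) = 0 := fun c hc m => by
    have := N.B_mul 0 m c c
    rw [hc, zero_mul, if_pos rfl, tau_left, Int.cast_one, one_smul, zero_add] at this
    exact this.symm
  have h10 : ∀ b : ZMod 2, b ≠ 0 → b = 1 := by decide
  have h01 : ∀ b : ZMod 2, b ≠ 1 → b = 0 := by decide
  rcases hN.2 (LinearMap.ker (N.B (0, 0))) (fun p u hu => by
      rw [LinearMap.mem_ker] at hu ⊢
      rw [← Module.End.mul_apply, ← hA, Module.End.mul_apply, hu, map_zero]) (fun p u hu => by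
      rw [LinearMap.mem_ker] at hu ⊢
      rw [← Module.End.mul_apply, ← hB, Module.End.mul_apply, hu, map_zero]) with h | h
  · have h1 : N.B (0, 0) = 1 := LinearMap.ext fun u => LinearMap.ker_eq_bot.1 h <| by
      rw [← Module.End.mul_apply, hidem]; rfl
    rw [h1, add_eq_left] at hsum
    exact ⟨0, h1, fun b hb m => h10 b hb ▸ hzero 1 hsum m⟩
  · have h0 : N.B (0, 0) = 0 := LinearMap.ker_eq_top.1 h
    rw [h0, zero_add] at hsum
    exact ⟨1, hsum, fun b hb m => h01 b hb ▸ hzero 0 h0 m⟩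

section Pure

variable {N : BasisRep k V} {c : ZMod 2}

theorem IsPure.x_pow (h : N.IsPure c) (n : ℕ) :
    N.B (((n : ZMod 4), 0), c) = N.B ((1, 0), c) ^ n := by
  induction n with
  | zero => rw [pow_zero, ← h.one, Nat.cast_zero]; rfl
  | succ n ih =>
    have ht : ∀ (i : ZMod 4) (c : ZMod 2), tau (i, 0) (1, 0) c = 1 := by decide
    rw [pow_succ, ← ih, N.B_mul, if_pos rfl, ht]
    simp

theorem IsPure.y_pow (h : N.IsPure c) (n : ℕ) :
    N.B ((0, (n : ZMod 2)), c) = N.B ((0, 1), c) ^ n := by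
  induction n with
  | zero => rw [pow_zero, ← h.one, Nat.cast_zero]; rfl
  | succ n ih =>
    have ht : ∀ (i : ZMod 2) (c : ZMod 2), tau (0, i) (0, 1) c = 1 := by decide
    rw [pow_succ, ← ih, N.B_mul, if_pos rfl, ht]
    simp

theorem IsPure.x_pow_four (h : N.IsPure c) : N.B ((1, 0), c) ^ 4 = 1 := by
  rw [← h.x_pow, ← h.one]; rfl

theorem IsPure.y_sq (h : N.IsPure c) : N.B ((0, 1), c) ^ 2 = 1 := by
  rw [← h.y_pow, ← h.one]; rfl

theorem IsPure.eq_pow_mul_pow (h : N.IsPure c) (m : KG) :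
    N.B (m, c) = N.B ((1, 0), c) ^ m.1.val * N.B ((0, 1), c) ^ m.2.val := by
  have ht : ∀ (i : ZMod 4) (j c : ZMod 2), tau (i, 0) (0, j) c = 1 := by decide
  rw [← h.x_pow, ← h.y_pow, ZMod.natCast_zmod_val, ZMod.natCast_zmod_val, N.B_mul, if_pos rfl, ht]
  simp

theorem IsPure.realizes_zeta (h : N.IsPure 0) {μ ν : KG} {v w : V} (hv0 : v ≠ 0)
    {T X Y : Matrix (Fin 2) (Fin 2) k}
    (hE : ∀ g, ActsBy ![v, w] (N.A (g, 0)) (Label.eMat μ ν g))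
    (hT : ActsBy ![v, w] (∑ g, N.A (g, 1)) T) (hX : ActsBy ![v, w] (N.B ((1, 0), 0)) X)
    (hY : ActsBy ![v, w] (N.B ((0, 1), 0)) Y) : N.Realizes (Label.zetaTable μ ν T X Y) :=
  ⟨![v, w], fun h => hv0 (congrFun h 0), hE, hT,
    fun g => by rw [h.eq_pow_mul_pow]; exact (hX.pow _).mul (hY.pow _),
    fun g => by rw [h.zero 1 (by decide)]; exact ActsBy.zero⟩

theorem IsPure.realizes_chi (h : N.IsPure 1) {μ ν : KG} {v w : V} (hv0 : v ≠ 0)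
    {T X Y : Matrix (Fin 2) (Fin 2) k}
    (hE : ∀ g, ActsBy ![v, w] (N.A (g, 0)) (Label.eMat μ ν g))
    (hT : ActsBy ![v, w] (∑ g, N.A (g, 1)) T) (hX : ActsBy ![v, w] (N.B ((1, 0), 1)) X)
    (hY : ActsBy ![v, w] (N.B ((0, 1), 1)) Y) : N.Realizes (Label.chiTable μ ν T X Y) :=
  ⟨![v, w], fun h => hv0 (congrFun h 0), hE, hT,
    fun g => by rw [h.zero 0 (by decide)]; exact ActsBy.zero,
    fun g => by rw [h.eq_pow_mul_pow]; exact (hX.pow _).mul (hY.pow _)⟩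

end Pure

section Homogeneous

variable {N : BasisRep k V} {g : KG} {v : V}

theorem IsSimple.exists_homogeneous (hN : N.IsSimple) : ∃ g v, v ≠ 0 ∧ N.A (g, 0) v = v := by
  obtain ⟨u, hu⟩ := @exists_ne V hN.1 0
  obtain ⟨g, hg⟩ : ∃ g, N.A (g, 0) u ≠ 0 := by
    by_contra! h
    apply hu
    rw [← Module.End.one_apply (R := k) u, ← N.A_one, LinearMap.sum_apply]
    exact Finset.sum_eq_zero fun g _ => h g
  refine ⟨g, _, hg, ?_⟩
  rw [← Module.End.mul_apply, N.A_mul, if_pos (tact_zero g), sigma_left, add_zero, Int.cast_one,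
    one_smul]

theorem A_zero_apply (hv : N.A (g, 0) v = v) (h : KG) :
    N.A (h, 0) v = (if h = g then 1 else 0 : k) • v := by
  conv_lhs => rw [← hv, ← Module.End.mul_apply, N.A_mul, tact_zero]
  split_ifs with hh
  · rw [hh, sigma_left, add_zero, Int.cast_one, one_smul, one_smul, hv]
  · simp

theorem t_apply (hv : N.A (g, 0) v = v) : (∑ h, N.A (h, 1)) v = N.A (tact g 1, 1) v := by
  rw [LinearMap.sum_apply]
  refine Finset.sum_eq_single _ (fun h _ hh => ?_) fun h => absurd (Finset.mem_univ _) h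
  rw [← hv, ← Module.End.mul_apply, N.A_mul, if_neg fun h' => hh ((tact_eq_iff _ _ _).1 h'),
    LinearMap.zero_apply]

theorem t_homogeneous (hv : N.A (g, 0) v = v) :
    N.A (tact g 1, 0) ((∑ h, N.A (h, 1)) v) = (∑ h, N.A (h, 1)) v := by
  rw [t_apply hv, ← Module.End.mul_apply, N.A_mul, if_pos (tact_zero _), sigma_left, zero_add,
    Int.cast_one, one_smul]

theorem t_t_apply (hv : N.A (g, 0) v = v) :
    (∑ h, N.A (h, 1)) ((∑ h, N.A (h, 1)) v) = (sigma g 1 1 : k) • v := by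
  rw [t_apply (t_homogeneous hv), t_apply hv, tact_tact, show (1 : ZMod 2) + 1 = 0 from rfl, tact_zero,
    ← Module.End.mul_apply, N.A_mul, if_pos rfl, show (1 : ZMod 2) + 1 = 0 from rfl, LinearMap.smul_apply, hv]

/-- The ζ_m preserve grades, while χ_m with m = xᵏyˡ multiplies the grade by (m ◁ t) m⁻¹ = yᵏ. -/
theorem B_homogeneous (hv : N.A (g, 0) v = v) (m : KG) (b : ZMod 2) :
    N.A (g + tact m b - m, 0) (N.B (m, b) v) = N.B (m, b) v := by
  have ht : ∀ g m b, theta g 0 m b = 1 := by intro g m b; rfl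
  rw [← Module.End.mul_apply, N.cross, ht, tact_zero, zero_add, Int.cast_one, one_smul,
    Module.End.mul_apply, show g + tact m b - m - tact m b + m = g by abel, hv]

theorem t_B_apply (hv : N.A (g, 0) v = v) (m : KG) (b : ZMod 2) :
    (∑ h, N.A (h, 1)) (N.B (m, b) v) = (theta (tact (g + tact m b - m) 1) 1 m b : k) •
      N.B (tact m 1, b) ((∑ h, N.A (h, 1)) v) := by
  have h : ∀ g m b, tact (g + tact m b - m) 1 - tact m (1 + b) + tact m 1 = tact g 1 := by
    rintro ⟨i, j⟩ ⟨i', j'⟩ b; revert i j i' j' b; decide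
  rw [t_apply (B_homogeneous hv m b), ← Module.End.mul_apply, N.cross, h, t_apply hv]
  rfl

theorem actsBy_eMat {μ ν : KG} {w : V} (hv : N.A (μ, 0) v = v) (hw : N.A (ν, 0) w = w) (g : KG) :
    ActsBy ![v, w] (N.A (g, 0)) (Label.eMat μ ν g) :=
  ActsBy.of_two (by rw [A_zero_apply hv]; simp) (by rw [A_zero_apply hw]; simp)

end Homogeneous

/-- With r² = d, either Fv + rv is an eigenvector for r, or it is zero and v is one for -r. In both
cases u lies in the span of v and Fv, so any G acting on both by the same scalar s acts so on u.
This last clause preserves the grade and the eigenvalues already obtained. -/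
theorem exists_eigenvector [IsAlgClosed k] {F : Module.End k V} {v : V} {d : k} (hv : v ≠ 0)
    (hF : F (F v) = d • v) : ∃ r u, r ^ 2 = d ∧ u ≠ 0 ∧ F u = r • u ∧
      ∀ (G : Module.End k V) (s : k), G v = s • v → G (F v) = s • F v → G u = s • u := by
  obtain ⟨r, hr⟩ := IsAlgClosed.exists_pow_nat_eq d two_pos
  by_cases h : F v + r • v = 0
  · exact ⟨-r, v, by rw [neg_sq, hr], hv, by rw [neg_smul]; exact eq_neg_of_add_eq_zero_left h,
      fun G s h _ => h⟩
  · refine ⟨r, _, hr, h, ?_, fun G s h1 h2 => ?_⟩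
    · rw [map_add, map_smul, hF, smul_add, smul_smul, ← sq, hr, add_comm]
    · rw [map_add, map_smul, h1, h2, smul_add, smul_comm]

end BasisRep

/-! ### Every simple module contains a listed one. -/

namespace BasisRep

open KG Label

variable {k : Type*} [Field k] {V : Type*} [AddCommGroup V] [Module k V] {N : BasisRep k V}
  {ξ : k} {v : V}

theorem exists_sgn {s : k} (hs : s ^ 2 = 1) : ∃ b, s = sgn b := by
  rcases sq_eq_one_iff.1 hs with h | h
  · exact ⟨true, by simp [sgn, h]⟩
  · exact ⟨false, by simp [sgn, h]⟩

theorem exists_fin_pow (hξ : IsPrimitiveRoot ξ 4) {r : k} (hr : r ^ 4 = 1) :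
    ∃ i : Fin 4, r = ξ ^ i.val := by
  obtain ⟨i, hi, h⟩ := hξ.eq_pow_of_pow_eq_one hr
  exact ⟨⟨i, hi⟩, h.symm⟩

theorem eq_or_tact_eq_xy (g : KG) : (∃ c : Fin 2, g = xy (1 + 2 * c.val) 0 ∨
    tact g 1 = xy (1 + 2 * c.val) 0) ∨ ∃ a b : Fin 2, g = xy (2 * a.val) b.val := by
  revert g; decide

section Zeta

/-- X, Y and e_g commute. As `exists_eigenvector` needs an operator with scalar square, it is
applied to X², then to X on an eigenvector of X², then to Y. -/
theorem IsPure.exists_joint_eigenvector (h : N.IsPure 0) [IsAlgClosed k] {g : KG} (hv0 : v ≠ 0)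
    (hv : N.A (g, 0) v = v) : ∃ l s : k, ∃ u, l ^ 4 = 1 ∧ s ^ 2 = 1 ∧ u ≠ 0 ∧ N.A (g, 0) u = u ∧
      N.B ((1, 0), 0) u = l • u ∧ N.B ((0, 1), 0) u = s • u := by
  set X := N.B ((1, 0), 0) with hX
  set Y := N.B ((0, 1), 0) with hY
  have hX4 : ∀ u, X (X (X (X u))) = u := fun u => LinearMap.congr_fun h.x_pow_four u
  have hY2 : ∀ u, Y (Y u) = u := fun u => LinearMap.congr_fun h.y_sq u
  have hXY : ∀ u, X (Y u) = Y (X u) := fun u => by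
    rw [← Module.End.mul_apply, ← Module.End.mul_apply, hX, hY, N.B_mul, N.B_mul]
    rfl
  have hhom : ∀ m u, N.A (g, 0) u = u → N.A (g, 0) (N.B (m, 0) u) = N.B (m, 0) u := fun m u hu => by
    simpa [tact_zero] using B_homogeneous hu m 0
  obtain ⟨r, u, hr, hu0, hXu, hG⟩ := exists_eigenvector (F := X * X) (d := 1) hv0
    (by rw [one_smul]; exact hX4 v)
  have hu : N.A (g, 0) u = u := by
    simpa using hG _ 1 (by rw [hv, one_smul])
      (by rw [one_smul]; exact hhom _ _ (hhom _ _ hv))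
  obtain ⟨l, u', hl, hu0', hXu', hG'⟩ := exists_eigenvector (F := X) hu0 hXu
  have hu' : N.A (g, 0) u' = u' := by
    simpa using hG' _ 1 (by rw [hu, one_smul]) (by rw [one_smul]; exact hhom _ _ hu)
  obtain ⟨s, w, hs, hw0, hYw, hG''⟩ := exists_eigenvector (F := Y) (d := 1) hu0'
    (by rw [one_smul]; exact hY2 _)
  refine ⟨l, s, w, by rw [show 4 = 2 * 2 from rfl, pow_mul, hl, hr], hs, hw0, ?_, ?_, hYw⟩
  · simpa using hG'' _ 1 (by rw [hu', one_smul]) (by rw [one_smul]; exact hhom _ _ hu')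
  · exact hG'' _ _ hXu' (by rw [hXY, hXu', map_smul])

theorem IsPure.B_one_one_zero (h : N.IsPure 0) (u : V) :
    N.B ((1, 1), 0) u = N.B ((1, 0), 0) (N.B ((0, 1), 0) u) := by
  rw [h.eq_pow_mul_pow]; rfl

/-- The vectors v and tv lie in the distinct grades μ and μy. From tY = -Yt and tX = XYt in grade
μy, tv is again a joint eigenvector, with Y-eigenvalue -s and X-eigenvalue -sl. -/
theorem IsPure.realizes_W (h : N.IsPure 0) [IsAlgClosed k] (hξ : IsPrimitiveRoot ξ 4)
    {c : Fin 2} (hv0 : v ≠ 0)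
    (hv : N.A (xy (1 + 2 * c.val) 0, 0) v = v) : ∃ l : Label, N.Realizes (l.table ξ) := by
  obtain ⟨l, s, v, hl, hs, hv0, hv, hX, hY⟩ := h.exists_joint_eigenvector hv0 hv
  obtain ⟨b, hb⟩ := exists_sgn (s := -s) (by rw [neg_sq, hs])
  -- In the table ξⁱ is the eigenvalue of ζ_x at the second vector tv, which differs from the
  -- eigenvalue l at v by the sign.
  obtain ⟨i, hi⟩ := exists_fin_pow hξ (r := sgn b * l) (by
    rw [mul_pow, hl, show 4 = 2 * 2 from rfl, pow_mul, sgn_sq]; simp)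
  have hb2 := sgn_sq (k := k) b
  obtain rfl : s = -sgn b := by rw [← hb, neg_neg]
  have hf : ∀ c : Fin 2, tact (xy (1 + 2 * c.val) 0) 1 = xy (1 + 2 * c.val) 1 ∧
      sigma (xy (1 + 2 * c.val) 0) 1 1 = (-1) ^ c.val ∧
      theta (xy (1 + 2 * c.val) 1) 1 (1, 0) 0 = 1 ∧
      theta (xy (1 + 2 * c.val) 1) 1 (0, 1) 0 = -1 := by decide
  have hTv := t_homogeneous hv
  have hTT := t_t_apply hv
  have hTX := t_B_apply hv (1, 0) 0
  have hTY := t_B_apply hv (0, 1) 0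
  rw [tact_zero, add_sub_cancel_right, (hf c).1] at hTX hTY
  rw [(hf c).2.2.1, hX, map_smul, Int.cast_one, one_smul] at hTX
  rw [(hf c).2.2.2, hY, map_smul, Int.cast_neg, Int.cast_one, neg_smul, neg_smul, one_smul,
    neg_inj] at hTY
  rw [(hf c).1] at hTv
  rw [(hf c).2.1] at hTT
  replace hTX := hTX.trans (h.B_one_one_zero _)
  replace hTY : _ = N.B ((0, 1), 0) _ := hTY
  rw [← hTY, map_smul] at hTX
  refine ⟨W c b i, h.realizes_zeta hv0 (actsBy_eMat hv hTv) (ActsBy.of_two (by simp) ?_)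
    (ActsBy.of_two ?_ ?_) (ActsBy.of_two ?_ ?_)⟩
  · rw [hTT]; simp
  · rw [hX, ← hi, ← mul_assoc, ← sq, hb2]; simp
  · rw [← hi, mul_smul, hTX, smul_smul, ← sq, hb2]; simp
  · rw [hY]; simp
  · rw [← hTY]; simp

/-- Now t preserves the grade and commutes with Y, and tX = (-1)ᵇ XYt. If Y acts on v by s = (-1)ᵇ,
then t commutes with X there and a t-eigenvector spans a module V; if s = -(-1)ᵇ, then t
anticommutes with X and v, tv give a module X. -/
theorem IsPure.realizes_even (h : N.IsPure 0) [IsAlgClosed k] (hξ : IsPrimitiveRoot ξ 4)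
    (hξ2 : ξ ^ 2 = -1)
    {a b : Fin 2} (hv0 : v ≠ 0) (hv : N.A (xy (2 * a.val) b.val, 0) v = v) :
    ∃ l : Label, N.Realizes (l.table ξ) := by
  obtain ⟨l, s, v, hl, hs, hv0, hv, hX, hY⟩ := h.exists_joint_eigenvector hv0 hv
  have hf : ∀ a b : Fin 2, tact (xy (2 * a.val) b.val) 1 = xy (2 * a.val) b.val ∧
      sigma (xy (2 * a.val) b.val) 1 1 = (-1) ^ a.val ∧
      theta (xy (2 * a.val) b.val) 1 (1, 0) 0 = (-1) ^ b.val ∧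
      theta (xy (2 * a.val) b.val) 1 (0, 1) 0 = 1 := by decide
  have hb2 : ((-1 : k) ^ b.val) * (-1) ^ b.val = 1 := by rw [← mul_pow]; simp
  have hTT0 : ∀ {v}, N.A (xy (2 * a.val) b.val, 0) v = v →
      (∑ h, N.A (h, 1)) ((∑ h, N.A (h, 1)) v) = ((-1) ^ a.val : k) • v := fun hv => by
    rw [t_t_apply hv, (hf a b).2.1]; simp
  have hT0 : ∀ {v}, N.A (xy (2 * a.val) b.val, 0) v = v →
      N.A (xy (2 * a.val) b.val, 0) ((∑ h, N.A (h, 1)) v) = (∑ h, N.A (h, 1)) v := fun hv => by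
    simpa only [(hf a b).1] using t_homogeneous hv
  have hY0 : ∀ {v} {s : k}, N.A (xy (2 * a.val) b.val, 0) v = v → N.B ((0, 1), 0) v = s • v →
      N.B ((0, 1), 0) ((∑ h, N.A (h, 1)) v) = s • (∑ h, N.A (h, 1)) v := fun {v s} hv hY => by
    have hTY := t_B_apply hv (0, 1) 0
    rw [tact_zero, add_sub_cancel_right, (hf a b).1, (hf a b).2.2.2, hY, map_smul, Int.cast_one,
      one_smul] at hTY
    exact hTY.symm
  have hX0 : ∀ {v} {s l : k}, N.A (xy (2 * a.val) b.val, 0) v = v → N.B ((0, 1), 0) v = s • v →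
      N.B ((1, 0), 0) v = l • v → l • (∑ h, N.A (h, 1)) v =
        ((-1) ^ b.val * s) • N.B ((1, 0), 0) ((∑ h, N.A (h, 1)) v) := fun {v s l} hv hY hX => by
    have hTX := t_B_apply hv (1, 0) 0
    rw [tact_zero, add_sub_cancel_right, (hf a b).1, (hf a b).2.2.1, hX, map_smul] at hTX
    rw [hTX, mul_smul, ← map_smul (N.B ((1, 0), 0)) s, ← hY0 hv hY, ← h.B_one_one_zero]
    push_cast
    rfl
  have hs' : s = (-1) ^ b.val ∨ s = -(-1) ^ b.val := sq_eq_sq_iff_eq_or_eq_neg.1 (by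
    rw [hs, sq, hb2])
  rcases hs' with rfl | rfl
  · obtain ⟨p, u, hp, hu0, hTu, hG⟩ := exists_eigenvector hv0 (hTT0 hv)
    have hu : N.A (xy (2 * a.val) b.val, 0) u = u := by
      simpa using hG _ 1 (by rw [hv, one_smul]) (by rw [one_smul]; exact hT0 hv)
    have hYu := hG _ _ hY (hY0 hv hY)
    have hXu := hG _ _ hX (by rw [hX0 hv hY hX, hb2, one_smul])
    have hp' : p = ξ ^ a.val ∨ p = -ξ ^ a.val := sq_eq_sq_iff_eq_or_eq_neg.1 (by
      rw [hp, ← pow_mul, mul_comm, pow_mul, hξ2])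
    obtain ⟨sg, rfl⟩ : ∃ sg, p = sgn sg * ξ ^ a.val := by
      rcases hp' with rfl | rfl
      · exact ⟨true, by simp [sgn]⟩
      · exact ⟨false, by simp [sgn]⟩
    obtain ⟨i, rfl⟩ := exists_fin_pow hξ hl
    have hpow : ∀ {F : Module.End k V} {r : k} (n : ℕ), F u = r • u → (F ^ n) u = r ^ n • u := by
      intro F r n hF
      induction n with
      | zero => simp
      | succ n ih => rw [pow_succ, Module.End.mul_apply, hF, map_smul, ih, smul_smul, pow_succ']
    refine ⟨Label.V a b sg i, ![u], fun h => hu0 (congrFun h 0), fun g => ActsBy.of_one ?_,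
      ActsBy.of_one hTu, fun g => ActsBy.of_one ?_, fun g => ?_⟩
    · rw [A_zero_apply hu]
    · rw [h.eq_pow_mul_pow, Module.End.mul_apply, hpow _ hYu, map_smul, hpow _ hXu, smul_smul,
        pow_mul, pow_mul, mul_comm]
    · rw [h.zero 1 (by decide)]; exact ActsBy.zero
  · have key : ∀ {v} {i : Fin 2}, v ≠ 0 → N.A (xy (2 * a.val) b.val, 0) v = v →
        N.B ((0, 1), 0) v = (-(-1) ^ b.val : k) • v → N.B ((1, 0), 0) v = ξ ^ i.val • v →
        ∃ l : Label, N.Realizes (l.table ξ) := fun {v i} hv0 hv hY hX => by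
      refine ⟨Label.X a b i, h.realizes_zeta hv0 (actsBy_eMat hv (hT0 hv))
        (ActsBy.of_two (by simp) ?_) (ActsBy.of_two ?_ ?_) (ActsBy.of_two ?_ ?_)⟩
      · rw [hTT0 hv]; simp
      · rw [hX]; simp
      · have := hX0 hv hY hX
        rw [mul_neg, hb2, neg_smul, one_smul] at this
        rw [neg_smul, this]; simp
      · rw [hY]; simp
      · rw [hY0 hv hY]; simp
    -- Only l up to sign matters, since v and tv have opposite X-eigenvalues.
    have hl2 : ∃ i : Fin 2, l ^ 2 = (ξ ^ i.val) ^ 2 := by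
      rcases sq_eq_one_iff.1 (show (l ^ 2) ^ 2 = 1 by rw [← pow_mul, hl]) with h | h
      · exact ⟨0, by simp [h]⟩
      · exact ⟨1, by simp [h, hξ2]⟩
    obtain ⟨i, hi⟩ := hl2
    rcases sq_eq_sq_iff_eq_or_eq_neg.1 hi with rfl | rfl
    · exact key hv0 hv hY hX
    -- If l = -ξⁱ, then tv takes the place of v; it is nonzero because t² acts on v by a nonzero
    -- scalar.
    · refine key (i := i) (fun h0 => hv0 ?_) (hT0 hv) (hY0 hv hY) ?_
      · have := hTT0 hv
        rw [h0, map_zero] at this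
        exact (smul_eq_zero.1 this.symm).resolve_left (pow_ne_zero _ (by simp))
      · have := hX0 hv hY hX
        rw [mul_neg, hb2, neg_smul, neg_smul, one_smul, neg_inj] at this
        exact this.symm

end Zeta

section Chi

theorem y_x_apply (u : V) : N.B ((0, 1), 1) (N.B ((1, 0), 1) u) =
    -N.B ((1, 0), 1) (N.B ((0, 1), 1) u) := by
  rw [← Module.End.mul_apply, ← Module.End.mul_apply, N.B_mul, N.B_mul,
    show tau (0, 1) (1, 0) 1 = -1 from rfl, show tau (1, 0) (0, 1) 1 = 1 from rfl, add_comm]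
  simp

/-- A homogeneous eigenvector of `χ_y` and `χ_x²`. -/
theorem IsPure.exists_joint_eigenvector_chi (h : N.IsPure 1) [IsAlgClosed k] {g : KG} (hv0 : v ≠ 0)
    (hv : N.A (g, 0) v = v) : ∃ e d : k, ∃ u, e ^ 2 = 1 ∧ d ^ 2 = 1 ∧ u ≠ 0 ∧ N.A (g, 0) u = u ∧
      N.B ((2, 0), 1) u = e • u ∧ N.B ((0, 1), 1) u = d • u := by
  have hhom : ∀ m, m = (2, 0) ∨ m = (0, 1) → ∀ u, N.A (g, 0) u = u →
      N.A (g, 0) (N.B (m, 1) u) = N.B (m, 1) u := fun m hm u hu => by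
    have hg : ∀ g m : KG, m = (2, 0) ∨ m = (0, 1) → g + tact m 1 - m = g := by
      intro g m hm
      rcases hm with rfl | rfl <;> (revert g; decide)
    simpa [hg g m hm] using B_homogeneous hu m 1
  have hsq : ∀ m : KG, m = (2, 0) ∨ m = (0, 1) → ∀ u, N.B (m, 1) (N.B (m, 1) u) = u := by
    intro m hm u
    have : m + m = 0 ∧ tau m m 1 = 1 := by rcases hm with rfl | rfl <;> decide
    rw [← Module.End.mul_apply, N.B_mul, if_pos rfl, this.1, this.2, h.one]
    simp
  have hcomm : ∀ u, N.B ((2, 0), 1) (N.B ((0, 1), 1) u) = N.B ((0, 1), 1) (N.B ((2, 0), 1) u) := by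
    intro u
    rw [← Module.End.mul_apply, ← Module.End.mul_apply, N.B_mul, N.B_mul]
    rfl
  obtain ⟨e, u, he, hu0, heu, hG⟩ := exists_eigenvector (F := N.B ((2, 0), 1)) (d := 1) hv0
    (by rw [one_smul]; exact hsq _ (.inl rfl) v)
  have hu : N.A (g, 0) u = u := by
    simpa using hG _ 1 (by rw [hv, one_smul]) (by rw [one_smul]; exact hhom _ (.inl rfl) _ hv)
  obtain ⟨d, w, hd, hw0, hdw, hG'⟩ := exists_eigenvector (F := N.B ((0, 1), 1)) (d := 1) hu0
    (by rw [one_smul]; exact hsq _ (.inr rfl) u)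
  refine ⟨e, d, w, he, hd, hw0, ?_, ?_, hdw⟩
  · simpa using hG' _ 1 (by rw [hu, one_smul]) (by rw [one_smul]; exact hhom _ (.inr rfl) _ hu)
  · exact hG' _ _ heu (by rw [hcomm, heu, map_smul])

theorem IsPure.x_x_apply (h : N.IsPure 1) (u : V) :
    N.B ((1, 0), 1) (N.B ((1, 0), 1) u) = N.B ((2, 0), 1) u := by
  rw [show ((2, 0) : KG) = (((2 : ℕ) : ZMod 4), 0) from rfl, h.x_pow]; rfl

theorem IsPure.B_one_one_one (h : N.IsPure 1) (u : V) :
    N.B ((1, 1), 1) u = N.B ((1, 0), 1) (N.B ((0, 1), 1) u) := by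
  rw [h.eq_pow_mul_pow]; rfl

theorem exists_paramZ (hξ : ξ ^ 2 = -1) {c : Fin 2} {e d p : k} (he : e ^ 2 = 1) (hd : d ^ 2 = 1)
    (hp : p ^ 2 = (-1) ^ c.val) :
    ∃ j, paramZp ξ c j = p ∧ paramZε j = e ∧ paramZd j = d := by
  have hp' : p = ξ ^ c.val ∨ p = -ξ ^ c.val := sq_eq_sq_iff_eq_or_eq_neg.1 (by
    rw [hp, ← pow_mul, mul_comm, pow_mul, hξ])
  rcases sq_eq_one_iff.1 he with rfl | rfl <;>
    rcases sq_eq_one_iff.1 hd with rfl | rfl <;> rcases hp' with rfl | rfl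
  · exact ⟨4, by simp [paramZp], rfl, rfl⟩
  · exact ⟨5, by simp [paramZp], rfl, rfl⟩
  · exact ⟨0, by simp [paramZp], rfl, rfl⟩
  · exact ⟨1, by simp [paramZp], rfl, rfl⟩
  · exact ⟨6, by simp [paramZp], rfl, rfl⟩
  · exact ⟨7, by simp [paramZp], rfl, rfl⟩
  · exact ⟨2, by simp [paramZp], rfl, rfl⟩
  · exact ⟨3, by simp [paramZp], rfl, rfl⟩

/-- The list is exhaustive: with e = (-1)ᶜ f the equation reads q² = -df, so the four sign pairs (d,
f) leave two values of q each, ±1 or ±ξ, hence eight triples. -/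
theorem exists_paramY (hξ : ξ ^ 2 = -1) {c : Fin 2} {e d q : k} (he : e ^ 2 = 1) (hd : d ^ 2 = 1)
    (hq : q ^ 2 = -((-1) ^ c.val * d * e)) :
    ∃ j, paramYq ξ j = q ∧ paramYε c j = e ∧ paramYd j = d := by
  obtain ⟨f, rfl⟩ : ∃ f, e = (-1) ^ c.val * f :=
    ⟨(-1) ^ c.val * e, by rw [← mul_assoc, ← mul_pow]; simp⟩
  have hc : ((-1 : k) ^ c.val) * (-1) ^ c.val = 1 := by rw [← mul_pow]; simp
  have hf : f ^ 2 = 1 := by linear_combination he - f ^ 2 * hc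
  replace hq : q ^ 2 = -(d * f) := by linear_combination hq - d * f * hc
  have hq1 : d * f = -1 → q = 1 ∨ q = -1 := fun h => sq_eq_one_iff.1 (by rw [hq, h, neg_neg])
  have hq2 : d * f = 1 → q = ξ ∨ q = -ξ := fun h =>
    sq_eq_sq_iff_eq_or_eq_neg.1 (by rw [hq, h, hξ])
  rcases sq_eq_one_iff.1 hf with rfl | rfl <;> rcases sq_eq_one_iff.1 hd with rfl | rfl
  · rcases hq2 (by simp) with rfl | rfl
    · exact ⟨0, rfl, rfl, rfl⟩
    · exact ⟨1, rfl, rfl, rfl⟩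
  · rcases hq1 (by simp) with rfl | rfl
    · exact ⟨6, rfl, rfl, rfl⟩
    · exact ⟨7, rfl, rfl, rfl⟩
  · rcases hq1 (by simp) with rfl | rfl
    · exact ⟨4, rfl, rfl, rfl⟩
    · exact ⟨5, rfl, rfl, rfl⟩
  · rcases hq2 (by simp) with rfl | rfl
    · exact ⟨2, rfl, rfl, rfl⟩
    · exact ⟨3, rfl, rfl, rfl⟩

/-- On the grade μ the operator t commutes with χ_x² and χ_y, so a joint eigenvector u of all three
exists. Then χ_x u lies in grade μy, and the relations fix every operator on u, χ_x u. -/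
theorem IsPure.realizes_Z (h : N.IsPure 1) [IsAlgClosed k] (hξ : ξ ^ 2 = -1) {c : Fin 2}
    (hv0 : v ≠ 0) (hv : N.A (xy (2 * c.val) 0, 0) v = v) :
    ∃ l : Label, N.Realizes (l.table ξ) := by
  obtain ⟨e, d, v, he, hd, hv0, hv, hev, hdv⟩ := h.exists_joint_eigenvector_chi hv0 hv
  have hf : ∀ c : Fin 2, tact (xy (2 * c.val) 0) 1 = xy (2 * c.val) 0 ∧
      sigma (xy (2 * c.val) 0) 1 1 = (-1) ^ c.val ∧
      xy (2 * c.val) 0 + tact (1, 0) 1 - (1, 0) = xy (2 * c.val) 1 ∧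
      theta (tact (xy (2 * c.val) 1) 1) 1 (1, 0) 1 = -1 ∧
      theta (tact (xy (2 * c.val) 0 + tact (0, 1) 1 - (0, 1)) 1) 1 (0, 1) 1 = 1 ∧
      theta (tact (xy (2 * c.val) 0 + tact (2, 0) 1 - (2, 0)) 1) 1 (2, 0) 1 = 1 := by decide
  have hTT := t_t_apply hv
  rw [(hf c).2.1, Int.cast_pow, Int.cast_neg, Int.cast_one] at hTT
  obtain ⟨p, u, hp, hu0, hTu, hG⟩ := exists_eigenvector hv0 hTT
  have hu : N.A (xy (2 * c.val) 0, 0) u = u := by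
    simpa using hG _ 1 (by rw [hv, one_smul])
      (by rw [one_smul]; simpa only [(hf c).1] using t_homogeneous hv)
  have hdu := hG _ _ hdv (by
    have := t_B_apply hv (0, 1) 1
    rw [(hf c).2.2.2.2.1, hdv, map_smul, Int.cast_one, one_smul] at this
    exact this.symm)
  have heu := hG _ _ hev (by
    have := t_B_apply hv (2, 0) 1
    rw [(hf c).2.2.2.2.2, hev, map_smul, Int.cast_one, one_smul] at this
    exact this.symm)
  have hXu := B_homogeneous hu (1, 0) 1
  have hTX := t_B_apply hu (1, 0) 1
  rw [(hf c).2.2.1] at hXu hTX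
  rw [(hf c).2.2.2.1, hTu, map_smul] at hTX
  replace hTX : _ = _ • p • N.B ((1, 1), 1) u := hTX
  rw [h.B_one_one_one, hdu, map_smul, smul_smul, smul_smul] at hTX
  obtain ⟨j, rfl, rfl, rfl⟩ := exists_paramZ hξ he hd hp
  have : N.Realizes (n := 2) _ := h.realizes_chi hu0 (actsBy_eMat hu hXu)
    (ActsBy.of_two (a := paramZp ξ c j) (b := 0) (c := 0) (d := -(paramZd j * paramZp ξ c j))
      (by rw [hTu]; simp) (by rw [hTX]; push_cast; rw [zero_smul, zero_add]; congr 1; ring))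
    (ActsBy.of_two (a := 0) (b := paramZε j) (c := 1) (d := 0) (by simp)
      (by rw [h.x_x_apply, heu]; simp))
    (ActsBy.of_two (a := paramZd j) (b := 0) (c := 0) (d := -paramZd j) (by rw [hdu]; simp)
      (by rw [y_x_apply, hdu, map_smul]; simp))
  rw [← table_Z] at this
  exact ⟨_, this⟩

/-- Both t and χ_x exchange the grades μ and μy, so F = χ_x³ t = χ_x⁻¹ t preserves μ. It commutes
with χ_x² and χ_y on v and has scalar square there, hence a common eigenvector u, and u, χ_x u is
the required family. -/
theorem IsPure.realizes_Y (h : N.IsPure 1) [IsAlgClosed k] (hξ : ξ ^ 2 = -1) {c : Fin 2}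
    (hv0 : v ≠ 0) (hv : N.A (xy (1 + 2 * c.val) 0, 0) v = v) :
    ∃ l : Label, N.Realizes (l.table ξ) := by
  obtain ⟨e, d, v, he, hd, hv0, hv, hev, hdv⟩ := h.exists_joint_eigenvector_chi hv0 hv
  have hf : ∀ c : Fin 2, tact (xy (1 + 2 * c.val) 0) 1 = xy (1 + 2 * c.val) 1 ∧
      sigma (xy (1 + 2 * c.val) 0) 1 1 = (-1) ^ c.val ∧
      xy (1 + 2 * c.val) 0 + tact (1, 0) 1 - (1, 0) = xy (1 + 2 * c.val) 1 ∧
      theta (tact (xy (1 + 2 * c.val) 1) 1) 1 (1, 0) 1 = 1 ∧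
      theta (tact (xy (1 + 2 * c.val) 0 + tact (0, 1) 1 - (0, 1)) 1) 1 (0, 1) 1 = -1 ∧
      theta (tact (xy (1 + 2 * c.val) 0 + tact (2, 0) 1 - (2, 0)) 1) 1 (2, 0) 1 = 1 ∧
      xy (1 + 2 * c.val) 1 + tact (3, 0) 1 - (3, 0) = xy (1 + 2 * c.val) 0 ∧
      theta (tact (xy (1 + 2 * c.val) 0) 1) 1 (3, 0) 1 = -1 := by decide
  obtain ⟨hf1, hf2, hf3, hf4, hf5, hf6, hf7, hf8⟩ := hf c
  have hTT := t_t_apply hv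
  rw [hf2, Int.cast_pow, Int.cast_neg, Int.cast_one] at hTT
  have hTv := t_homogeneous hv
  rw [hf1] at hTv
  have hFv := B_homogeneous hTv (3, 0) 1
  have hTF := t_B_apply hTv (3, 0) 1
  rw [hf7] at hFv hTF
  rw [hf8, hTT, map_smul] at hTF
  have hdT := t_B_apply hv (0, 1) 1
  rw [hf5, hdv, map_smul] at hdT
  have heT := t_B_apply hv (2, 0) 1
  rw [hf6, hev, map_smul, Int.cast_one, one_smul] at heT
  replace hdT : _ = _ • N.B ((0, 1), 1) _ := hdT
  replace heT : _ = N.B ((2, 0), 1) _ := heT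
  have hmul : ∀ m m' u, N.B (m, 1) (N.B (m', 1) u) = (tau m m' 1 : k) • N.B (m + m', 1) u := by
    intro m m' u
    rw [← Module.End.mul_apply, N.B_mul, if_pos rfl, LinearMap.smul_apply]
  have h33 : ∀ u, N.B ((3, 0), 1) (N.B (tact (3, 0) 1, 1) u) =
      N.B ((2, 0), 1) (N.B ((0, 1), 1) u) := fun u => by
    rw [hmul, hmul]; rfl
  have h13 : ∀ u, N.B ((1, 0), 1) (N.B ((3, 0), 1) u) = u := fun u => by
    have := hmul (1, 0) (3, 0) u
    rwa [show ((1, 0) : KG) + (3, 0) = 0 from rfl, h.one, show tau (1, 0) (3, 0) 1 = 1 from rfl,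
      Int.cast_one, one_smul] at this
  have hFF : (N.B ((3, 0), 1) * ∑ h, N.A (h, 1)) ((N.B ((3, 0), 1) * ∑ h, N.A (h, 1)) v) =
      (-((-1) ^ c.val * d * e)) • v := by
    rw [Module.End.mul_apply, Module.End.mul_apply, hTF, map_smul, map_smul, h33, hdv, map_smul,
      hev, smul_smul, smul_smul, smul_smul]
    push_cast
    congr 1
    ring
  obtain ⟨q, u, hq, hu0, hFu, hG⟩ := exists_eigenvector hv0 hFF
  have hu : N.A (xy (1 + 2 * c.val) 0, 0) u = u := by
    simpa using hG _ 1 (by rw [hv, one_smul]) (by rw [one_smul]; exact hFv)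
  have hdu := hG _ _ hdv (by
    rw [Module.End.mul_apply, hmul, ← map_smul (N.B ((3, 0), 1)) d, hdT, map_smul, hmul, smul_smul,
      ← Int.cast_mul]
    rfl)
  have heu := hG _ _ hev (by
    rw [Module.End.mul_apply, hmul, ← map_smul (N.B ((3, 0), 1)) e, heT, hmul]
    rfl)
  -- Applying χ_x to χ_x³ tu = qu and using χ_x⁴ = 1.
  have hTu : (∑ h, N.A (h, 1)) u = q • N.B ((1, 0), 1) u := by
    rw [← map_smul, ← hFu, Module.End.mul_apply, h13]
  have hXu := B_homogeneous hu (1, 0) 1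
  have hTX := t_B_apply hu (1, 0) 1
  rw [hf3] at hXu hTX
  rw [hf4, hTu, map_smul, Int.cast_one, one_smul] at hTX
  replace hTX : _ = q • N.B ((1, 1), 1) _ := hTX
  rw [h.B_one_one_one, y_x_apply, hdu, map_smul, map_neg, map_smul, h.x_x_apply, heu, ← neg_smul,
    smul_smul, smul_smul] at hTX
  obtain ⟨j, rfl, rfl, rfl⟩ := exists_paramY hξ he hd hq
  have : N.Realizes (n := 2) _ := h.realizes_chi hu0 (actsBy_eMat hu hXu)
    (ActsBy.of_two (a := 0) (b := -(paramYε c j * paramYd j * paramYq ξ j)) (c := paramYq ξ j)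
      (d := 0) (by rw [hTu]; simp)
      (by rw [hTX, zero_smul, add_zero]; congr 1; ring))
    (ActsBy.of_two (a := 0) (b := paramYε c j) (c := 1) (d := 0) (by simp)
      (by rw [h.x_x_apply, heu]; simp))
    (ActsBy.of_two (a := paramYd j) (b := 0) (c := 0) (d := -paramYd j) (by rw [hdu]; simp)
      (by rw [y_x_apply, hdu, map_smul]; simp))
  rw [← table_Y] at this
  exact ⟨_, this⟩

end Chi

/-- Every simple module contains one of the modules of the list. -/
theorem IsSimple.exists_realizes [IsAlgClosed k] [CharZero k] (hN : N.IsSimple)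
    (hξ : IsPrimitiveRoot ξ 4) (hξ2 : ξ ^ 2 = -1) : ∃ l : Label, N.Realizes (l.table ξ) := by
  obtain ⟨g, v, hv0, hv⟩ := hN.exists_homogeneous
  obtain ⟨c, hc⟩ := hN.exists_isPure
  rcases zmod2_cases c with rfl | rfl
  · rcases eq_or_tact_eq_xy g with ⟨c, rfl | hg⟩ | ⟨a, b, rfl⟩
    · exact hc.realizes_W hξ hv0 hv
    -- When v has grade xy or x³y, tv has grade x or x³, and it is nonzero because t² acts on v by
    -- ±1.
    · refine hc.realizes_W hξ (fun h0 => hv0 ?_) (hg ▸ t_homogeneous hv)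
      have := t_t_apply hv
      rw [h0, map_zero] at this
      exact (smul_eq_zero.1 this.symm).resolve_left
        (KashinaH.intCast_ne_zero k _ (sigma_mul_self _ _ _))
    · exact hc.realizes_even hξ hξ2 hv0 hv
  -- As χ_x is invertible and multiplies the grade by y, replacing v by χ_x v if necessary makes the
  -- grade a power of x.
  · have hX := B_homogeneous hv (1, 0) 1
    have hX0 : N.B ((1, 0), 1) v ≠ 0 := fun h0 => hv0 <| by
      rw [← Module.End.one_apply (R := k) v, ← hc.x_pow_four, pow_succ, Module.End.mul_apply, h0,
        map_zero]
    have hg : ∀ g : KG, ∃ c : Fin 2, (g = xy (1 + 2 * c.val) 0 ∨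
        g + tact (1, 0) 1 - (1, 0) = xy (1 + 2 * c.val) 0) ∨ g = xy (2 * c.val) 0 ∨
        g + tact (1, 0) 1 - (1, 0) = xy (2 * c.val) 0 := by decide
    obtain ⟨c, (rfl | h) | rfl | h⟩ := hg g
    · exact hc.realizes_Y hξ2 hv0 hv
    · exact hc.realizes_Y hξ2 hX0 (h ▸ hX)
    · exact hc.realizes_Z hξ2 hv0 hv
    · exact hc.realizes_Z hξ2 hX0 (h ▸ hX)

end BasisRep

/-! ### The classification and its transfer to the three settings. -/

/-- The classification, in terms of operators. -/
theorem BasisRep.classification (k : Type u) [Field k] [IsAlgClosed k] [CharZero k] (ξ : k)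
    (hξ : IsPrimitiveRoot ξ 4) :
    ∃ M : ∀ l : Label, BasisRep k (Fin l.dim → k),
      (∀ l, (M l).HasTable (l.table ξ)) ∧
      (∀ l, (M l).IsSimple) ∧
      (∀ l m, (M l).Isomorphic (M m) → l = m) ∧
      ∀ (V : Type w) [AddCommGroup V] [Module k V] (N : BasisRep k V),
        N.IsSimple → ∃ l, N.Isomorphic (M l) := by
  -- Here ξ² is a square root of 1, and it is not 1 because ξ has order 4.
  have hξ2 : ξ ^ 2 = -1 := by
    have h4 : (ξ ^ 2) ^ 2 = 1 := by rw [← pow_mul]; exact hξ.pow_eq_one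
    exact (sq_eq_one_iff.1 h4).resolve_left (hξ.pow_ne_one_of_pos_of_lt two_ne_zero (by norm_num))
  choose M hM using Label.exists_hasTable hξ2
  refine ⟨M, hM, fun l => (hM l).isSimple hξ2, fun l m h =>
    Label.eq_of_sameTraces hξ hξ2 (h.sameTraces (hM l) (hM m)), fun V _ _ N hN => ?_⟩
  obtain ⟨l, hl⟩ := hN.exists_realizes hξ hξ2
  exact ⟨l, hl.isomorphic (hM l) ((hM l).isSimple hξ2) hN⟩


theorem theorem4p7 (k : Type u) [Field k] [IsAlgClosed k] [CharZero k] (ξ : k)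
    (hξ : IsPrimitiveRoot ξ 4) :
    -- the list has 88 members, 32 of dimension one and 56 of dimension two
    Fintype.card Label = 88 ∧
    Fintype.card {l : Label // l.dim = 1} = 32 ∧
    Fintype.card {l : Label // l.dim = 2} = 56 ∧
    -- left-right Yetter–Drinfel'd modules
    (∃ M : ∀ l : Label, LeftRightYD k (KashinaH k) (Fin l.dim → k),
      (∀ l, (M l).HasTable (l.table ξ)) ∧
      (∀ l, (M l).IsSimple) ∧
      (∀ l m, (M l).Isomorphic (M m) → l = m) ∧
      ∀ (V : Type w) [AddCommGroup V] [Module k V] (N : LeftRightYD k (KashinaH k) V),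
        N.IsSimple → ∃ l, N.Isomorphic (M l)) ∧
    -- left-left Yetter–Drinfel'd modules
    (∃ M : ∀ l : Label, LeftLeftYD k (KashinaH k) (Fin l.dim → k),
      (∀ l, (M l).HasTable (l.table ξ)) ∧
      (∀ l, (M l).IsSimple) ∧
      (∀ l m, (M l).Isomorphic (M m) → l = m) ∧
      ∀ (V : Type w) [AddCommGroup V] [Module k V] (N : LeftLeftYD k (KashinaH k) V),
        N.IsSimple → ∃ l, N.Isomorphic (M l)) ∧
    -- left modules over the Drinfel'd double
    (∃ M : ∀ l : Label, DoubleModule k (KashinaH k) (Fin l.dim → k),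
      (∀ l, (M l).HasTable (l.table ξ)) ∧
      (∀ l, (M l).IsSimple) ∧
      (∀ l m, (M l).Isomorphic (M m) → l = m) ∧
      ∀ (V : Type w) [AddCommGroup V] [Module k V] (N : DoubleModule k (KashinaH k) V),
        N.IsSimple → ∃ l, N.Isomorphic (M l)) := by
  obtain ⟨M, hM, hS, hI, hC⟩ := BasisRep.classification.{u, w} k ξ hξ
  refine ⟨by decide, by decide, by decide,
    ⟨fun l => LeftRightYD.ofBasisRep (M l), fun l => ?_, fun l => ?_, fun l m h => ?_,
      fun V _ _ N hN => ?_⟩,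
    ⟨fun l => LeftLeftYD.ofBasisRep (M l), fun l => ?_, fun l => ?_, fun l m h => ?_,
      fun V _ _ N hN => ?_⟩,
    ⟨fun l => DoubleModule.ofBasisRep (M l), fun l => ?_, fun l => ?_, fun l m h => ?_,
      fun V _ _ N hN => ?_⟩⟩
  · exact LeftRightYD.hasTable_of_toBasisRep (by rw [LeftRightYD.toBasisRep_ofBasisRep]; exact hM l)
  · rw [LeftRightYD.isSimple_iff, LeftRightYD.toBasisRep_ofBasisRep]; exact hS l
  · rw [LeftRightYD.isomorphic_iff, LeftRightYD.toBasisRep_ofBasisRep,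
      LeftRightYD.toBasisRep_ofBasisRep] at h
    exact hI l m h
  · obtain ⟨l, hl⟩ := hC V N.toBasisRep (N.isSimple_iff.1 hN)
    exact ⟨l, by rwa [LeftRightYD.isomorphic_iff, LeftRightYD.toBasisRep_ofBasisRep]⟩
  · exact LeftLeftYD.hasTable_of_toBasisRep (by rw [LeftLeftYD.toBasisRep_ofBasisRep]; exact hM l)
  · rw [LeftLeftYD.isSimple_iff, LeftLeftYD.toBasisRep_ofBasisRep]; exact hS l
  · rw [LeftLeftYD.isomorphic_iff, LeftLeftYD.toBasisRep_ofBasisRep,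
      LeftLeftYD.toBasisRep_ofBasisRep] at h
    exact hI l m h
  · obtain ⟨l, hl⟩ := hC V N.toBasisRep (N.isSimple_iff.1 hN)
    exact ⟨l, by rwa [LeftLeftYD.isomorphic_iff, LeftLeftYD.toBasisRep_ofBasisRep]⟩
  · exact DoubleModule.hasTable_of_toBasisRep
      (by rw [DoubleModule.toBasisRep_ofBasisRep]; exact hM l)
  · rw [DoubleModule.isSimple_iff, DoubleModule.toBasisRep_ofBasisRep]; exact hS l
  · rw [DoubleModule.isomorphic_iff, DoubleModule.toBasisRep_ofBasisRep,
      DoubleModule.toBasisRep_ofBasisRep] at h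
    exact hI l m h
  · obtain ⟨l, hl⟩ := hC V N.toBasisRep (N.isSimple_iff.1 hN)
    exact ⟨l, by rwa [DoubleModule.isomorphic_iff, DoubleModule.toBasisRep_ofBasisRep]⟩
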